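/- Let $k\ge 1$ be an integer, let $\mathbb{A}^1$ be the complex affine line with coordinate $z$, and let $\mathcal{T}_{\mathbb{A}^1}(-k\cdot 0)$ be the Lie algebroid on $\mathbb{A}^1$ whose sections over an open set $U$ are the holomorphic vector fields $f\,\partial_z$ on $U$ with $f\in z^k\mathcal{O}(U)$, with the usual bracket of vector fields and with anchor the inclusion into all vector fields. An integration of a Lie algebroid $\mathcal{A}$ is a holomorphic Lie groupoid together with an isomorphism from its Lie algebroid to $\mathcal{A}$. A Lie groupoid is source-simply connected if the fibres of its source map are connected and simply connected. The Stokes groupoid $\mathsf{Sto}_k=\Pi(\mathbb{A}^1,k\cdot 0)$ is the source-simply connected integration of $\mathcal{T}_{\mathbb{A}^1}(-k\cdot 0)$, which is unique up to isomorphism of Lie groupoids over $\mathbb{A}^1$. Then $\mathsf{Sto}_k$ may be identified with $\mathbb{C}\times\mathbb{A}^1$, with coordinates $(z,u)$, $z\in\mathbb{A}^1$, $u\in\mathbb{C}$, and with groupoid structure $$s(z,u)=z,\qquad t(z,u)=\exp(u z^{k-1})\,z,\qquad (z_2,u_2)\cdot(z_1,u_1)=\bigl(z_1,\;u_2\exp((k-1)u_1z_1^{k-1})+u_1\bigr),$$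 the product being defined when $s(z_2,u_2)=t(z_1,u_1)$. That is: these formulas define a holomorphic Lie groupoid over $\mathbb{A}^1$ which is source-simply connected and integrates $\mathcal{T}_{\mathbb{A}^1}(-k\cdot 0)$, and every source-simply connected (Hausdorff) holomorphic Lie groupoid over $\mathbb{A}^1$ integrating $\mathcal{T}_{\mathbb{A}^1}(-k\cdot 0)$ is isomorphic to it, by an isomorphism that is the identity on $\mathbb{A}^1$. -/

import Mathlib

open scoped Manifold ContDiff Topology
open TopologicalSpace (Opens)

noncomputable section

section General

variable {EG EX : Type*}
  [NormedAddCommGroup EG] [NormedSpace ℂ EG] [FiniteDimensional ℂ EG]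
  [NormedAddCommGroup EX] [NormedSpace ℂ EX] [FiniteDimensional ℂ EX]

/-- A holomorphic Lie groupoid with complex manifold of arrows `G` (modelled on `EG`) and complex
manifold of objects `X` (modelled on `EX`).  Over `ℂ`, the regularity `ω` means holomorphic.

The product `mul g h` is the composite "`h` first, then `g`"; only its values on the composable
pairs, those with `src g = tgt h`, carry meaning, and all axioms concern composable pairs only. -/
structure HolLieGroupoid (EG EX : Type*)
    [NormedAddCommGroup EG] [NormedSpace ℂ EG] [FiniteDimensional ℂ EG]
    [NormedAddCommGroup EX] [NormedSpace ℂ EX] [FiniteDimensional ℂ EX]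
    (G X : Type*)
    [TopologicalSpace G] [T2Space G] [ChartedSpace EG G] [IsManifold 𝓘(ℂ, EG) ω G]
    [TopologicalSpace X] [T2Space X] [ChartedSpace EX X] [IsManifold 𝓘(ℂ, EX) ω X] where
  /-- source -/
  src : G → X
  /-- target -/
  tgt : G → X
  /-- identity arrows -/
  one : X → G
  /-- composition of arrows -/
  mul : G → G → G
  /-- inverse arrows -/
  inv : G → G
  src_one : ∀ x, src (one x) = x
  tgt_one : ∀ x, tgt (one x) = x
  src_mul : ∀ g h, src g = tgt h → src (mul g h) = src h
  tgt_mul : ∀ g h, src g = tgt h → tgt (mul g h) = tgt g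
  mul_assoc : ∀ g h l, src g = tgt h → src h = tgt l → mul (mul g h) l = mul g (mul h l)
  one_mul : ∀ g, mul (one (tgt g)) g = g
  mul_one : ∀ g, mul g (one (src g)) = g
  src_inv : ∀ g, src (inv g) = tgt g
  tgt_inv : ∀ g, tgt (inv g) = src g
  inv_mul : ∀ g, mul (inv g) g = one (src g)
  mul_inv : ∀ g, mul g (inv g) = one (tgt g)
  holomorphic_src : ContMDiff 𝓘(ℂ, EG) 𝓘(ℂ, EX) ω src
  submersion_src : ∀ g, Function.Surjective (mfderiv 𝓘(ℂ, EG) 𝓘(ℂ, EX) src g)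
  holomorphic_tgt : ContMDiff 𝓘(ℂ, EG) 𝓘(ℂ, EX) ω tgt
  submersion_tgt : ∀ g, Function.Surjective (mfderiv 𝓘(ℂ, EG) 𝓘(ℂ, EX) tgt g)
  holomorphic_one : ContMDiff 𝓘(ℂ, EX) 𝓘(ℂ, EG) ω one
  closedEmbedding_one : Topology.IsClosedEmbedding one
  holomorphic_mul : ContMDiffOn (𝓘(ℂ, EG).prod 𝓘(ℂ, EG)) 𝓘(ℂ, EG) ω
    (fun p : G × G => mul p.1 p.2) {p | src p.1 = tgt p.2}
  holomorphic_inv : ContMDiff 𝓘(ℂ, EG) 𝓘(ℂ, EG) ω inv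

/-- The ring `𝒪(U)` of holomorphic functions on an open subset `U` of a complex manifold. -/
def holFun {X : Type*} [TopologicalSpace X] [ChartedSpace EX X] (U : Opens X) :
    Subalgebra ℂ (U → ℂ) where
  carrier := {f | ContMDiff 𝓘(ℂ, EX) 𝓘(ℂ, ℂ) ω f}
  mul_mem' hf hg := ContMDiff.mul hf hg
  add_mem' hf hg := ContMDiff.add hf hg
  algebraMap_mem' _ := contMDiff_const

variable {G X : Type*}
  [TopologicalSpace G] [T2Space G] [ChartedSpace EG G] [IsManifold 𝓘(ℂ, EG) ω G]
  [TopologicalSpace X] [T2Space X] [ChartedSpace EX X] [IsManifold 𝓘(ℂ, EX) ω X]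

namespace HolLieGroupoid

/-- The fibres of the source map are connected and simply connected. -/
def SourceSimplyConnected (𝒢 : HolLieGroupoid EG EX G X) : Prop :=
  ∀ x : X, SimplyConnectedSpace (𝒢.src ⁻¹' {x})

/-- Transport of a tangent vector along an equality of base points. -/
def castTangent {F M : Type*} [NormedAddCommGroup F] [NormedSpace ℂ F] [TopologicalSpace M]
    [ChartedSpace F M] {a b : M} (h : a = b) (v : TangentSpace 𝓘(ℂ, F) a) :
    TangentSpace 𝓘(ℂ, F) b :=
  h ▸ v

/-- A field `v` of tangent vectors of `G` along the identity arrows over `U` is holomorphic. -/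
def HolAlong (𝒢 : HolLieGroupoid EG EX G X) (U : Opens X)
    (v : (x : U) → TangentSpace 𝓘(ℂ, EG) (𝒢.one x)) : Prop :=
  ContMDiff 𝓘(ℂ, EX) 𝓘(ℂ, EG).tangent ω
    (fun x : U => (⟨𝒢.one x, v x⟩ : TangentBundle 𝓘(ℂ, EG) G))

theorem holAlong_iff (𝒢 : HolLieGroupoid EG EX G X) (U : Opens X)
    (v : (x : U) → TangentSpace 𝓘(ℂ, EG) (𝒢.one x)) :
    𝒢.HolAlong U v ↔ ∀ x₀ : U, ContMDiffAt 𝓘(ℂ, EX) 𝓘(ℂ, EG) ω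
      (fun x : U => (trivializationAt EG (TangentSpace 𝓘(ℂ, EG)) (𝒢.one x₀)
        ⟨𝒢.one x, v x⟩).2) x₀ := by
  have h1 : ContMDiff 𝓘(ℂ, EX) 𝓘(ℂ, EG) ω (fun x : U => 𝒢.one x) :=
    𝒢.holomorphic_one.comp contMDiff_subtype_val
  refine forall_congr' fun x₀ => ?_
  rw [ModelWithCorners.tangent, Bundle.contMDiffAt_totalSpace]
  exact ⟨fun h => h.2, fun h => ⟨h1 x₀, h⟩⟩

theorem eventually_mem_baseSet (𝒢 : HolLieGroupoid EG EX G X) (U : Opens X) (x₀ : U) :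
    ∀ᶠ x : U in 𝓝 x₀,
      𝒢.one x ∈ (trivializationAt EG (TangentSpace 𝓘(ℂ, EG)) (𝒢.one x₀)).baseSet := by
  have h1 : Continuous (fun x : U => 𝒢.one x) :=
    𝒢.holomorphic_one.continuous.comp continuous_subtype_val
  exact h1.continuousAt.eventually_mem
    ((trivializationAt EG (TangentSpace 𝓘(ℂ, EG)) (𝒢.one x₀)).open_baseSet.mem_nhds
      (FiberBundle.mem_baseSet_trivializationAt' _))

theorem HolAlong.add {𝒢 : HolLieGroupoid EG EX G X} {U : Opens X}
    {v w : (x : U) → TangentSpace 𝓘(ℂ, EG) (𝒢.one x)}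
    (hv : 𝒢.HolAlong U v) (hw : 𝒢.HolAlong U w) : 𝒢.HolAlong U (v + w) := by
  rw [holAlong_iff] at *
  intro x₀
  refine ((hv x₀).add (hw x₀)).congr_of_eventuallyEq ?_
  filter_upwards [𝒢.eventually_mem_baseSet U x₀] with x hx
  exact ((trivializationAt EG (TangentSpace 𝓘(ℂ, EG)) (𝒢.one x₀)).linear ℂ hx).1 _ _

theorem HolAlong.smul {𝒢 : HolLieGroupoid EG EX G X} {U : Opens X} {f : U → ℂ}
    {v : (x : U) → TangentSpace 𝓘(ℂ, EG) (𝒢.one x)}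
    (hf : ContMDiff 𝓘(ℂ, EX) 𝓘(ℂ, ℂ) ω f) (hv : 𝒢.HolAlong U v) :
    𝒢.HolAlong U (fun x => f x • v x) := by
  rw [holAlong_iff] at *
  intro x₀
  refine ((hf x₀).smul (hv x₀)).congr_of_eventuallyEq ?_
  filter_upwards [𝒢.eventually_mem_baseSet U x₀] with x hx
  exact ((trivializationAt EG (TangentSpace 𝓘(ℂ, EG)) (𝒢.one x₀)).linear ℂ hx).2 _ _

theorem HolAlong.zero (𝒢 : HolLieGroupoid EG EX G X) (U : Opens X) : 𝒢.HolAlong U 0 := by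
  rw [holAlong_iff]
  intro x₀
  refine (contMDiffAt_const (c := (0 : EG))).congr_of_eventuallyEq ?_
  filter_upwards [𝒢.eventually_mem_baseSet U x₀] with x hx
  exact ((trivializationAt EG (TangentSpace 𝓘(ℂ, EG)) (𝒢.one x₀)).linear ℂ hx).map_zero

/-- The `𝒪(U)`-module of sections over `U` of the Lie algebroid of `𝒢`.  The normal bundle of the
identity embedding is represented by its canonical complement to the tangent spaces of the identity
arrows: the kernel of the derivative of the source map at the identity arrows. -/
def lieSections (𝒢 : HolLieGroupoid EG EX G X) (U : Opens X) :
    Submodule (holFun (EX := EX) U) ((x : U) → TangentSpace 𝓘(ℂ, EG) (𝒢.one x)) where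
  carrier := {v | 𝒢.HolAlong U v ∧
    ∀ x : U, mfderiv 𝓘(ℂ, EG) 𝓘(ℂ, EX) 𝒢.src (𝒢.one x) (v x) = 0}
  add_mem' hv hw := ⟨hv.1.add hw.1, fun x =>
    (map_add _ _ _).trans (by rw [hv.2 x, hw.2 x, add_zero])⟩
  zero_mem' := ⟨HolAlong.zero 𝒢 U, fun _ => map_zero _⟩
  smul_mem' f _ hv := ⟨HolAlong.smul f.2 hv.1, fun x =>
    (map_smul _ _ _).trans (by rw [hv.2 x, smul_zero])⟩

/-- The anchor: the derivative of the target map at the identity arrows. -/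
def anchor (𝒢 : HolLieGroupoid EG EX G X) (x : X) (v : TangentSpace 𝓘(ℂ, EG) (𝒢.one x)) :
    TangentSpace 𝓘(ℂ, EX) x :=
  castTangent (𝒢.tgt_one x) (mfderiv 𝓘(ℂ, EG) 𝓘(ℂ, EX) 𝒢.tgt (𝒢.one x) v)

open Classical in
/-- The right-invariant vector field on `tgt ⁻¹' U` (extended by zero) that restricts to `v` on the
identity arrows: its value at `g` is the image of the value of `v` at `tgt g` under the derivative
of right translation by `g`, a map from the source fibre of `tgt g` to that of `src g`. -/
def rightInvariant (𝒢 : HolLieGroupoid EG EX G X) (U : Opens X)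
    (v : (x : U) → TangentSpace 𝓘(ℂ, EG) (𝒢.one x)) (g : G) : TangentSpace 𝓘(ℂ, EG) g :=
  if h : 𝒢.tgt g ∈ U then
    castTangent (𝒢.one_mul g)
      (mfderivWithin 𝓘(ℂ, EG) 𝓘(ℂ, EG) (fun a => 𝒢.mul a g) (𝒢.src ⁻¹' {𝒢.tgt g})
        (𝒢.one (𝒢.tgt g)) (v ⟨𝒢.tgt g, h⟩))
  else 0

/-- The Lie bracket of two sections of the Lie algebroid of `𝒢`: the bracket of the corresponding
right-invariant vector fields, restricted to the identity arrows. -/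
def lieBracket (𝒢 : HolLieGroupoid EG EX G X) (U : Opens X)
    (v w : (x : U) → TangentSpace 𝓘(ℂ, EG) (𝒢.one x)) (x : U) : TangentSpace 𝓘(ℂ, EG) (𝒢.one x) :=
  VectorField.mlieBracket 𝓘(ℂ, EG) (𝒢.rightInvariant U v) (𝒢.rightInvariant U w) (𝒢.one x)

/-- An isomorphism of Lie groupoids over `X`: a biholomorphic functor that is the identity on
objects. -/
structure Iso {EH H : Type*} [NormedAddCommGroup EH] [NormedSpace ℂ EH] [FiniteDimensional ℂ EH]
    [TopologicalSpace H] [T2Space H] [ChartedSpace EH H] [IsManifold 𝓘(ℂ, EH) ω H]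
    (𝒢 : HolLieGroupoid EG EX G X) (ℋ : HolLieGroupoid EH EX H X) where
  toDiffeomorph : Diffeomorph 𝓘(ℂ, EG) 𝓘(ℂ, EH) G H ω
  map_src : ∀ g, ℋ.src (toDiffeomorph g) = 𝒢.src g
  map_tgt : ∀ g, ℋ.tgt (toDiffeomorph g) = 𝒢.tgt g
  map_one : ∀ x, toDiffeomorph (𝒢.one x) = ℋ.one x
  map_mul : ∀ g h, 𝒢.src g = 𝒢.tgt h →
    toDiffeomorph (𝒢.mul g h) = ℋ.mul (toDiffeomorph g) (toDiffeomorph h)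

end HolLieGroupoid

end General

/-- The `𝒪(U)`-module of sections over `U ⊆ ℂ` of the Lie algebroid `𝒯(-k·0)`: the holomorphic
vector fields `f ∂_z` on `U` such that `f` is a multiple of `z ^ k` in `𝒪(U)`.  The anchor is the
inclusion into all vector fields, and the bracket is the bracket of vector fields. -/
def twistedTangent (k : ℕ) (U : Opens ℂ) : Submodule (holFun (EX := ℂ) U) (U → ℂ) where
  carrier := {f | ∃ g ∈ holFun (EX := ℂ) U, ∀ z : U, f z = (z : ℂ) ^ k * g z}
  add_mem' := by
    rintro _ _ ⟨g, hg, h⟩ ⟨g', hg', h'⟩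
    exact ⟨g + g', add_mem hg hg', fun z => by simp [h z, h' z, mul_add]⟩
  zero_mem' := ⟨0, zero_mem _, fun z => by simp⟩
  smul_mem' := by
    rintro c f ⟨g, hg, h⟩
    refine ⟨c.1 * g, mul_mem c.2 hg, fun z => ?_⟩
    have hc : (c • f) z = c.1 z * f z := rfl
    rw [hc, h z, Pi.mul_apply]
    ring

open Classical in
/-- Extension by zero of a function on an open subset of `ℂ`. -/
def extendZero (U : Opens ℂ) (f : U → ℂ) (z : ℂ) : ℂ := if h : z ∈ U then f ⟨z, h⟩ else 0

/-- The Lie bracket of the vector fields `f ∂_z` and `g ∂_z` on the open set `U`. -/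
def vfBracket (U : Opens ℂ) (f g : U → ℂ) (z : U) : ℂ :=
  VectorField.lieBracket ℂ (extendZero U f) (extendZero U g) z

namespace HolLieGroupoid

variable {EG : Type*} [NormedAddCommGroup EG] [NormedSpace ℂ EG] [FiniteDimensional ℂ EG]
  {G : Type*} [TopologicalSpace G] [T2Space G] [ChartedSpace EG G] [IsManifold 𝓘(ℂ, EG) ω G]

/-- An isomorphism of Lie algebroids from the Lie algebroid of `𝒢` to `𝒯(-k·0)`: an isomorphism of
sheaves of `𝒪`-modules that is compatible with the anchors and with the Lie brackets.  With it, `𝒢`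
is an integration of `𝒯(-k·0)`. -/
structure Integration (𝒢 : HolLieGroupoid EG ℂ G ℂ) (k : ℕ) where
  toEquiv : ∀ U : Opens ℂ, 𝒢.lieSections U ≃ₗ[holFun (EX := ℂ) U] twistedTangent k U
  map_restrict : ∀ (U V : Opens ℂ) (hUV : U ≤ V) (v : 𝒢.lieSections V) (w : 𝒢.lieSections U),
    (∀ z : U, w.1 z = v.1 ⟨z, hUV z.2⟩) →
      ∀ z : U, (toEquiv U w).1 z = (toEquiv V v).1 ⟨z, hUV z.2⟩
  map_anchor : ∀ (U : Opens ℂ) (v : 𝒢.lieSections U) (z : U),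
    (toEquiv U v).1 z = NormedSpace.fromTangentSpace (z : ℂ) (𝒢.anchor z (v.1 z))
  map_bracket : ∀ (U : Opens ℂ) (v w : 𝒢.lieSections U), ∃ b : 𝒢.lieSections U,
    b.1 = 𝒢.lieBracket U v.1 w.1 ∧
      (toEquiv U b).1 = vfBracket U (toEquiv U v).1 (toEquiv U w).1

/-- `𝒢` is a source-simply connected integration of `𝒯(-k·0)`, that is, `𝒢` is a Stokes groupoid
`Sto_k = Π(𝔸¹, k·0)`. -/
def IsStokesGroupoid (𝒢 : HolLieGroupoid EG ℂ G ℂ) (k : ℕ) : Prop :=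
  𝒢.SourceSimplyConnected ∧ Nonempty (𝒢.Integration k)

end HolLieGroupoid

end

/-! Existence is a computation. With the explicit formulas every source fibre is a copy of `ℂ`, Lie
algebroid sections are vertical vectors `(0, a(z))` with anchor `z^k a`, and their bracket comes
from the right-invariant fields `(0, a(t) * factor)`.

For uniqueness it is enough to find, on any source-simply connected integration, a holomorphic
function `u` with `t = exp(u s^(k-1)) s` that obeys the cocycle identity of the product and
restricts to a coordinate on source fibres near the identities. Then `(s, u)` is the isomorphism.

Near an identity arrow, the generator of the algebroid with anchor `z^k ∂_z` provides coordinates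
`(z, y)` with `z` the source. Right invariance makes the target `T` solve `∂T/∂y = T^k *
(holomorphic)`, with `T(z, 0) = z`. Hence `T` vanishes on `z = 0`, `T - z` is divisible by `z^k`,
and `T = z exp(z^(k-1) u)` for a holomorphic `u`, which can replace `y` (`exists_eq_mul_exp`,
`Integration.nonempty_logChart`).

To globalise, divisibility is spread from the identities over the connected source fibres by left
multiplication with small arrows (`eq_univ_of_mul_mem`). This gives `t = s m` with `m`
multiplicative and nowhere zero. Simple connectedness of the source fibres gives an additive
logarithm `L` of `m`, and `L = s^(k-1) u`. Identities for `u` are proved where `s ≠ 0` by cancelling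
powers of `s`, and extended by continuity (`exists_global_coordinate`).

Finally `u` is a covering map from each source fibre to `ℂ`, because right translation carries one
chart to all points of a fibre of `u` at once. Since `ℂ` is simply connected and the source fibre is
connected, it is a bijection (`GlobalCoordinate.bijective_fibre`), and the inverse of `(s, u)` is
locally a product of holomorphic families of arrows. -/

noncomputable section

/-! ### Holomorphic functions of two variables: division, and the local form of the target map. -/

section Analysis

open MeasureTheory Metric

/-- Integration of a bounded continuous function on the plane against an integrable weight. -/
def weightedIntegral (w : ℝ × ℝ → ℂ) (S : Set (ℝ × ℝ)) (hw : IntegrableOn w S) :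
    BoundedContinuousFunction (ℝ × ℝ) ℂ →L[ℂ] ℂ :=
  have hi : ∀ h : BoundedContinuousFunction (ℝ × ℝ) ℂ, IntegrableOn (fun q => w q * h q) S :=
    fun h => hw.mul_bdd h.continuous.aestronglyMeasurable
      (Filter.Eventually.of_forall h.norm_coe_le_norm)
  LinearMap.mkContinuous
    { toFun := fun h => ∫ q in S, w q * h q
      map_add' := fun h h' => by
        rw [← integral_add (hi h) (hi h')]
        simp [mul_add]
      map_smul' := fun c h => by
        rw [← integral_smul]
        simp [mul_left_comm] }
    (∫ q in S, ‖w q‖) fun h => by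
      refine (norm_integral_le_integral_norm _).trans ?_
      rw [← integral_mul_const]
      refine integral_mono (hi h).norm (hw.norm.mul_const _) fun q => ?_
      simpa using mul_le_mul_of_nonneg_left (h.norm_coe_le_norm q) (norm_nonneg (w q))

theorem weightedIntegral_apply (w : ℝ × ℝ → ℂ) (S : Set (ℝ × ℝ)) (hw : IntegrableOn w S)
    (h : BoundedContinuousFunction (ℝ × ℝ) ℂ) :
    weightedIntegral w S hw h = ∫ q in S, w q * h q := rfl

/-- The bounded function on the plane obtained from the parametrization of a circle. -/
def circleBCF (r : ℝ) (p : ℝ × ℝ → ℝ) (hp : Continuous p) :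
    BoundedContinuousFunction (ℝ × ℝ) ℂ :=
  BoundedContinuousFunction.ofNormedAddCommGroup (fun q => circleMap 0 r (p q))
    ((continuous_circleMap 0 r).comp hp) |r| fun q => by simp

theorem isUnit_circleBCF {r : ℝ} (hr : 0 < r) (p : ℝ × ℝ → ℝ) (hp : Continuous p) :
    IsUnit (circleBCF r p hp) := by
  have h0 : ∀ q, circleMap 0 r (p q) ≠ 0 := fun q => circleMap_ne_center hr.ne'
  refine IsUnit.of_mul_eq_one (BoundedContinuousFunction.ofNormedAddCommGroup
    (fun q => (circleMap 0 r (p q))⁻¹) (((continuous_circleMap 0 r).comp hp).inv₀ h0)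
    |r|⁻¹ fun q => by simp) ?_
  ext q
  exact mul_inv_cancel₀ (h0 q)

/-- Inversion in the Banach algebra of bounded continuous functions is analytic at units, and the
parametrized circle is a unit because it avoids the origin. -/
theorem analyticAt_inverse_circleBCF {r : ℝ} (hr : 0 < r) (p : ℝ × ℝ → ℝ) (hp : Continuous p)
    (l : ℂ × ℂ →L[ℂ] ℂ) :
    AnalyticAt ℂ (fun v : ℂ × ℂ => Ring.inverse
      (circleBCF r p hp - BoundedContinuousFunction.const _ (l v))) 0 ∧
    ∀ᶠ v in 𝓝 (0 : ℂ × ℂ), ∀ q, (Ring.inverse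
      (circleBCF r p hp - BoundedContinuousFunction.const _ (l v)) :
        BoundedContinuousFunction (ℝ × ℝ) ℂ) q = (circleMap 0 r (p q) - l v)⁻¹ := by
  have hc : (fun v : ℂ × ℂ => circleBCF r p hp - BoundedContinuousFunction.const _ (l v))
      = fun v => circleBCF r p hp - (l v) • (1 : BoundedContinuousFunction (ℝ × ℝ) ℂ) := by
    ext v q
    simp
  have ha : AnalyticAt ℂ (fun v : ℂ × ℂ =>
      circleBCF r p hp - BoundedContinuousFunction.const _ (l v)) 0 := by
    rw [hc]
    exact analyticAt_const.sub ((l.analyticAt 0).smul analyticAt_const)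
  have h0 : circleBCF r p hp - BoundedContinuousFunction.const _ (l 0) = circleBCF r p hp := by
    ext q
    simp
  have hu : IsUnit (circleBCF r p hp - BoundedContinuousFunction.const _ (l 0)) := by
    rw [h0]
    exact isUnit_circleBCF hr p hp
  refine ⟨?_, ?_⟩
  · obtain ⟨x, hx⟩ := hu
    have := analyticAt_inverse (𝕜 := ℂ) x
    rw [hx] at this
    exact this.comp (g := Ring.inverse) (f := fun v => circleBCF r p hp -
      BoundedContinuousFunction.const _ (l v)) ha
  · filter_upwards [ha.continuousAt.eventually_mem (Units.isOpen.mem_nhds hu)] with v hv q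
    have h1 : circleBCF r p hp - BoundedContinuousFunction.const _ (l v) ∈ {x | IsUnit x} := hv
    have h2 := congrArg (fun f : BoundedContinuousFunction (ℝ × ℝ) ℂ => f q)
      (Ring.mul_inverse_cancel _ h1)
    exact eq_inv_of_mul_eq_one_right h2

/-- The kernel is an analytic map into a Banach algebra followed by a continuous linear functional,
so analyticity is joint in both variables without differentiating under the integral. -/
theorem analyticAt_cauchyKernel {r : ℝ} (hr : 0 < r) (w : ℝ × ℝ → ℂ) (S : Set (ℝ × ℝ))
    (hw : IntegrableOn w S) :
    AnalyticAt ℂ (fun v : ℂ × ℂ => ∫ q in S, w q *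
      ((circleMap 0 r q.1 - v.1)⁻¹ * (circleMap 0 r q.2 - v.2)⁻¹)) 0 := by
  obtain ⟨h1, h1'⟩ := analyticAt_inverse_circleBCF hr Prod.fst continuous_fst
    (ContinuousLinearMap.fst ℂ ℂ ℂ)
  obtain ⟨h2, h2'⟩ := analyticAt_inverse_circleBCF hr Prod.snd continuous_snd
    (ContinuousLinearMap.snd ℂ ℂ ℂ)
  refine (((weightedIntegral w S hw).analyticAt _).comp (h1.mul h2)).congr ?_
  filter_upwards [h1', h2'] with v hv hv'
  simp only [Function.comp_apply, weightedIntegral_apply, Pi.mul_apply,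
    BoundedContinuousFunction.mul_apply, hv, hv']
  rfl

/-- Division with remainder of a holomorphic function of two variables by the first variable. -/
theorem AnalyticAt.exists_eq_add_mul {f : ℂ × ℂ → ℂ} (hf : AnalyticAt ℂ f 0) :
    ∃ g : ℂ × ℂ → ℂ, AnalyticAt ℂ g 0 ∧ ∀ᶠ v in 𝓝 (0 : ℂ × ℂ), f v = f (0, v.2) + v.1 * g v := by
  obtain ⟨ε, hε, hball⟩ := Metric.eventually_nhds_iff_ball.1 hf.eventually_analyticAt
  obtain ⟨r, hr, hrε⟩ := exists_between hε
  have hfa : ∀ z y : ℂ, ‖z‖ ≤ r → ‖y‖ ≤ r → AnalyticAt ℂ f (z, y) := fun z y hz hy => by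
    refine hball _ ?_
    rw [mem_ball_zero_iff, Prod.norm_def]
    exact (max_le hz hy).trans_lt hrε
  have hd1 : ∀ y : ℂ, ‖y‖ ≤ r → DifferentiableOn ℂ (fun z => f (z, y)) (closedBall 0 r) :=
    fun y hy z hz => ((hfa z y (by simpa using hz) hy).differentiableAt.comp z
      (differentiableAt_id.prodMk (differentiableAt_const y))).differentiableWithinAt
  have hd2 : ∀ z : ℂ, ‖z‖ ≤ r → DifferentiableOn ℂ (fun y => f (z, y)) (closedBall 0 r) :=
    fun z hz y hy => ((hfa z y hz (by simpa using hy)).differentiableAt.comp y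
      ((differentiableAt_const z).prodMk differentiableAt_id)).differentiableWithinAt
  set S : Set (ℝ × ℝ) := Set.Ioc 0 (2 * Real.pi) ×ˢ Set.Ioc 0 (2 * Real.pi) with hS
  have hπ : (0 : ℝ) ≤ 2 * Real.pi := by positivity
  let c : ℂ := (2 * Real.pi * Complex.I)⁻¹
  have hc : 2 * Real.pi * Complex.I * c = 1 := mul_inv_cancel₀ (by simp [Real.pi_ne_zero])
  -- The extra factor `1/ζ` turns the Cauchy kernel in the first variable into `1/(ζ(ζ - z)) = (1/(ζ
  -- - z) - 1/ζ)/z`, the kernel of the difference quotient `(f(z, y) - f(0, y))/z`.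
  let w : ℝ × ℝ → ℂ := fun q => c * c * (deriv (circleMap 0 r) q.1 * deriv (circleMap 0 r) q.2 *
    ((circleMap 0 r q.1)⁻¹ * f (circleMap 0 r q.1, circleMap 0 r q.2)))
  have hn : ∀ θ, ‖circleMap 0 r θ‖ = r := fun θ => by simp [abs_of_pos hr]
  have hne : ∀ θ, circleMap 0 r θ ≠ 0 := fun θ => circleMap_ne_center hr.ne'
  have hcm1 : Continuous fun q : ℝ × ℝ => circleMap 0 r q.1 :=
    (continuous_circleMap 0 r).comp continuous_fst
  have hcm2 : Continuous fun q : ℝ × ℝ => circleMap 0 r q.2 :=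
    (continuous_circleMap 0 r).comp continuous_snd
  have hfc : Continuous fun q : ℝ × ℝ => f (circleMap 0 r q.1, circleMap 0 r q.2) :=
    continuous_iff_continuousAt.2 fun q => ContinuousAt.comp (f := fun q : ℝ × ℝ =>
      (circleMap 0 r q.1, circleMap 0 r q.2)) (hfa _ _ (hn _).le (hn _).le).continuousAt
      (hcm1.prodMk hcm2).continuousAt
  have hwc : Continuous w := by
    simp only [w, deriv_circleMap]
    exact continuous_const.mul (((hcm1.mul continuous_const).mul (hcm2.mul continuous_const)).mul
      ((hcm1.inv₀ fun q => hne _).mul hfc))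
  have hint : ∀ h : ℝ × ℝ → ℂ, Continuous h → IntegrableOn h S := fun h hh =>
    (hh.continuousOn.integrableOn_compact (isCompact_Icc.prod isCompact_Icc)).mono_set
      (Set.prod_mono Set.Ioc_subset_Icc_self Set.Ioc_subset_Icc_self)
  refine ⟨_, analyticAt_cauchyKernel hr w S (hint w hwc), ?_⟩
  filter_upwards [Metric.ball_mem_nhds 0 hr] with v hv
  have hv1 : ‖v.1‖ < r := (norm_fst_le v).trans_lt (by simpa using hv)
  have hv2 : ‖v.2‖ < r := (norm_snd_le v).trans_lt (by simpa using hv)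
  have hs : ∀ x : ℂ, ‖x‖ < r → ∀ θ, circleMap 0 r θ - x ≠ 0 := fun x hx θ h => by
    rw [sub_eq_zero] at h
    exact absurd (hn θ) (by rw [h]; exact hx.ne)
  rw [Measure.volume_eq_prod, setIntegral_prod _ (by
    rw [← Measure.volume_eq_prod]
    exact hint _ (hwc.mul (((hcm1.sub continuous_const).inv₀ fun q => hs _ hv1 _).mul
      ((hcm2.sub continuous_const).inv₀ fun q => hs _ hv2 _))))]
  -- The inner integral is Cauchy's formula in the second variable.
  have hin : ∀ θ : ℝ, (∫ θ' in Set.Ioc 0 (2 * Real.pi), w (θ, θ') *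
      ((circleMap 0 r θ - v.1)⁻¹ * (circleMap 0 r θ' - v.2)⁻¹)) =
      c * (deriv (circleMap 0 r) θ • ((circleMap 0 r θ)⁻¹ * (circleMap 0 r θ - v.1)⁻¹ *
        f (circleMap 0 r θ, v.2))) := fun θ => by
    have h := (hd2 _ (hn θ).le).circleIntegral_sub_inv_smul (w := v.2) (by simpa using hv2)
    rw [circleIntegral, intervalIntegral.integral_of_le hπ] at h
    calc _ = ∫ θ' in Set.Ioc 0 (2 * Real.pi), (c * c * deriv (circleMap 0 r) θ *
          ((circleMap 0 r θ)⁻¹ * (circleMap 0 r θ - v.1)⁻¹)) *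
          (deriv (circleMap 0 r) θ' • (circleMap 0 r θ' - v.2)⁻¹ •
            f (circleMap 0 r θ, circleMap 0 r θ')) := by
          refine integral_congr_ae (Filter.Eventually.of_forall fun θ' => ?_)
          simp only [w, smul_eq_mul]
          ring
      _ = _ := by
          rw [integral_const_mul, h]
          simp only [smul_eq_mul]
          linear_combination (c * deriv (circleMap 0 r) θ * ((circleMap 0 r θ)⁻¹ *
            (circleMap 0 r θ - v.1)⁻¹) * f (circleMap 0 r θ, v.2)) * hc
  simp only [hin]
  have h1 := (hd1 _ hv2.le).circleIntegral_sub_inv_smul (w := v.1) (by simpa using hv1)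
  have h0 := (hd1 _ hv2.le).circleIntegral_sub_inv_smul (w := 0) (by simpa using hr)
  rw [circleIntegral, intervalIntegral.integral_of_le hπ] at h1 h0
  have hfc2 : Continuous fun θ => f (circleMap 0 r θ, v.2) :=
    continuous_iff_continuousAt.2 fun q => ContinuousAt.comp (f := fun q : ℝ =>
      (circleMap 0 r q, v.2)) (hfa _ _ (hn _).le hv2.le).continuousAt
      ((continuous_circleMap 0 r).prodMk continuous_const).continuousAt
  have hint1 : ∀ h : ℝ → ℂ, Continuous h → IntegrableOn h (Set.Ioc 0 (2 * Real.pi)) :=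
    fun h hh => (hh.continuousOn.integrableOn_compact isCompact_Icc).mono_set
      Set.Ioc_subset_Icc_self
  have hcont : ∀ x : ℂ, ‖x‖ < r → Continuous fun θ => deriv (circleMap 0 r) θ •
      (circleMap 0 r θ - x)⁻¹ • f (circleMap 0 r θ, v.2) := fun x hx => by
    simp only [deriv_circleMap]
    exact ((continuous_circleMap 0 r).mul continuous_const).smul
      ((((continuous_circleMap 0 r).sub continuous_const).inv₀ (hs x hx)).smul hfc2)
  have hdiff := integral_sub (hint1 _ (hcont _ hv1)) (hint1 _ (hcont 0 (by simpa using hr)))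
  rw [h1, h0] at hdiff
  -- Multiplying by `z` splits the kernel into `1/(ζ - z) - 1/ζ`, and Cauchy's formula applies at
  -- the two centres `z` and `0`.
  have hfin : v.1 * ∫ θ in Set.Ioc 0 (2 * Real.pi), c * (deriv (circleMap 0 r) θ •
      ((circleMap 0 r θ)⁻¹ * (circleMap 0 r θ - v.1)⁻¹ * f (circleMap 0 r θ, v.2))) =
      c * (2 * Real.pi * Complex.I * f (v.1, v.2) - 2 * Real.pi * Complex.I * f (0, v.2)) := by
    rw [integral_const_mul, mul_left_comm, ← integral_const_mul]
    congr 1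
    refine Eq.trans (integral_congr_ae (Filter.Eventually.of_forall fun θ => ?_)) hdiff
    have a1 := hs _ hv1 θ
    have a2 := hne θ
    simp only [smul_eq_mul, sub_zero]
    field_simp
    ring
  rw [hfin]
  linear_combination (f (0, v.2) - f (v.1, v.2)) * hc

/-- A nonzero linear form may be cancelled near a point: where it vanishes, `D` is the limit of its
values along a line transverse to the kernel. -/
theorem eventually_eq_zero_of_mul_eq_zero {E : Type*} [NormedAddCommGroup E] [NormedSpace ℂ E]
    {D : E → ℂ} (l : E →L[ℂ] ℂ) (hl : l ≠ 0) {x₀ : E}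
    (hD : ∀ᶠ v in 𝓝 x₀, ContinuousAt D v) (h : ∀ᶠ v in 𝓝 x₀, l v * D v = 0) :
    ∀ᶠ v in 𝓝 x₀, D v = 0 := by
  obtain ⟨e, he⟩ : ∃ e, l e ≠ 0 := by
    by_contra! hc
    exact hl (ContinuousLinearMap.ext hc)
  filter_upwards [hD, h.eventually_nhds] with v hv hv'
  by_cases hlv : l v = 0
  · have hp : Filter.Tendsto (fun t : ℂ => v + t • e) (𝓝[≠] 0) (𝓝 v) := by
      have : ContinuousAt (fun t : ℂ => v + t • e) 0 := by fun_prop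
      have h2 := this.tendsto
      simp only [zero_smul, add_zero] at h2
      exact h2.mono_left nhdsWithin_le_nhds
    refine tendsto_nhds_unique (hv.tendsto.comp hp) (tendsto_const_nhds.congr' ?_)
    filter_upwards [hp.eventually hv', self_mem_nhdsWithin] with t ht ht'
    have : l (v + t • e) ≠ 0 := by simpa [hlv, he] using ht'
    exact ((mul_eq_zero.1 ht).resolve_left this).symm
  · exact (mul_eq_zero.1 hv'.self_of_nhds).resolve_left hlv

theorem hasDerivAt_snd {f : ℂ × ℂ → ℂ} {v : ℂ × ℂ} (hf : DifferentiableAt ℂ f v) :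
    HasDerivAt (fun y => f (v.1, y)) (fderiv ℂ f v (0, 1)) v.2 :=
  hf.hasFDerivAt.comp_hasDerivAt v.2 ((hasDerivAt_const v.2 v.1).prodMk (hasDerivAt_id v.2))

theorem tendsto_zero_prodMk : Filter.Tendsto (fun y : ℂ => ((0 : ℂ), y)) (𝓝 0) (𝓝 0) :=
  (Continuous.prodMk_right (0 : ℂ)).tendsto' 0 0 rfl

theorem tendsto_prodMk_zero : Filter.Tendsto (fun z : ℂ => (z, (0 : ℂ))) (𝓝 0) (𝓝 0) :=
  (Continuous.prodMk_left (0 : ℂ)).tendsto' 0 0 rfl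

theorem analyticAt_fderiv_snd {f : ℂ × ℂ → ℂ} {v : ℂ × ℂ} (hf : AnalyticAt ℂ f v) :
    AnalyticAt ℂ (fun v => fderiv ℂ f v (0, 1)) v :=
  ((ContinuousLinearMap.apply ℂ ℂ ((0, 1) : ℂ × ℂ)).analyticAt _).comp hf.fderiv

/-- If the derivative of `f` in the second variable is divisible by the `n`-th power of the first
variable and `f` vanishes on the first axis, then `f` is divisible by that power. -/
theorem AnalyticAt.exists_eq_pow_mul (n : ℕ) {f H : ℂ × ℂ → ℂ} (hf : AnalyticAt ℂ f 0)
    (hH : AnalyticAt ℂ H 0) (hd : ∀ᶠ v in 𝓝 (0 : ℂ × ℂ), fderiv ℂ f v (0, 1) = v.1 ^ n * H v)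
    (h0 : ∀ᶠ z in 𝓝 (0 : ℂ), f (z, 0) = 0) :
    ∃ g : ℂ × ℂ → ℂ, AnalyticAt ℂ g 0 ∧ ∀ᶠ v in 𝓝 (0 : ℂ × ℂ), f v = v.1 ^ n * g v := by
  induction n generalizing f with
  | zero => exact ⟨f, hf, by simp⟩
  | succ n ih =>
    -- The exponent is positive, so on the axis `z = 0` the derivative in `y` vanishes and `f(0, ·)`
    -- is constant, equal to `f(0, 0) = 0`. Thus one factor `z` splits off.
    have hzero : ∀ᶠ y in 𝓝 (0 : ℂ), f (0, y) = 0 := by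
      have h1 : ∀ᶠ y in 𝓝 (0 : ℂ), HasDerivAt (fun y => f (0, y)) 0 y := by
        filter_upwards [tendsto_zero_prodMk.eventually hd,
          tendsto_zero_prodMk.eventually hf.eventually_analyticAt] with y hy hy'
        have := hasDerivAt_snd hy'.differentiableAt
        rw [hy] at this
        simpa using this
      obtain ⟨ε, hε, hball⟩ := Metric.eventually_nhds_iff_ball.1 h1
      filter_upwards [Metric.ball_mem_nhds 0 hε] with y hy
      refine Eq.trans ?_ h0.self_of_nhds
      exact Metric.isOpen_ball.is_const_of_deriv_eq_zero (convex_ball 0 ε).isPreconnected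
        (fun y hy => (hball y hy).differentiableAt.differentiableWithinAt)
        (fun y hy => (hball y hy).deriv) hy (Metric.mem_ball_self hε)
    obtain ⟨g, hg, hfg⟩ := hf.exists_eq_add_mul
    have hfg' : ∀ᶠ v in 𝓝 (0 : ℂ × ℂ), f v = v.1 * g v := by
      filter_upwards [hfg, (continuous_snd.tendsto' (0 : ℂ × ℂ) 0 rfl).eventually hzero]
        with v hv hv'
      rw [hv, hv', zero_add]
    -- The quotient again satisfies the hypothesis, with one power less and the same `H`, after `z`
    -- is cancelled.
    have hgd : ∀ᶠ v in 𝓝 (0 : ℂ × ℂ), fderiv ℂ g v (0, 1) - v.1 ^ n * H v = 0 := by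
      have han : AnalyticAt ℂ (fun v => fderiv ℂ g v (0, 1) - v.1 ^ n * H v) 0 :=
        (analyticAt_fderiv_snd hg).sub ((analyticAt_fst.pow n).mul hH)
      refine eventually_eq_zero_of_mul_eq_zero (ContinuousLinearMap.fst ℂ ℂ ℂ)
        (fun h => by simpa using congrArg (fun l => l (1, 0)) h)
        (han.eventually_analyticAt.mono fun v hv => hv.continuousAt) ?_
      filter_upwards [hfg'.eventually_nhds, hd, hg.eventually_analyticAt] with v hv hv' hv''
      have h1 : fderiv ℂ f v = fderiv ℂ (fun v => v.1 * g v) v := Filter.EventuallyEq.fderiv_eq hv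
      rw [h1, fderiv_fun_mul differentiableAt_fst hv''.differentiableAt] at hv'
      have h2 : fderiv ℂ (fun v : ℂ × ℂ => v.1) v (0, 1) = 0 := by
        rw [fderiv_fst]; rfl
      simp only [add_apply, smul_apply, h2, smul_eq_mul, mul_zero, add_zero] at hv'
      simp only [ContinuousLinearMap.coe_fst']
      linear_combination hv'
    have hg0 : ∀ᶠ z in 𝓝 (0 : ℂ), g (z, 0) = 0 := by
      refine eventually_eq_zero_of_mul_eq_zero (ContinuousLinearMap.id ℂ ℂ)
        (fun h => by simpa using congrArg (fun l => l 1) h) ?_ ?_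
      · filter_upwards [tendsto_prodMk_zero.eventually hg.eventually_analyticAt] with z hz
        exact ContinuousAt.comp (f := fun z : ℂ => (z, (0 : ℂ))) hz.continuousAt
          (Continuous.prodMk_left (0 : ℂ)).continuousAt
      · filter_upwards [h0, tendsto_prodMk_zero.eventually hfg'] with z hz hz'
        simpa [hz] using hz'.symm
    obtain ⟨g', hg', hgg'⟩ := ih hg (hgd.mono fun v hv => sub_eq_zero.1 hv) hg0
    refine ⟨g', hg', ?_⟩
    filter_upwards [hfg', hgg'] with v hv hv'
    rw [hv, hv', pow_succ']
    ring

/-- Orders of vanishing: if `f` had a zero of finite order `n + 1`, its derivative would have order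
exactly `n`, while `f h` vanishes to higher order. Only continuity of `h` at the point is needed. -/
theorem AnalyticAt.eventually_eq_zero_of_deriv_eq_mul {f h : ℂ → ℂ} (hf : AnalyticAt ℂ f 0)
    (hh : ContinuousAt h 0) (h0 : f 0 = 0) (hd : ∀ᶠ y in 𝓝 (0 : ℂ), deriv f y = f y * h y) :
    ∀ᶠ y in 𝓝 (0 : ℂ), f y = 0 := by
  by_contra hcon
  obtain ⟨n, g, hg, hg0, hfg⟩ := hf.exists_eventuallyEq_pow_smul_nonzero_iff.2 hcon
  simp only [sub_zero, smul_eq_mul] at hfg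
  have hn : n ≠ 0 := by
    rintro rfl
    have := hfg.self_of_nhds
    simp_all
  obtain ⟨n, rfl⟩ := Nat.exists_eq_add_one_of_ne_zero hn
  have hev : ∀ᶠ y in 𝓝[≠] (0 : ℂ), ((n : ℂ) + 1) * g y + y * deriv g y = y * g y * h y := by
    have h1 : ∀ᶠ y in 𝓝 (0 : ℂ), y ≠ 0 →
        ((n : ℂ) + 1) * g y + y * deriv g y = y * g y * h y := by
      filter_upwards [hfg.eventually_nhds, hd, hg.eventually_analyticAt] with y hy hy' hy'' hne
      have h2 : deriv f y = deriv (fun z => z ^ (n + 1) * g z) y :=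
        Filter.EventuallyEq.deriv_eq hy
      rw [hy.self_of_nhds, h2, deriv_fun_mul (by fun_prop) hy''.differentiableAt] at hy'
      simp only [deriv_pow_field, Nat.cast_add, Nat.cast_one, add_tsub_cancel_right] at hy'
      refine mul_left_cancel₀ (pow_ne_zero n hne) ?_
      linear_combination hy'
    filter_upwards [nhdsWithin_le_nhds h1, self_mem_nhdsWithin] with y hy hne using hy hne
  have hl : ContinuousAt (fun y => ((n : ℂ) + 1) * g y + y * deriv g y) 0 :=
    (continuousAt_const.mul hg.continuousAt).add (continuousAt_id.mul hg.deriv.continuousAt)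
  have hr : ContinuousAt (fun y => y * g y * h y) 0 :=
    (continuousAt_id.mul hg.continuousAt).mul hh
  have := tendsto_nhds_unique_of_eventuallyEq (hl.tendsto.mono_left nhdsWithin_le_nhds)
    (hr.tendsto.mono_left nhdsWithin_le_nhds) hev
  simp only [zero_mul, add_zero, mul_eq_zero] at this
  rcases this with h | h
  · exact Nat.cast_add_one_ne_zero n h
  · exact hg0 h

/-- Dividing out `x` shows that `log(1 + z^(k-1) K)` is a multiple of `z^(k-1)`. -/
theorem exists_log_one_add_eq_mul : ∃ l : ℂ → ℂ, AnalyticAt ℂ l 0 ∧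
    ∀ x, Complex.log (1 + x) = x * l x := by
  have ha : AnalyticAt ℂ (fun x : ℂ => Complex.log (1 + x)) 0 :=
    AnalyticAt.clog (by fun_prop) (by simp [Complex.slitPlane])
  obtain ⟨p, hp⟩ := ha
  refine ⟨dslope (fun x : ℂ => Complex.log (1 + x)) 0, ⟨_, hp.has_fpower_series_dslope_fslope⟩,
    fun x => ?_⟩
  have := sub_smul_dslope (fun x : ℂ => Complex.log (1 + x)) 0 x
  simpa using this.symm

/-- The local form of the target map of a groupoid in coordinates `(z, y)` near an identity arrow:
`T` is the target, and `q ((z, y), y')` is the second coordinate of the arrow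
`(z, y') (z, y)⁻¹`. -/
theorem exists_eq_mul_exp {k : ℕ} (hk : 1 ≤ k) {T : ℂ × ℂ → ℂ} {q : (ℂ × ℂ) × ℂ → ℂ} {β : ℂ → ℂ}
    (hT : AnalyticAt ℂ T 0) (hq : AnalyticAt ℂ q 0) (hβ : AnalyticAt ℂ β 0)
    (hT0 : ∀ᶠ z in 𝓝 (0 : ℂ), T (z, 0) = z)
    (hTβ : ∀ᶠ z in 𝓝 (0 : ℂ), fderiv ℂ T (z, 0) (0, 1) = z ^ k * β z)
    (hq0 : ∀ᶠ v in 𝓝 (0 : ℂ × ℂ), q (v, v.2) = 0)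
    (hTq : ∀ᶠ p in 𝓝 (0 : (ℂ × ℂ) × ℂ), T (T p.1, q p) = T (p.1.1, p.2)) :
    ∃ u : ℂ × ℂ → ℂ, AnalyticAt ℂ u 0 ∧
      (∀ᶠ v in 𝓝 (0 : ℂ × ℂ), T v = v.1 * Complex.exp (v.1 ^ (k - 1) * u v)) ∧
      ∀ᶠ z in 𝓝 (0 : ℂ), u (z, 0) = 0 := by
  have hT00 : T 0 = 0 := hT0.self_of_nhds
  have hTt : Filter.Tendsto T (𝓝 0) (𝓝 0) := by simpa [hT00] using hT.continuousAt.tendsto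
  have hdiag : Filter.Tendsto (fun v : ℂ × ℂ => (v, v.2)) (𝓝 0) (𝓝 0) :=
    Continuous.tendsto' (by fun_prop) _ _ rfl
  -- The rate at which `(z, y')(z, y)⁻¹` leaves the identity as `y'` moves away from `y`.
  let c : ℂ × ℂ → ℂ := fun v => fderiv ℂ q (v, v.2) (0, 1)
  have hc : AnalyticAt ℂ c 0 := by
    have h1 : AnalyticAt ℂ (fderiv ℂ q) ((fun v : ℂ × ℂ => (v, v.2)) 0) := hq.fderiv
    have h2 : AnalyticAt ℂ (fun v : ℂ × ℂ => (v, v.2)) 0 := AnalyticAt.prod analyticAt_id analyticAt_snd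
    exact ((ContinuousLinearMap.apply ℂ ℂ ((0, 1) : (ℂ × ℂ) × ℂ)).analyticAt _).comp
      (AnalyticAt.comp (f := fun v : ℂ × ℂ => (v, v.2)) h1 h2)
  -- Differentiate `T(T(v), q(v, y')) = T(v.1, y')` at `y' = v.2`. There `q = 0`, so the left side
  -- is governed by the derivative of `T` at the identity arrow over `T(v)`, namely `T(v)^k
  -- β(T(v))`.
  have hode : ∀ᶠ v in 𝓝 (0 : ℂ × ℂ), fderiv ℂ T v (0, 1) = T v ^ k * (β (T v) * c v) := by
    filter_upwards [hdiag.eventually hTq.eventually_nhds, hq0, hTt.eventually hTβ,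
      hT.eventually_analyticAt, hdiag.eventually hq.eventually_analyticAt,
      (tendsto_prodMk_zero.comp hTt).eventually hT.eventually_analyticAt] with v h1 h2 h3 h4 h5 h6
    have e1 := hasDerivAt_snd h4.differentiableAt
    have e2 : HasDerivAt (fun y => q (v, y)) (c v) v.2 :=
      h5.differentiableAt.hasFDerivAt.comp_hasDerivAt v.2
        ((hasDerivAt_const v.2 v).prodMk (hasDerivAt_id v.2))
    have e3 : HasDerivAt (fun y => T (T v, q (v, y))) (fderiv ℂ T (T v, 0) (0, c v)) v.2 := by
      have h6' : HasFDerivAt T (fderiv ℂ T (T v, 0)) (T v, q (v, v.2)) := by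
        rw [h2]; exact h6.differentiableAt.hasFDerivAt
      exact h6'.comp_hasDerivAt v.2 ((hasDerivAt_const v.2 (T v)).prodMk e2)
    have e4 : (fun y => T (T v, q (v, y))) =ᶠ[𝓝 v.2] fun y => T (v.1, y) :=
      ((Continuous.prodMk_right v).tendsto v.2).eventually h1
    have e5 := e1.unique (e3.congr_of_eventuallyEq e4.symm)
    have e6 : ((0, c v) : ℂ × ℂ) = c v • (0, 1) := by simp
    rw [e5, e6, map_smul, h3, smul_eq_mul]
    ring
  -- Since `k ≥ 1`, the restriction to `z = 0` solves a linear equation `T' = T h` with `T(0, 0) =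
  -- 0`.
  have hzero : ∀ᶠ y in 𝓝 (0 : ℂ), T (0, y) = 0 := by
    have hrow : AnalyticAt ℂ (fun y : ℂ => ((0 : ℂ), y)) 0 := by fun_prop
    have hTr : AnalyticAt ℂ (fun y : ℂ => T (0, y)) 0 :=
      AnalyticAt.comp (f := fun y : ℂ => ((0 : ℂ), y)) hT hrow
    have hβT : AnalyticAt ℂ (fun v => β (T v)) 0 :=
      AnalyticAt.comp (by rw [hT00]; exact hβ) hT
    have hh : AnalyticAt ℂ (fun v => T v ^ (k - 1) * (β (T v) * c v)) 0 :=
      (hT.pow _).mul (hβT.mul hc)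
    refine hTr.eventually_eq_zero_of_deriv_eq_mul
      (h := fun y => T (0, y) ^ (k - 1) * (β (T (0, y)) * c (0, y)))
      (AnalyticAt.comp (f := fun y : ℂ => ((0 : ℂ), y)) hh hrow).continuousAt hT00 ?_
    filter_upwards [tendsto_zero_prodMk.eventually hode,
      tendsto_zero_prodMk.eventually hT.eventually_analyticAt] with y hy hy'
    rw [(hasDerivAt_snd hy'.differentiableAt).deriv, hy, ← mul_assoc (T (0, y)), ← pow_succ',
      Nat.sub_add_cancel hk]
  obtain ⟨m, hm, hTm⟩ := hT.exists_eq_add_mul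
  have hTm' : ∀ᶠ v in 𝓝 (0 : ℂ × ℂ), T v = v.1 * m v := by
    filter_upwards [hTm, (continuous_snd.tendsto' (0 : ℂ × ℂ) 0 rfl).eventually hzero] with v hv hv'
    rw [hv, hv', zero_add]
  have hβT : AnalyticAt ℂ (fun v => β (T v)) 0 := AnalyticAt.comp (by rw [hT00]; exact hβ) hT
  -- Substituting `T = z m` makes the derivative of `T - z` in `y` divisible by `z^k`, and `T - z`
  -- vanishes at `y = 0`; hence `T = z (1 + z^(k-1) K)`.
  obtain ⟨K, hK, hTK⟩ := AnalyticAt.exists_eq_pow_mul k (f := fun v => T v - v.1)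
    (H := fun v => m v ^ k * (β (T v) * c v)) (hT.sub analyticAt_fst)
    ((hm.pow k).mul (hβT.mul hc)) (by
      filter_upwards [hode, hTm', hT.eventually_analyticAt] with v hv hv' hv''
      have h2 : fderiv ℂ (fun v : ℂ × ℂ => v.1) v (0, 1) = 0 := by
        rw [fderiv_fst]; rfl
      rw [fderiv_fun_sub hv''.differentiableAt differentiableAt_fst]
      simp only [sub_apply, h2, sub_zero, hv]
      rw [← mul_assoc (v.1 ^ k), ← mul_pow, ← hv'])
    (by filter_upwards [hT0] with z hz; simp [hz])
  have hK0 : ∀ᶠ z in 𝓝 (0 : ℂ), K (z, 0) = 0 := by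
    have hcont : ∀ᶠ z in 𝓝 (0 : ℂ), ContinuousAt (fun z => K (z, 0)) z := by
      filter_upwards [tendsto_prodMk_zero.eventually hK.eventually_analyticAt] with z hz
      exact ContinuousAt.comp (f := fun z : ℂ => (z, (0 : ℂ))) hz.continuousAt
        (Continuous.prodMk_left (0 : ℂ)).continuousAt
    refine eventually_eq_zero_of_mul_eq_zero (ContinuousLinearMap.id ℂ ℂ)
      (fun h => by simpa using congrArg (fun l => l 1) h) hcont ?_
    filter_upwards [hT0, tendsto_prodMk_zero.eventually hTK] with z hz hz'
    have h1 : z ^ k * K (z, 0) = 0 := by rw [← hz', hz, sub_self]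
    rcases mul_eq_zero.1 h1 with h | h
    · simp [eq_zero_of_pow_eq_zero h]
    · simp [h]
  obtain ⟨l, hl, hlog⟩ := exists_log_one_add_eq_mul
  have hx : AnalyticAt ℂ (fun v : ℂ × ℂ => v.1 ^ (k - 1) * K v) 0 :=
    (analyticAt_fst.pow _).mul hK
  have hx0 : (fun v : ℂ × ℂ => v.1 ^ (k - 1) * K v) 0 = 0 := by
    have : K 0 = 0 := hK0.self_of_nhds
    simp [this]
  have hl' : AnalyticAt ℂ l ((fun v : ℂ × ℂ => v.1 ^ (k - 1) * K v) 0) := by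
    rw [hx0]
    exact hl
  -- From `log(1 + x) = x l(x)` at `x = z^(k-1) K`, so that `z^(k-1) u = log(T/z)`.
  refine ⟨fun v => K v * l (v.1 ^ (k - 1) * K v), hK.mul (AnalyticAt.comp
    (f := fun v : ℂ × ℂ => v.1 ^ (k - 1) * K v) hl' hx), ?_, ?_⟩
  · have hne : ∀ᶠ v in 𝓝 (0 : ℂ × ℂ), 1 + v.1 ^ (k - 1) * K v ≠ 0 :=
      by
      refine ContinuousAt.eventually_ne (continuousAt_const.add hx.continuousAt) ?_
      have : (0 : ℂ × ℂ).1 ^ (k - 1) * K 0 = 0 := hx0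
      rw [this]
      simp
    filter_upwards [hTK, hne] with v hv hv'
    rw [← mul_assoc, ← hlog, Complex.exp_log hv', mul_add, mul_one, ← mul_assoc, ← pow_succ',
      Nat.sub_add_cancel hk, ← hv]
    ring
  · filter_upwards [hK0] with z hz
    simp [hz]

end Analysis

end


/-! ### The generator of the Lie algebroid and charts adapted to the source map. -/

noncomputable section

namespace HolLieGroupoid

variable {E : Type*} [NormedAddCommGroup E] [NormedSpace ℂ E] [FiniteDimensional ℂ E]
  {G : Type*} [TopologicalSpace G] [T2Space G] [ChartedSpace E G] [IsManifold 𝓘(ℂ, E) ω G]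
  {𝒢 : HolLieGroupoid E ℂ G ℂ} {k : ℕ}

theorem castTangent_eq {F M : Type*} [NormedAddCommGroup F] [NormedSpace ℂ F] [TopologicalSpace M]
    [ChartedSpace F M] {a b : M} (h : a = b) (v : TangentSpace 𝓘(ℂ, F) a) :
    (castTangent h v : F) = v := by
  subst h
  rfl

theorem HolAlong.restrict {U V : Opens ℂ} (hUV : U ≤ V)
    {v : (x : V) → TangentSpace 𝓘(ℂ, E) (𝒢.one x)} (hv : 𝒢.HolAlong V v) :
    𝒢.HolAlong U (fun x => v ⟨x, hUV x.2⟩) :=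
  ContMDiff.comp (f := fun x : U => (⟨x, hUV x.2⟩ : V)) hv (contMDiff_inclusion hUV)

variable (𝒢) in
theorem mdifferentiableAt_src (g : G) : MDifferentiableAt 𝓘(ℂ, E) 𝓘(ℂ, ℂ) 𝒢.src g :=
  𝒢.holomorphic_src.mdifferentiableAt (by simp)

variable (𝒢) in
theorem mdifferentiableAt_one (z : ℂ) : MDifferentiableAt 𝓘(ℂ, ℂ) 𝓘(ℂ, E) 𝒢.one z :=
  𝒢.holomorphic_one.mdifferentiableAt (by simp)

theorem mfderiv_src_one (z : ℂ) (w : TangentSpace 𝓘(ℂ, ℂ) z) :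
    mfderiv 𝓘(ℂ, E) 𝓘(ℂ, ℂ) 𝒢.src (𝒢.one z) (mfderiv 𝓘(ℂ, ℂ) 𝓘(ℂ, E) 𝒢.one z w) = w := by
  have h := mfderiv_comp z (𝒢.mdifferentiableAt_src (𝒢.one z)) (𝒢.mdifferentiableAt_one z)
  have h2 : 𝒢.src ∘ 𝒢.one = id := funext 𝒢.src_one
  rw [h2, mfderiv_id] at h
  exact (DFunLike.congr_fun h w).symm

set_option synthInstance.maxHeartbeats 400000 in
/-- A generator of the Lie algebroid, whose anchor is `z ^ k ∂_z`. -/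
theorem Integration.exists_generator (Φ : 𝒢.Integration k) :
    ∃ e : (z : ℂ) → TangentSpace 𝓘(ℂ, E) (𝒢.one z),
      ContMDiff 𝓘(ℂ, ℂ) 𝓘(ℂ, E).tangent ω
        (fun z : ℂ => (⟨𝒢.one z, e z⟩ : TangentBundle 𝓘(ℂ, E) G)) ∧
      (∀ z, mfderiv 𝓘(ℂ, E) 𝓘(ℂ, ℂ) 𝒢.src (𝒢.one z) (e z) = (0 : ℂ)) ∧
      (∀ z, mfderiv 𝓘(ℂ, E) 𝓘(ℂ, ℂ) 𝒢.tgt (𝒢.one z) (e z) = (z ^ k : ℂ)) ∧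
      ∀ (U : Opens ℂ) (v : 𝒢.lieSections U) (z : U), ∃ c : ℂ, v.1 z = c • e z := by
  let f : twistedTangent k ⊤ := ⟨fun z => (z : ℂ) ^ k, 1, one_mem _, fun z => by simp⟩
  let e := (Φ.toEquiv ⊤).symm f
  have he : Φ.toEquiv ⊤ e = f := (Φ.toEquiv ⊤).apply_symm_apply f
  refine ⟨fun z => e.1 ⟨z, trivial⟩, ?_, ?_, ?_, ?_⟩
  · intro z
    exact (contMDiffAt_subtype_iff (U := ⊤) (x := ⟨z, trivial⟩)).1 (e.2.1 ⟨z, trivial⟩)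
  · intro z
    exact (e.2.2 ⟨z, trivial⟩).trans (by rfl)
  · intro z
    have h := Φ.map_anchor ⊤ e ⟨z, trivial⟩
    rw [he] at h
    exact (h.trans (castTangent_eq (𝒢.tgt_one z) _)).symm
  · intro U v z
    let w : 𝒢.lieSections U := ⟨fun x => e.1 ⟨x, trivial⟩,
      HolAlong.restrict (le_top : U ≤ ⊤) e.2.1, fun x => e.2.2 ⟨x, trivial⟩⟩
    have hw := Φ.map_restrict U ⊤ le_top e w (fun _ => rfl)
    -- A section with image `z^k g` has the same image as `g` times the restricted generator.
    obtain ⟨g, hg, hgv⟩ := (Φ.toEquiv U v).2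
    have hvw : v = (⟨g, hg⟩ : holFun (EX := ℂ) U) • w := by
      apply (Φ.toEquiv U).injective
      rw [map_smul]
      ext x
      rw [hgv x]
      have h1 : ((⟨g, hg⟩ : holFun (EX := ℂ) U) • Φ.toEquiv U w).1 x
        = g x * (Φ.toEquiv U w).1 x := rfl
      rw [h1, hw x, he]
      exact mul_comm _ _
    exact ⟨g z, by rw [hvw]; rfl⟩

/-- Every vector tangent to a source fibre at an identity arrow extends to a local section of the
Lie algebroid. -/
theorem exists_lieSection_eq (z₀ : ℂ) (v₀ : TangentSpace 𝓘(ℂ, E) (𝒢.one z₀))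
    (hv₀ : mfderiv 𝓘(ℂ, E) 𝓘(ℂ, ℂ) 𝒢.src (𝒢.one z₀) v₀ = (0 : ℂ)) :
    ∃ (U : Opens ℂ) (hz₀ : z₀ ∈ U) (v : 𝒢.lieSections U), v.1 ⟨z₀, hz₀⟩ = v₀ := by
  let τ := trivializationAt E (TangentSpace 𝓘(ℂ, E)) (𝒢.one z₀)
  have h0 : 𝒢.one z₀ ∈ τ.baseSet := FiberBundle.mem_baseSet_trivializationAt' _
  let U : Opens ℂ := ⟨𝒢.one ⁻¹' τ.baseSet,
    τ.open_baseSet.preimage 𝒢.holomorphic_one.continuous⟩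
  let w₁ : (x : U) → TangentSpace 𝓘(ℂ, E) (𝒢.one x) := fun x => τ.symm (𝒢.one x) (τ ⟨_, v₀⟩).2
  have hw₁ : 𝒢.HolAlong U w₁ := by
    have h1 : ContMDiff 𝓘(ℂ, ℂ) (𝓘(ℂ, E).prod 𝓘(ℂ, E)) ω
        (fun x : U => (𝒢.one x, (τ ⟨_, v₀⟩).2)) :=
      (𝒢.holomorphic_one.comp contMDiff_subtype_val).prodMk contMDiff_const
    have h2 := (τ.contMDiffOn_symm (n := ω) (IB := 𝓘(ℂ, E))).comp_contMDiff h1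
      (fun x => (τ.mem_target).2 x.2)
    refine h2.congr fun x => ?_
    exact τ.mk_symm x.2 _
  let w₂ : (x : U) → TangentSpace 𝓘(ℂ, E) (𝒢.one x) :=
    fun x => mfderiv 𝓘(ℂ, ℂ) 𝓘(ℂ, E) 𝒢.one (x : ℂ) (1 : ℂ)
  have hw₂ : 𝒢.HolAlong U w₂ := by
    have h1 : ContMDiff 𝓘(ℂ, ℂ) 𝓘(ℂ, ℂ).tangent ω
        (fun x : ℂ => (⟨x, (1 : ℂ)⟩ : TangentBundle 𝓘(ℂ, ℂ) ℂ)) :=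
      contMDiff_vectorSpace_iff_contDiff.2 contDiff_const
    exact ((𝒢.holomorphic_one.contMDiff_tangentMap (m := ω) (by simp)).comp h1).comp
      contMDiff_subtype_val
  let f : U → ℂ := fun x => mfderiv 𝓘(ℂ, E) 𝓘(ℂ, ℂ) 𝒢.src (𝒢.one x) (w₁ x)
  have hf : ContMDiff 𝓘(ℂ, ℂ) 𝓘(ℂ, ℂ) ω f := by
    have h1 := (𝒢.holomorphic_src.contMDiff_tangentMap (m := ω) (by simp)).comp hw₁
    exact (contMDiff_snd_tangentBundle_modelSpace ℂ 𝓘(ℂ, ℂ)).comp h1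
  -- `w₁` extends `v₀` constantly in a trivialization, and `w₂` is tangent to the identities with
  -- `ds(w₂) = 1`. Subtracting `ds(w₁) w₂` moves into the kernel of `ds`, and changes nothing at
  -- `z₀`, where `ds(w₁) = 0`.
  refine ⟨U, h0, ⟨w₁ + fun x => (-f x) • w₂ x, hw₁.add (HolAlong.smul hf.neg hw₂), fun x => ?_⟩, ?_⟩
  · have h1 : mfderiv 𝓘(ℂ, E) 𝓘(ℂ, ℂ) 𝒢.src (𝒢.one x) (w₂ x) = (1 : ℂ) :=
      mfderiv_src_one (x : ℂ) (1 : ℂ)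
    change mfderiv 𝓘(ℂ, E) 𝓘(ℂ, ℂ) 𝒢.src (𝒢.one x) (w₁ x + (-f x) • w₂ x) = (0 : ℂ)
    rw [map_add, map_smul, h1]
    change f x + (-f x) * 1 = 0
    ring
  · have h1 : w₁ ⟨z₀, h0⟩ = v₀ := τ.symm_apply_apply_mk h0 v₀
    have h2 : f ⟨z₀, h0⟩ = 0 := by
      simp only [f, h1]
      exact hv₀
    change w₁ ⟨z₀, h0⟩ + (-f ⟨z₀, h0⟩) • w₂ ⟨z₀, h0⟩ = v₀
    rw [h1, h2, neg_zero, zero_smul, add_zero]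


/-- The generator spans the tangent spaces of the source fibres at the identity arrows. -/
theorem Integration.exists_frame (Φ : 𝒢.Integration k) :
    ∃ e : (z : ℂ) → TangentSpace 𝓘(ℂ, E) (𝒢.one z),
      ContMDiff 𝓘(ℂ, ℂ) 𝓘(ℂ, E).tangent ω
        (fun z : ℂ => (⟨𝒢.one z, e z⟩ : TangentBundle 𝓘(ℂ, E) G)) ∧
      (∀ z, mfderiv 𝓘(ℂ, E) 𝓘(ℂ, ℂ) 𝒢.src (𝒢.one z) (e z) = (0 : ℂ)) ∧
      (∀ z, mfderiv 𝓘(ℂ, E) 𝓘(ℂ, ℂ) 𝒢.tgt (𝒢.one z) (e z) = (z ^ k : ℂ)) ∧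
      (∀ z, e z ≠ 0) ∧
      ∀ z (v : TangentSpace 𝓘(ℂ, E) (𝒢.one z)),
        mfderiv 𝓘(ℂ, E) 𝓘(ℂ, ℂ) 𝒢.src (𝒢.one z) v = (0 : ℂ) → ∃ c : ℂ, v = c • e z := by
  obtain ⟨e, he, hes, het, hspan⟩ := Φ.exists_generator
  have hker : ∀ z (v : TangentSpace 𝓘(ℂ, E) (𝒢.one z)),
      mfderiv 𝓘(ℂ, E) 𝓘(ℂ, ℂ) 𝒢.src (𝒢.one z) v = (0 : ℂ) → ∃ c : ℂ, v = c • e z := by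
    intro z v hv
    obtain ⟨U, hz, w, hw⟩ := exists_lieSection_eq z v hv
    rw [← hw]
    exact hspan U w ⟨z, hz⟩
  refine ⟨e, he, hes, het, ?_, hker⟩
  let A : ℂ → E →ₗ[ℂ] ℂ := fun z =>
    (mfderiv 𝓘(ℂ, E) 𝓘(ℂ, ℂ) 𝒢.src (𝒢.one z)).toLinearMap
  -- The kernel of `ds` has the same rank at all identities. At `z = 1` the anchor of the generator
  -- is nonzero, so this rank is one and `dim E = 2`; a zero of the generator would make the rank
  -- drop.
  have hrank : ∀ z, Module.finrank ℂ (LinearMap.ker (A z)) + 1 = Module.finrank ℂ E := by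
    intro z
    have h1 := (A z).finrank_range_add_finrank_ker
    have h2 : LinearMap.range (A z) = ⊤ := LinearMap.range_eq_top.2 (𝒢.submersion_src (𝒢.one z))
    rw [h2, finrank_top, Module.finrank_self] at h1
    omega
  let e' : ℂ → E := e
  have hspan' : ∀ z, LinearMap.ker (A z) = Submodule.span ℂ {e' z} := by
    intro z
    ext v
    rw [LinearMap.mem_ker, Submodule.mem_span_singleton]
    constructor
    · intro h
      obtain ⟨c, hc⟩ := hker z v h
      exact ⟨c, hc.symm⟩
    · rintro ⟨c, rfl⟩
      rw [map_smul]
      have : A z (e' z) = 0 := hes z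
      rw [this, smul_zero]
  have he1 : e' 1 ≠ 0 := by
    intro h
    have h1 := het 1
    have h2 : e 1 = 0 := h
    rw [h2, map_zero, one_pow] at h1
    exact zero_ne_one (α := ℂ) h1
  have h2 : Module.finrank ℂ E = 2 := by
    rw [← hrank 1, hspan', finrank_span_singleton he1]
  intro z hz
  have h3 := hrank z
  have h4 : e' z = 0 := hz
  rw [hspan', h4, Submodule.span_zero_singleton, finrank_bot, h2] at h3
  omega

/-- `holomorphic_mul` only concerns the set of composable pairs, which need not be open. Families
that stay in this set near `x` have holomorphic products in the unrestricted sense. -/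
theorem contMDiffAt_mul {F H M : Type*} [NormedAddCommGroup F] [NormedSpace ℂ F]
    [TopologicalSpace H] {I : ModelWithCorners ℂ F H} [TopologicalSpace M] [ChartedSpace H M]
    {f g : M → G} {x : M} (hf : ContMDiffAt I 𝓘(ℂ, E) ω f x) (hg : ContMDiffAt I 𝓘(ℂ, E) ω g x)
    (h : ∀ᶠ y in 𝓝 x, 𝒢.src (f y) = 𝒢.tgt (g y)) :
    ContMDiffAt I 𝓘(ℂ, E) ω (fun y => 𝒢.mul (f y) (g y)) x := by
  have h1 := 𝒢.holomorphic_mul (f x, g x) h.self_of_nhds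
  have h2 : ContMDiffWithinAt I 𝓘(ℂ, E) ω
      ((fun p : G × G => 𝒢.mul p.1 p.2) ∘ fun y => (f y, g y))
      {y | 𝒢.src (f y) = 𝒢.tgt (g y)} x :=
    h1.comp x ((hf.prodMk hg).contMDiffWithinAt) fun y hy => hy
  exact h2.contMDiffAt h

/-- Restriction of a local chart to the preimage of a bidisc. -/
theorem exists_restrict_bidisc {z₀ : ℂ} (χ : OpenPartialHomeomorph G (ℂ × ℂ)) {N : Set G}
    (hN : N ∈ 𝓝 (𝒢.one z₀)) (h0 : 𝒢.one z₀ ∈ χ.source)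
    (hχ : ContMDiffAt 𝓘(ℂ, E) 𝓘(ℂ, ℂ × ℂ) ω χ (𝒢.one z₀))
    (hχ' : ContMDiffAt 𝓘(ℂ, ℂ × ℂ) 𝓘(ℂ, E) ω χ.symm (z₀, 0))
    (hone : ∀ᶠ z in 𝓝 z₀, χ (𝒢.one z) = (z, 0)) :
    ∃ (χ' : OpenPartialHomeomorph G (ℂ × ℂ)) (r : ℝ), 0 < r ∧ 𝒢.one z₀ ∈ χ'.source ∧
      χ'.source ⊆ N ∩ χ.source ∧ (⇑χ' = χ) ∧
      χ'.target = Metric.ball z₀ r ×ˢ Metric.ball 0 r ∧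
      ContMDiffOn 𝓘(ℂ, E) 𝓘(ℂ, ℂ × ℂ) ω χ' χ'.source ∧
      ContMDiffOn 𝓘(ℂ, ℂ × ℂ) 𝓘(ℂ, E) ω χ'.symm χ'.target ∧
      ∀ z ∈ Metric.ball z₀ r, χ'.symm (z, 0) = 𝒢.one z := by
  have e0 : χ (𝒢.one z₀) = (z₀, 0) := hone.self_of_nhds
  have ht : (z₀, (0 : ℂ)) ∈ χ.target := e0 ▸ χ.map_source h0
  have es : χ.symm (z₀, 0) = 𝒢.one z₀ := e0 ▸ χ.left_inv h0
  have hc : Filter.Tendsto χ.symm (𝓝 (z₀, 0)) (𝓝 (𝒢.one z₀)) := by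
    simpa [ContinuousAt, es] using χ.symm.continuousAt ht
  have hone' : ∀ᶠ z in 𝓝 z₀, χ.symm (z, 0) = 𝒢.one z := by
    filter_upwards [hone, (𝒢.holomorphic_one.continuous.tendsto z₀).eventually
      (χ.open_source.mem_nhds h0)] with z hz hz'
    rw [← hz, χ.left_inv hz']
  have hW : ∀ᶠ p in 𝓝 (z₀, (0 : ℂ)), p ∈ χ.target ∧ χ.symm p ∈ N ∧
      ContMDiffAt 𝓘(ℂ, E) 𝓘(ℂ, ℂ × ℂ) ω χ (χ.symm p) ∧
      ContMDiffAt 𝓘(ℂ, ℂ × ℂ) 𝓘(ℂ, E) ω χ.symm p := by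
    filter_upwards [χ.open_target.mem_nhds ht, hc.eventually hN,
      hc.eventually ((contMDiffAt_iff_contMDiffAt_nhds (by simp)).1 hχ),
      (contMDiffAt_iff_contMDiffAt_nhds (by simp)).1 hχ'] with p h1 h2 h3 h4
    exact ⟨h1, h2, h3, h4⟩
  obtain ⟨r, hr, hrW⟩ := Metric.eventually_nhds_iff_ball.1 hW
  obtain ⟨r', hr', hrW'⟩ := Metric.eventually_nhds_iff_ball.1 hone'
  let ρ := min r r'
  have hρ : 0 < ρ := lt_min hr hr'
  have hsub : Metric.ball z₀ ρ ×ˢ Metric.ball (0 : ℂ) ρ ⊆ Metric.ball (z₀, 0) r := by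
    rw [ball_prod_same]
    exact Metric.ball_subset_ball (min_le_left _ _)
  -- Restricting the inverse chart rather than the chart makes the target exactly the bidisc.
  let χ' := (χ.symm.restrOpen (Metric.ball z₀ ρ ×ˢ Metric.ball (0 : ℂ) ρ)
    (Metric.isOpen_ball.prod Metric.isOpen_ball)).symm
  have htar : χ'.target = Metric.ball z₀ ρ ×ˢ Metric.ball 0 ρ := by
    change χ.symm.source ∩ _ = _
    exact Set.inter_eq_right.2 fun p hp => (hrW p (hsub hp)).1
  have hsrc : ∀ g ∈ χ'.source, g ∈ χ.source ∧ χ g ∈ Metric.ball z₀ ρ ×ˢ Metric.ball (0 : ℂ) ρ := by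
    intro g hg
    have h1 := χ'.map_source hg
    rw [htar] at h1
    exact ⟨hg.1, h1⟩
  refine ⟨χ', ρ, hρ, ?_, ?_, rfl, htar, ?_, ?_, ?_⟩
  · have : (z₀, (0 : ℂ)) ∈ χ'.target := by
      rw [htar]
      exact ⟨Metric.mem_ball_self hρ, Metric.mem_ball_self hρ⟩
    have h2 := χ'.symm.map_source this
    have h3 : χ'.symm (z₀, 0) = 𝒢.one z₀ := es
    rwa [h3] at h2
  · intro g hg
    obtain ⟨h1, h2⟩ := hsrc g hg
    have h3 := (hrW _ (hsub h2)).2.1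
    rw [χ.left_inv h1] at h3
    exact ⟨h3, h1⟩
  · intro g hg
    obtain ⟨h1, h2⟩ := hsrc g hg
    have h3 := (hrW _ (hsub h2)).2.2.1
    rw [χ.left_inv h1] at h3
    exact h3.contMDiffWithinAt
  · intro p hp
    rw [htar] at hp
    exact (hrW _ (hsub hp)).2.2.2.contMDiffWithinAt
  · intro z hz
    exact hrW' z (Metric.ball_subset_ball (min_le_right _ _) hz)

/-- Holomorphic coordinates near an identity arrow, the first of which is the source map. -/
theorem exists_chart {z₀ : ℂ} (e₀ : TangentSpace 𝓘(ℂ, E) (𝒢.one z₀)) (he₀ : e₀ ≠ 0)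
    (hspan : ∀ v : TangentSpace 𝓘(ℂ, E) (𝒢.one z₀),
      mfderiv 𝓘(ℂ, E) 𝓘(ℂ, ℂ) 𝒢.src (𝒢.one z₀) v = (0 : ℂ) → ∃ c : ℂ, v = c • e₀)
    (hse₀ : mfderiv 𝓘(ℂ, E) 𝓘(ℂ, ℂ) 𝒢.src (𝒢.one z₀) e₀ = (0 : ℂ)) :
    ∃ (χ : OpenPartialHomeomorph G (ℂ × ℂ)) (r : ℝ), 0 < r ∧ 𝒢.one z₀ ∈ χ.source ∧
      χ.target = Metric.ball z₀ r ×ˢ Metric.ball 0 r ∧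
      ContMDiffOn 𝓘(ℂ, E) 𝓘(ℂ, ℂ × ℂ) ω χ χ.source ∧
      ContMDiffOn 𝓘(ℂ, ℂ × ℂ) 𝓘(ℂ, E) ω χ.symm χ.target ∧
      (∀ g ∈ χ.source, (χ g).1 = 𝒢.src g) ∧
      ∀ z ∈ Metric.ball z₀ r, χ.symm (z, 0) = 𝒢.one z := by
  let φ := chartAt E (𝒢.one z₀)
  have hφ0 : 𝒢.one z₀ ∈ φ.source := mem_chart_source E _
  have hφ1 : φ (𝒢.one z₀) ∈ φ.target := φ.map_source hφ0
  have hφ2 : φ.symm (φ (𝒢.one z₀)) = 𝒢.one z₀ := φ.left_inv hφ0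
  have hφs : ContMDiffAt 𝓘(ℂ, E) 𝓘(ℂ, E) ω φ.symm (φ (𝒢.one z₀)) :=
    (contMDiffOn_chart_symm (I := 𝓘(ℂ, E)) (n := ω) (x := 𝒢.one z₀)).contMDiffAt
      (φ.open_target.mem_nhds hφ1)
  have hφd : ContMDiffAt 𝓘(ℂ, E) 𝓘(ℂ, E) ω φ (𝒢.one z₀) :=
    (contMDiffOn_chart (I := 𝓘(ℂ, E)) (n := ω) (x := 𝒢.one z₀)).contMDiffAt
      (φ.open_source.mem_nhds hφ0)
  let s' : E → ℂ := fun v => 𝒢.src (φ.symm v)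
  let o' : ℂ → E := fun z => φ (𝒢.one z)
  have hs'0 : s' (φ (𝒢.one z₀)) = z₀ := by simp only [s', hφ2, 𝒢.src_one]
  have hs' : ContDiffAt ℂ ω s' (φ (𝒢.one z₀)) :=
    contMDiffAt_iff_contDiffAt.1 ((𝒢.holomorphic_src _).comp _ hφs)
  have ho' : ContDiffAt ℂ ω o' z₀ :=
    contMDiffAt_iff_contDiffAt.1 (ContMDiffAt.comp z₀ hφd (𝒢.holomorphic_one z₀))
  have hev : ∀ᶠ z in 𝓝 z₀, 𝒢.one z ∈ φ.source :=
    (𝒢.holomorphic_one.continuous.tendsto z₀).eventually (φ.open_source.mem_nhds hφ0)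
  let A : E →L[ℂ] ℂ := fderiv ℂ s' (φ (𝒢.one z₀))
  let B : ℂ →L[ℂ] E := fderiv ℂ o' z₀
  have hA : HasFDerivAt s' A (φ (𝒢.one z₀)) := (hs'.differentiableAt (by simp)).hasFDerivAt
  have hB : HasFDerivAt o' B z₀ := (ho'.differentiableAt (by simp)).hasFDerivAt
  have hAB : ∀ c, A (B c) = c := by
    have h1 : HasFDerivAt (s' ∘ o') (A.comp B) z₀ := HasFDerivAt.comp z₀ hA hB
    have h2 : s' ∘ o' =ᶠ[𝓝 z₀] id := by
      filter_upwards [hev] with z hz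
      simp only [Function.comp_apply, s', o', φ.left_inv hz, 𝒢.src_one, id]
    have h3 := h1.unique ((hasFDerivAt_id z₀).congr_of_eventuallyEq h2)
    exact fun c => DFunLike.congr_fun h3 c
  have hAm : ∀ v : E, A v = mfderiv 𝓘(ℂ, E) 𝓘(ℂ, ℂ) 𝒢.src (𝒢.one z₀) v := by
    intro v
    rw [(𝒢.mdifferentiableAt_src _).mfderiv]
    simp only [writtenInExtChartAt, mfld_simps, fderivWithin_univ]
    rfl
  obtain ⟨e₁, he₁⟩ : ∃ e₁ : E, e₁ = e₀ := ⟨e₀, rfl⟩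
  have he₁' : e₁ ≠ 0 := fun h => he₀ (he₁.symm.trans h)
  obtain ⟨l, hl⟩ : ∃ l : E →L[ℂ] ℂ, l e₁ = 1 := SeparatingDual.exists_eq_one he₁'
  -- The second coordinate measures, along `e₀`, the displacement from the identity arrow with the
  -- same source, so it vanishes on the identities.
  let Θ : E → ℂ × ℂ := fun v => (s' v, l (v - o' (s' v)))
  have hos : ContDiffAt ℂ ω (fun v => o' (s' v)) (φ (𝒢.one z₀)) :=
    ContDiffAt.comp (g := o') (φ (𝒢.one z₀)) (by rw [hs'0]; exact ho') hs'
  have hΘ : ContDiffAt ℂ ω Θ (φ (𝒢.one z₀)) :=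
    hs'.prodMk (l.contDiff.contDiffAt.comp _ (contDiffAt_id.sub hos))
  let D : E →L[ℂ] ℂ × ℂ := A.prod (l.comp (ContinuousLinearMap.id ℂ E - B.comp A))
  have hD : HasFDerivAt Θ D (φ (𝒢.one z₀)) := by
    refine hA.prodMk (l.hasFDerivAt.comp _ ((hasFDerivAt_id _).sub ?_))
    exact HasFDerivAt.comp (φ (𝒢.one z₀)) (by rw [hs'0]; exact hB) hA
  have hAe : A e₁ = 0 := by
    rw [he₁]
    exact (hAm e₀).trans hse₀
  -- A vector killed by `ds` is `c e₀`, and then the second component of `D` is `c`.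
  have hDi : LinearMap.ker D.toLinearMap = ⊥ := by
    refine LinearMap.ker_eq_bot'.2 fun v hv => ?_
    have h1 : A v = 0 := congrArg Prod.fst hv
    have h2 : l (v - B (A v)) = 0 := congrArg Prod.snd hv
    obtain ⟨c, hc⟩ := hspan v ((hAm v).symm.trans h1)
    have hc' : v = c • e₁ := by
      rw [he₁]
      exact hc
    rw [h1, map_zero, sub_zero, hc', map_smul, hl, smul_eq_mul, _root_.mul_one] at h2
    rw [hc', h2, zero_smul]
  have hDs : LinearMap.range D.toLinearMap = ⊤ := by
    refine LinearMap.range_eq_top.2 fun p => ⟨B p.1 + p.2 • e₁, ?_⟩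
    have h1 : A (B p.1 + p.2 • e₁) = p.1 := by
      rw [map_add, hAB, map_smul, hAe, smul_zero, add_zero]
    refine Prod.ext h1 ?_
    change l (B p.1 + p.2 • e₁ - B (A (B p.1 + p.2 • e₁))) = p.2
    rw [h1, add_sub_cancel_left, map_smul, hl, smul_eq_mul, _root_.mul_one]
  let D' : E ≃L[ℂ] ℂ × ℂ := ContinuousLinearEquiv.ofBijective D hDi hDs
  have hD' : HasFDerivAt Θ (D' : E →L[ℂ] ℂ × ℂ) (φ (𝒢.one z₀)) := by
    rw [ContinuousLinearEquiv.coe_ofBijective]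
    exact hD
  let ψ := hΘ.toOpenPartialHomeomorph Θ hD' (by simp)
  have hψ0 : φ (𝒢.one z₀) ∈ ψ.source := hΘ.mem_toOpenPartialHomeomorph_source hD' (by simp)
  have hΘ0 : Θ (φ (𝒢.one z₀)) = (z₀, 0) := by
    simp only [Θ, hs'0, o', sub_self, map_zero]
  have hψs : ContDiffAt ℂ ω ψ.symm (z₀, 0) := by
    rw [← hΘ0]
    exact hΘ.to_localInverse hD' (by simp)
  have hψs0 : ψ.symm (z₀, 0) = φ (𝒢.one z₀) := by
    rw [← hΘ0]
    exact ψ.left_inv hψ0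
  let χ := φ.trans ψ
  have hχ : ∀ g, χ g = Θ (φ g) := fun g => rfl
  have hχs : ∀ p, χ.symm p = φ.symm (ψ.symm p) := fun g => rfl
  have hχ0 : 𝒢.one z₀ ∈ χ.source := by
    rw [OpenPartialHomeomorph.trans_source]
    exact ⟨hφ0, hψ0⟩
  obtain ⟨χ', r, hr, h0, hsub, hcoe, htar, hd, hds, hone⟩ := exists_restrict_bidisc (N := Set.univ)
    χ Filter.univ_mem hχ0
    (ContMDiffAt.comp (g := Θ) (f := φ) (𝒢.one z₀) hΘ.contMDiffAt hφd)
    (ContMDiffAt.comp (g := φ.symm) (f := ψ.symm) (z₀, (0 : ℂ)) (by rw [hψs0]; exact hφs)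
      hψs.contMDiffAt) (by
      filter_upwards [hev] with z hz
      rw [hχ]
      simp only [Θ, s', o', φ.left_inv hz, 𝒢.src_one, sub_self, map_zero])
  refine ⟨χ', r, hr, h0, htar, hd, hds, fun g hg => ?_, hone⟩
  have h1 : g ∈ φ.source := by
    have := (hsub hg).2
    rw [OpenPartialHomeomorph.trans_source] at this
    exact this.1
  rw [hcoe, hχ]
  simp only [Θ, s', φ.left_inv h1]

end HolLieGroupoid
end


/-! ### Logarithmic charts near the identity arrows. -/

noncomputable section

namespace HolLieGroupoid

variable {E : Type*} [NormedAddCommGroup E] [NormedSpace ℂ E] [FiniteDimensional ℂ E]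
  {G : Type*} [TopologicalSpace G] [T2Space G] [ChartedSpace E G] [IsManifold 𝓘(ℂ, E) ω G]
  {𝒢 : HolLieGroupoid E ℂ G ℂ} {k : ℕ}

/-- Holomorphic coordinates `(z, u)` on a bidisc near an identity arrow, in which the source map is
`z` and the target map is `exp (u z ^ (k - 1)) z`. -/
structure LogChart (𝒢 : HolLieGroupoid E ℂ G ℂ) (k : ℕ) (z₀ : ℂ) where
  chart : OpenPartialHomeomorph G (ℂ × ℂ)
  radius : ℝ
  radius_pos : 0 < radius
  one_mem : 𝒢.one z₀ ∈ chart.source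
  target_eq : chart.target = Metric.ball z₀ radius ×ˢ Metric.ball 0 radius
  contMDiffOn : ContMDiffOn 𝓘(ℂ, E) 𝓘(ℂ, ℂ × ℂ) ω chart chart.source
  contMDiffOn_symm : ContMDiffOn 𝓘(ℂ, ℂ × ℂ) 𝓘(ℂ, E) ω chart.symm chart.target
  fst_eq : ∀ g ∈ chart.source, (chart g).1 = 𝒢.src g
  tgt_eq : ∀ g ∈ chart.source,
    𝒢.tgt g = 𝒢.src g * Complex.exp (𝒢.src g ^ (k - 1) * (chart g).2)
  symm_zero : ∀ z ∈ Metric.ball z₀ radius, chart.symm (z, 0) = 𝒢.one z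

/-- The derivative of the target map at the identity arrows, in coordinates. -/
theorem exists_fderiv_tgt_symm {z₀ : ℂ} {χ : OpenPartialHomeomorph G (ℂ × ℂ)}
    (h0 : 𝒢.one z₀ ∈ χ.source)
    (hd : ContMDiffOn 𝓘(ℂ, E) 𝓘(ℂ, ℂ × ℂ) ω χ χ.source)
    (hds : ContMDiffOn 𝓘(ℂ, ℂ × ℂ) 𝓘(ℂ, E) ω χ.symm χ.target)
    (hfst : ∀ g ∈ χ.source, (χ g).1 = 𝒢.src g)
    (hone : ∀ᶠ z in 𝓝 z₀, χ (𝒢.one z) = (z, 0))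
    {e : (z : ℂ) → TangentSpace 𝓘(ℂ, E) (𝒢.one z)}
    (he : ContMDiff 𝓘(ℂ, ℂ) 𝓘(ℂ, E).tangent ω
        (fun z : ℂ => (⟨𝒢.one z, e z⟩ : TangentBundle 𝓘(ℂ, E) G)))
    (hes : ∀ z, mfderiv 𝓘(ℂ, E) 𝓘(ℂ, ℂ) 𝒢.src (𝒢.one z) (e z) = (0 : ℂ))
    (het : ∀ z, mfderiv 𝓘(ℂ, E) 𝓘(ℂ, ℂ) 𝒢.tgt (𝒢.one z) (e z) = (z ^ k : ℂ))
    (he0 : e z₀ ≠ 0) :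
    ∃ β : ℂ → ℂ, AnalyticAt ℂ β z₀ ∧ β z₀ ≠ 0 ∧ ∀ᶠ z in 𝓝 z₀,
      fderiv ℂ (fun p => 𝒢.tgt (χ.symm p)) (z, 0) (0, 1) = z ^ k * β z := by
  let η : ℂ → ℂ × ℂ := fun z => mfderiv 𝓘(ℂ, E) 𝓘(ℂ, ℂ × ℂ) χ (𝒢.one z) (e z)
  have hsrc : ∀ᶠ z in 𝓝 z₀, 𝒢.one z ∈ χ.source :=
    (𝒢.holomorphic_one.continuous.tendsto z₀).eventually (χ.open_source.mem_nhds h0)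
  have hdiff : ∀ z, 𝒢.one z ∈ χ.source →
      MDifferentiableAt 𝓘(ℂ, E) 𝓘(ℂ, ℂ × ℂ) χ (𝒢.one z) := fun z hz =>
    (hd.contMDiffAt (χ.open_source.mem_nhds hz)).mdifferentiableAt (by simp)
  have hη : AnalyticAt ℂ η z₀ := by
    have h1 := hd.contMDiffOn_tangentMapWithin (m := ω) (by simp) χ.open_source.uniqueMDiffOn
    have h2 : ContMDiffAt 𝓘(ℂ, E).tangent 𝓘(ℂ, ℂ × ℂ).tangent ω
        (tangentMapWithin 𝓘(ℂ, E) 𝓘(ℂ, ℂ × ℂ) χ χ.source) ⟨𝒢.one z₀, e z₀⟩ := by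
      refine h1.contMDiffAt (IsOpen.mem_nhds ?_ h0)
      exact χ.open_source.preimage (FiberBundle.continuous_proj E (TangentSpace 𝓘(ℂ, E)))
    have h3 := (contMDiff_snd_tangentBundle_modelSpace (ℂ × ℂ) 𝓘(ℂ, ℂ × ℂ) (n := ω)).contMDiffAt.comp
      z₀ (ContMDiffAt.comp z₀ h2 (he z₀))
    refine (contMDiffAt_iff_contDiffAt.1 (h3.congr_of_eventuallyEq ?_)).analyticAt
    filter_upwards [hsrc] with z hz
    exact (DFunLike.congr_fun (mfderivWithin_of_isOpen χ.open_source hz) (e z)).symm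
  have hη1 : ∀ z, 𝒢.one z ∈ χ.source → (η z).1 = 0 := by
    intro z hz
    have h1 : MDifferentiableAt 𝓘(ℂ, ℂ × ℂ) 𝓘(ℂ, ℂ) (Prod.fst : ℂ × ℂ → ℂ) (χ (𝒢.one z)) :=
      mdifferentiableAt_iff_differentiableAt.2 differentiableAt_fst
    have h2 := mfderiv_comp (𝒢.one z) h1 (hdiff z hz)
    have h3 : Prod.fst ∘ χ =ᶠ[𝓝 (𝒢.one z)] 𝒢.src := by
      filter_upwards [χ.open_source.mem_nhds hz] with g hg using hfst g hg
    rw [h3.mfderiv_eq] at h2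
    have h4 := (DFunLike.congr_fun h2 (e z)).symm.trans (hes z)
    have h5 : mfderiv 𝓘(ℂ, ℂ × ℂ) 𝓘(ℂ, ℂ) (Prod.fst : ℂ × ℂ → ℂ) (χ (𝒢.one z)) =
      ContinuousLinearMap.fst ℂ ℂ ℂ := by rw [mfderiv_eq_fderiv, fderiv_fst]
    rw [h5] at h4
    exact h4
  have hη0 : (η z₀).2 ≠ 0 := by
    intro hc
    have h1 : η z₀ = 0 := Prod.ext (hη1 z₀ h0) hc
    have h2 : MDifferentiableAt 𝓘(ℂ, ℂ × ℂ) 𝓘(ℂ, E) χ.symm (χ (𝒢.one z₀)) :=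
      (hds.contMDiffAt (χ.open_target.mem_nhds (χ.map_source h0))).mdifferentiableAt (by simp)
    have h3 := mfderiv_comp (𝒢.one z₀) h2 (hdiff z₀ h0)
    have h4 : χ.symm ∘ χ =ᶠ[𝓝 (𝒢.one z₀)] id := by
      filter_upwards [χ.open_source.mem_nhds h0] with g hg using χ.left_inv hg
    rw [h4.mfderiv_eq, mfderiv_id] at h3
    have h5 := DFunLike.congr_fun h3 (e z₀)
    refine he0 (h5.trans ?_)
    change mfderiv 𝓘(ℂ, ℂ × ℂ) 𝓘(ℂ, E) χ.symm (χ (𝒢.one z₀)) (η z₀) = 0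
    rw [h1]
    exact map_zero _
  have hη2 : AnalyticAt ℂ (fun z => (η z).2) z₀ := analyticAt_snd.comp hη
  -- In the chart the generator is `(0, η₂)` with `η₂ ≠ 0`, and its anchor gives `η₂ * ∂T/∂y = z^k`.
  refine ⟨fun z => ((η z).2)⁻¹, hη2.inv hη0, inv_ne_zero hη0, ?_⟩
  filter_upwards [hsrc, hone, hη2.continuousAt.eventually_ne hη0] with z hz hz1 hz2
  have h1 : ContMDiffAt 𝓘(ℂ, ℂ × ℂ) 𝓘(ℂ, ℂ) ω (fun p => 𝒢.tgt (χ.symm p)) (χ (𝒢.one z)) :=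
    (𝒢.holomorphic_tgt _).comp _ (hds.contMDiffAt (χ.open_target.mem_nhds (χ.map_source hz)))
  have h2 := mfderiv_comp (𝒢.one z) (h1.mdifferentiableAt (by simp)) (hdiff z hz)
  have h3 : (fun p => 𝒢.tgt (χ.symm p)) ∘ χ =ᶠ[𝓝 (𝒢.one z)] 𝒢.tgt := by
    filter_upwards [χ.open_source.mem_nhds hz] with g hg
    simp only [Function.comp_apply, χ.left_inv hg]
  rw [h3.mfderiv_eq, mfderiv_eq_fderiv] at h2
  have h4 : (z ^ k : ℂ) = fderiv ℂ (fun p => 𝒢.tgt (χ.symm p)) (χ (𝒢.one z)) (η z) :=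
    (het z).symm.trans (DFunLike.congr_fun h2 (e z))
  have h5 : η z = (η z).2 • ((0, 1) : ℂ × ℂ) := Prod.ext (by simp [hη1 z hz]) (by simp)
  rw [hz1, h5, map_smul, smul_eq_mul] at h4
  rw [h4, mul_comm, ← _root_.mul_assoc, inv_mul_cancel₀ hz2, _root_.one_mul]

/-- The logarithmic coordinate exists in a chart near an identity arrow. -/
theorem exists_log_coordinate (hk : 1 ≤ k) {z₀ : ℂ} {χ : OpenPartialHomeomorph G (ℂ × ℂ)}
    (h0 : 𝒢.one z₀ ∈ χ.source)
    (hd : ContMDiffOn 𝓘(ℂ, E) 𝓘(ℂ, ℂ × ℂ) ω χ χ.source)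
    (hds : ContMDiffOn 𝓘(ℂ, ℂ × ℂ) 𝓘(ℂ, E) ω χ.symm χ.target)
    (hfst : ∀ g ∈ χ.source, (χ g).1 = 𝒢.src g)
    (hone : ∀ᶠ z in 𝓝 z₀, χ (𝒢.one z) = (z, 0))
    {β : ℂ → ℂ} (hβ : AnalyticAt ℂ β z₀)
    (hTβ : ∀ᶠ z in 𝓝 z₀,
      fderiv ℂ (fun p => 𝒢.tgt (χ.symm p)) (z, 0) (0, 1) = z ^ k * β z) :
    ∃ u : ℂ × ℂ → ℂ, AnalyticAt ℂ u (z₀, 0) ∧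
      (∀ᶠ p in 𝓝 (z₀, (0 : ℂ)),
        𝒢.tgt (χ.symm p) = p.1 * Complex.exp (p.1 ^ (k - 1) * u p)) ∧
      ∀ᶠ z in 𝓝 z₀, u (z, 0) = 0 := by
  have e0 : χ (𝒢.one z₀) = (z₀, 0) := hone.self_of_nhds
  have ht : (z₀, (0 : ℂ)) ∈ χ.target := e0 ▸ χ.map_source h0
  have es : χ.symm (z₀, 0) = 𝒢.one z₀ := e0 ▸ χ.left_inv h0
  have hone' : ∀ᶠ z in 𝓝 z₀, χ.symm (z, 0) = 𝒢.one z := by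
    filter_upwards [hone, (𝒢.holomorphic_one.continuous.tendsto z₀).eventually
      (χ.open_source.mem_nhds h0)] with z hz hz'
    rw [← hz, χ.left_inv hz']
  let T : ℂ × ℂ → ℂ := fun p => 𝒢.tgt (χ.symm p)
  have hsymm : ContMDiffAt 𝓘(ℂ, ℂ × ℂ) 𝓘(ℂ, E) ω χ.symm (z₀, 0) :=
    hds.contMDiffAt (χ.open_target.mem_nhds ht)
  have hT : AnalyticAt ℂ T (z₀, 0) :=
    (contMDiffAt_iff_contDiffAt.1 ((𝒢.holomorphic_tgt _).comp _ hsymm)).analyticAt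
  have hT0 : ∀ᶠ z in 𝓝 z₀, T (z, 0) = z := by
    filter_upwards [hone'] with z hz
    simp only [T, hz, 𝒢.tgt_one]
  -- Only the singular point needs the differential equation; elsewhere `T/z` is close to `1` and
  -- `z^(k-1)` is invertible, so `log(T/z)/z^(k-1)` works.
  by_cases hz₀ : z₀ = 0
  · subst hz₀
    let Q : (ℂ × ℂ) × ℂ → G := fun p =>
      𝒢.mul (χ.symm (p.1.1, p.2)) (𝒢.inv (χ.symm p.1))
    have hT00 : T 0 = 0 := hT0.self_of_nhds
    have hsrc : ∀ p ∈ χ.target, 𝒢.src (χ.symm p) = p.1 := fun p hp => by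
      rw [← hfst _ (χ.map_target hp), χ.right_inv hp]
    have htar : ∀ᶠ p in 𝓝 (0 : ℂ × ℂ), p ∈ χ.target := χ.open_target.mem_nhds ht
    have hl1 : Filter.Tendsto (fun p : (ℂ × ℂ) × ℂ => (p.1.1, p.2)) (𝓝 0) (𝓝 0) :=
      Continuous.tendsto' (by fun_prop) _ _ rfl
    have hl2 : Filter.Tendsto (fun p : (ℂ × ℂ) × ℂ => p.1) (𝓝 0) (𝓝 0) :=
      Continuous.tendsto' (by fun_prop) _ _ rfl
    have hcomp : ∀ᶠ p in 𝓝 (0 : (ℂ × ℂ) × ℂ),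
        𝒢.src (χ.symm (p.1.1, p.2)) = 𝒢.tgt (𝒢.inv (χ.symm p.1)) := by
      filter_upwards [hl1.eventually htar, hl2.eventually htar] with p h1 h2
      rw [𝒢.tgt_inv, hsrc _ h1, hsrc _ h2]
    have hQ : ContMDiffAt 𝓘(ℂ, (ℂ × ℂ) × ℂ) 𝓘(ℂ, E) ω Q 0 := by
      refine contMDiffAt_mul ?_ ?_ hcomp
      · have h1 : ContMDiffAt 𝓘(ℂ, (ℂ × ℂ) × ℂ) 𝓘(ℂ, ℂ × ℂ) ω
            (fun p : (ℂ × ℂ) × ℂ => (p.1.1, p.2)) 0 :=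
          contMDiffAt_iff_contDiffAt.2 (by fun_prop)
        exact ContMDiffAt.comp (g := χ.symm) (f := fun p : (ℂ × ℂ) × ℂ => (p.1.1, p.2)) 0 hsymm h1
      · have h1 : ContMDiffAt 𝓘(ℂ, (ℂ × ℂ) × ℂ) 𝓘(ℂ, ℂ × ℂ) ω
            (fun p : (ℂ × ℂ) × ℂ => p.1) 0 :=
          contMDiffAt_iff_contDiffAt.2 (by fun_prop)
        exact (𝒢.holomorphic_inv _).comp _
          (ContMDiffAt.comp (g := χ.symm) (f := fun p : (ℂ × ℂ) × ℂ => p.1) 0 hsymm h1)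
    have hQ0 : Q 0 = 𝒢.one 0 := by
      have h1 : Q 0 = 𝒢.mul (χ.symm (0, 0)) (𝒢.inv (χ.symm (0, 0))) := rfl
      rw [h1, 𝒢.mul_inv, es, 𝒢.tgt_one]
    have hχQ : ContMDiffAt 𝓘(ℂ, (ℂ × ℂ) × ℂ) 𝓘(ℂ, ℂ × ℂ) ω (fun p => χ (Q p)) 0 :=
      ContMDiffAt.comp (g := χ) 0
        (by rw [hQ0]; exact hd.contMDiffAt (χ.open_source.mem_nhds h0)) hQ
    have hq : AnalyticAt ℂ (fun p => (χ (Q p)).2) 0 :=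
      analyticAt_snd.comp (contMDiffAt_iff_contDiffAt.1 hχQ).analyticAt
    refine exists_eq_mul_exp hk hT hq hβ hT0 hTβ ?_ ?_
    · have hTt : Filter.Tendsto T (𝓝 0) (𝓝 0) := by
        have := hT.continuousAt.tendsto
        rwa [show T (0, 0) = 0 from hT00] at this
      filter_upwards [htar, hTt.eventually hone] with v h1 h2
      have h3 : Q (v, v.2) = 𝒢.one (T v) := 𝒢.mul_inv _
      rw [h3, h2]
    · filter_upwards [hcomp, hl1.eventually htar, hl2.eventually htar,
        hQ.continuousAt.eventually (hQ0 ▸ χ.open_source.mem_nhds h0)] with p h1 h2 h3 h4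
      have h5 : (T p.1, (χ (Q p)).2) = χ (Q p) := by
        refine Prod.ext ?_ rfl
        rw [hfst _ h4]
        simp only [Q, T, 𝒢.src_mul _ _ h1, 𝒢.src_inv]
      rw [h5]
      simp only [χ.left_inv h4, Q, 𝒢.tgt_mul _ _ h1]
  · have hz1 : ContinuousAt (fun p : ℂ × ℂ => p.1) (z₀, 0) := continuousAt_fst
    refine ⟨fun p => Complex.log (T p / p.1) / p.1 ^ (k - 1), ?_, ?_, ?_⟩
    · refine ((hT.div analyticAt_fst hz₀).clog ?_).div (analyticAt_fst.pow _) (pow_ne_zero _ hz₀)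
      have : T (z₀, 0) / z₀ = 1 := by rw [hT0.self_of_nhds, div_self hz₀]
      simp only [Pi.div_apply, this]
      exact Complex.one_mem_slitPlane
    · have h1 : T (z₀, 0) ≠ 0 := by rwa [hT0.self_of_nhds]
      filter_upwards [hz1.eventually_ne hz₀, hT.continuousAt.eventually_ne h1] with p h2 h3
      rw [mul_div_cancel₀ _ (pow_ne_zero _ h2), Complex.exp_log (div_ne_zero h3 h2),
        mul_div_cancel₀ _ h2]
    · filter_upwards [hT0, eventually_ne_nhds hz₀] with z h1 h2
      simp only [h1, div_self h2, Complex.log_one, zero_div]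

/-- The logarithmic function `u` replaces the second chart coordinate. This is a change of
coordinates by the inverse function theorem, because `∂u/∂y = β ≠ 0` at the base point. -/
theorem Integration.nonempty_logChart (hk : 1 ≤ k) (Φ : 𝒢.Integration k) (z₀ : ℂ) :
    Nonempty (LogChart 𝒢 k z₀) := by
  obtain ⟨e, he, hes, het, hne, hker⟩ := Φ.exists_frame
  obtain ⟨χ, r, hr, h0, htar, hd, hds, hfst, hone'⟩ :=
    exists_chart (e z₀) (hne z₀) (hker z₀) (hes z₀)
  have hone : ∀ᶠ z in 𝓝 z₀, χ (𝒢.one z) = (z, 0) := by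
    filter_upwards [Metric.ball_mem_nhds z₀ hr] with z hz
    rw [← hone' z hz, χ.right_inv]
    rw [htar]
    exact ⟨hz, Metric.mem_ball_self hr⟩
  have e0 : χ (𝒢.one z₀) = (z₀, 0) := hone.self_of_nhds
  have ht : (z₀, (0 : ℂ)) ∈ χ.target := e0 ▸ χ.map_source h0
  have es : χ.symm (z₀, 0) = 𝒢.one z₀ := e0 ▸ χ.left_inv h0
  obtain ⟨β, hβ, hβ0, hTβ⟩ := exists_fderiv_tgt_symm h0 hd hds hfst hone he hes het (hne z₀)
  obtain ⟨u, hu, hTu, hu0⟩ := exists_log_coordinate hk h0 hd hds hfst hone hβ hTβ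
  have hrow : Filter.Tendsto (fun z : ℂ => (z, (0 : ℂ))) (𝓝 z₀) (𝓝 (z₀, 0)) :=
    (Continuous.prodMk_left (0 : ℂ)).tendsto z₀
  -- Differentiating `T = z exp(z^(k-1) u)` at `y = 0` gives `z^k ∂u/∂y = z^k β`; the power of `z`
  -- is cancelled off `z = 0` and the equality extended by continuity.
  have huβ : fderiv ℂ u (z₀, 0) (0, 1) = β z₀ := by
    have hrowa : AnalyticAt ℂ (fun z : ℂ => (z, (0 : ℂ))) z₀ := analyticAt_id.prod analyticAt_const
    have h1 : AnalyticAt ℂ (fun z => fderiv ℂ u (z, 0) (0, 1) - β z) z₀ :=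
      (AnalyticAt.comp (f := fun z : ℂ => (z, (0 : ℂ))) (analyticAt_fderiv_snd hu) hrowa).sub hβ
    refine sub_eq_zero.1 (eventually_eq_zero_of_mul_eq_zero (ContinuousLinearMap.id ℂ ℂ)
      (fun h => by simpa using congrArg (fun l => l 1) h)
      (h1.eventually_analyticAt.mono fun z hz => hz.continuousAt) ?_).self_of_nhds
    filter_upwards [hrow.eventually hTu.eventually_nhds, hTβ, hu0,
      hrow.eventually hu.eventually_analyticAt] with z h2 h3 h4 h5
    have h6 : HasDerivAt (fun y => z * Complex.exp (z ^ (k - 1) * u (z, y)))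
        (z * (Complex.exp (z ^ (k - 1) * u (z, 0)) *
          (z ^ (k - 1) * fderiv ℂ u (z, 0) (0, 1)))) 0 :=
      (((hasDerivAt_snd (v := (z, 0)) h5.differentiableAt).const_mul _).cexp).const_mul _
    have h7 : fderiv ℂ (fun p => 𝒢.tgt (χ.symm p)) (z, 0) =
        fderiv ℂ (fun p : ℂ × ℂ => p.1 * Complex.exp (p.1 ^ (k - 1) * u p)) (z, 0) :=
      Filter.EventuallyEq.fderiv_eq h2
    have h8 : DifferentiableAt ℂ (fun p : ℂ × ℂ => p.1 * Complex.exp (p.1 ^ (k - 1) * u p))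
        (z, 0) :=
      differentiableAt_fst.mul ((differentiableAt_fst.pow _).mul h5.differentiableAt).cexp
    have h9 := (hasDerivAt_snd h8).unique h6
    rw [← h7, h3, h4, mul_zero, Complex.exp_zero, _root_.one_mul, ← _root_.mul_assoc, ← pow_succ',
      Nat.sub_add_cancel hk] at h9
    have h10 : z ^ k * (fderiv ℂ u (z, 0) (0, 1) - β z) = 0 := by
      rw [mul_sub, ← h9, sub_self]
    rcases mul_eq_zero.1 h10 with h | h
    · simp [eq_zero_of_pow_eq_zero h]
    · simp [h]
  let Θ : ℂ × ℂ → ℂ × ℂ := fun p => (p.1, u p)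
  have hΘ : ContDiffAt ℂ ω Θ (z₀, 0) := contDiffAt_fst.prodMk hu.contDiffAt
  let D : ℂ × ℂ →L[ℂ] ℂ × ℂ := (ContinuousLinearMap.fst ℂ ℂ ℂ).prod (fderiv ℂ u (z₀, 0))
  have hD : HasFDerivAt Θ D (z₀, 0) := hasFDerivAt_fst.prodMk hu.differentiableAt.hasFDerivAt
  have hDval : ∀ a b : ℂ, fderiv ℂ u (z₀, 0) (a, b) =
      a * fderiv ℂ u (z₀, 0) (1, 0) + b * β z₀ := fun a b => by
    have : ((a, b) : ℂ × ℂ) = a • (1, 0) + b • (0, 1) := by simp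
    rw [this, map_add, map_smul, map_smul, huβ, smul_eq_mul, smul_eq_mul]
  have hDi : LinearMap.ker D.toLinearMap = ⊥ := by
    refine LinearMap.ker_eq_bot'.2 fun v hv => ?_
    have h1 : v.1 = 0 := congrArg Prod.fst hv
    have h2 : fderiv ℂ u (z₀, 0) (v.1, v.2) = 0 := congrArg Prod.snd hv
    rw [hDval, h1, zero_mul, zero_add] at h2
    exact Prod.ext h1 ((mul_eq_zero.1 h2).resolve_right hβ0)
  have hDs : LinearMap.range D.toLinearMap = ⊤ := by
    refine LinearMap.range_eq_top.2 fun p =>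
      ⟨(p.1, (p.2 - p.1 * fderiv ℂ u (z₀, 0) (1, 0)) / β z₀), Prod.ext rfl ?_⟩
    change fderiv ℂ u (z₀, 0) (p.1, (p.2 - p.1 * fderiv ℂ u (z₀, 0) (1, 0)) / β z₀) = p.2
    rw [hDval, div_mul_cancel₀ _ hβ0]
    ring
  let D' : (ℂ × ℂ) ≃L[ℂ] ℂ × ℂ := ContinuousLinearEquiv.ofBijective D hDi hDs
  have hD' : HasFDerivAt Θ (D' : ℂ × ℂ →L[ℂ] ℂ × ℂ) (z₀, 0) := by
    rw [ContinuousLinearEquiv.coe_ofBijective]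
    exact hD
  let ψ := hΘ.toOpenPartialHomeomorph Θ hD' (by simp)
  have hψ0 : (z₀, (0 : ℂ)) ∈ ψ.source := hΘ.mem_toOpenPartialHomeomorph_source hD' (by simp)
  have hΘ0 : Θ (z₀, 0) = (z₀, 0) := by
    simp only [Θ, hu0.self_of_nhds]
  have hψs : ContDiffAt ℂ ω ψ.symm (z₀, 0) := by
    have := hΘ.to_localInverse hD' (by simp)
    rwa [hΘ0] at this
  have hψs0 : ψ.symm (z₀, 0) = (z₀, 0) := by
    have := ψ.left_inv hψ0
    rwa [show ψ (z₀, 0) = (z₀, 0) from hΘ0] at this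
  let χ₂ := χ.trans ψ
  have hχ₂ : ∀ g, χ₂ g = Θ (χ g) := fun g => rfl
  have hmem : 𝒢.one z₀ ∈ χ₂.source := by
    rw [OpenPartialHomeomorph.trans_source]
    exact ⟨h0, by rw [Set.mem_preimage, e0]; exact hψ0⟩
  have hχc : Filter.Tendsto χ (𝓝 (𝒢.one z₀)) (𝓝 (z₀, 0)) := by
    simpa [ContinuousAt, e0] using χ.continuousAt h0
  obtain ⟨χ', r', hr', h0', hsub, hcoe, htar', hd', hds', hone''⟩ := exists_restrict_bidisc
    (N := {g | 𝒢.tgt (χ.symm (χ g)) =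
      (χ g).1 * Complex.exp ((χ g).1 ^ (k - 1) * u (χ g))}) χ₂ (hχc.eventually hTu) hmem
    (ContMDiffAt.comp (g := Θ) (f := χ) (𝒢.one z₀) (by rw [e0]; exact hΘ.contMDiffAt)
      (hd.contMDiffAt (χ.open_source.mem_nhds h0)))
    (ContMDiffAt.comp (g := χ.symm) (f := ψ.symm) (z₀, (0 : ℂ))
      (by rw [hψs0]; exact hds.contMDiffAt (χ.open_target.mem_nhds ht)) hψs.contMDiffAt) (by
      filter_upwards [hone, hu0] with z hz hz'
      rw [hχ₂, hz]
      simp only [Θ, hz'])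
  have hs : ∀ g ∈ χ'.source, g ∈ χ.source := fun g hg => by
    have := (hsub hg).2
    rw [OpenPartialHomeomorph.trans_source] at this
    exact this.1
  have hf : ∀ g ∈ χ'.source, (χ' g).1 = 𝒢.src g := fun g hg => by
    rw [hcoe]
    exact hfst g (hs g hg)
  refine ⟨⟨χ', r', hr', h0', htar', hd', hds', hf, fun g hg => ?_, hone''⟩⟩
  have h1 := (hsub hg).1
  simp only [Set.mem_ofPred_eq, χ.left_inv (hs g hg), hfst g (hs g hg)] at h1
  rw [h1, hcoe]
  rfl

end HolLieGroupoid
end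


/-! ### Groupoid algebra, local sections, and propagation from the identities. -/

noncomputable section

theorem eq_of_eventuallyEq_punctured {X : Type*} [TopologicalSpace X] [T2Space X] {f g : ℂ → X}
    {z₀ : ℂ} (hf : ContinuousAt f z₀) (hg : ContinuousAt g z₀) (h : ∀ᶠ z in 𝓝[≠] z₀, f z = g z) :
    f z₀ = g z₀ :=
  tendsto_nhds_unique_of_eventuallyEq (hf.tendsto.mono_left nhdsWithin_le_nhds)
    (hg.tendsto.mono_left nhdsWithin_le_nhds) h

theorem eventually_punctured_ne_zero (z₀ : ℂ) : ∀ᶠ z in 𝓝[≠] z₀, z ≠ 0 := by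
  by_cases h : z₀ = 0
  · subst h
    exact self_mem_nhdsWithin
  · exact nhdsWithin_le_nhds (eventually_ne_nhds h)

/-- `d` and `0` lift the same constant map through the covering `exp`, and agree at one point. This
is how identities between logarithms are proved. -/
theorem eq_zero_of_exp_eq_one {X : Type*} [TopologicalSpace X] [PreconnectedSpace X] {d : X → ℂ}
    (hd : Continuous d) (he : ∀ x, Complex.exp (d x) = 1) {x₀ : X} (h0 : d x₀ = 0) (x : X) :
    d x = 0 :=
  congrFun (Complex.isCoveringMap_exp.eq_of_comp_eq (g₂ := fun _ => 0) hd continuous_const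
    (funext fun x => Subtype.ext (by simp [he])) x₀ h0) x

namespace HolLieGroupoid

variable {E : Type*} [NormedAddCommGroup E] [NormedSpace ℂ E] [FiniteDimensional ℂ E]
  {G : Type*} [TopologicalSpace G] [T2Space G] [ChartedSpace E G] [IsManifold 𝓘(ℂ, E) ω G]
  {𝒢 : HolLieGroupoid E ℂ G ℂ} {k : ℕ}

section Algebra

variable {a g h : G}

theorem mul_mul_inv (hag : 𝒢.src a = 𝒢.tgt g) : 𝒢.mul (𝒢.mul a g) (𝒢.inv g) = a := by
  rw [𝒢.mul_assoc _ _ _ hag (𝒢.tgt_inv g).symm, 𝒢.mul_inv, ← hag, 𝒢.mul_one]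

theorem mul_inv_mul (hhg : 𝒢.src h = 𝒢.src g) : 𝒢.mul (𝒢.mul h (𝒢.inv g)) g = h := by
  rw [𝒢.mul_assoc _ _ _ (by rw [𝒢.tgt_inv, hhg]) (𝒢.src_inv g), 𝒢.inv_mul, ← hhg, 𝒢.mul_one]

theorem inv_mul_mul (hag : 𝒢.src a = 𝒢.tgt g) : 𝒢.mul (𝒢.inv a) (𝒢.mul a g) = g := by
  rw [← 𝒢.mul_assoc _ _ _ (𝒢.src_inv a) hag, 𝒢.inv_mul, hag, 𝒢.one_mul]

theorem mul_inv_mul_left (hha : 𝒢.tgt h = 𝒢.tgt a) : 𝒢.mul a (𝒢.mul (𝒢.inv a) h) = h := by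
  rw [← 𝒢.mul_assoc _ _ _ (𝒢.tgt_inv a).symm (by rw [𝒢.src_inv, hha]), 𝒢.mul_inv, ← hha, 𝒢.one_mul]

theorem inv_inv (g : G) : 𝒢.inv (𝒢.inv g) = g := by
  have h := mul_mul_inv (𝒢 := 𝒢) (a := g) (g := 𝒢.inv g) (𝒢.tgt_inv g).symm
  have h2 := 𝒢.one_mul (𝒢.inv (𝒢.inv g))
  rw [𝒢.mul_inv] at h
  rwa [𝒢.tgt_inv, 𝒢.src_inv, h, eq_comm] at h2

end Algebra

theorem continuousAt_mul {M : Type*} [TopologicalSpace M] {f g : M → G} {x : M}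
    (hf : ContinuousAt f x) (hg : ContinuousAt g x)
    (h : ∀ᶠ y in 𝓝 x, 𝒢.src (f y) = 𝒢.tgt (g y)) :
    ContinuousAt (fun y => 𝒢.mul (f y) (g y)) x := by
  have h1 : ContinuousWithinAt (fun p : G × G => 𝒢.mul p.1 p.2) {p | 𝒢.src p.1 = 𝒢.tgt p.2}
      (f x, g x) := 𝒢.holomorphic_mul.continuousOn (f x, g x) h.self_of_nhds
  have h2 : ContinuousWithinAt ((fun p : G × G => 𝒢.mul p.1 p.2) ∘ fun y => (f y, g y))
      {y | 𝒢.src (f y) = 𝒢.tgt (g y)} x :=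
    ContinuousWithinAt.comp (f := fun y => (f y, g y)) h1 (hf.prodMk hg).continuousWithinAt
      fun y hy => hy
  exact h2.continuousAt h

theorem continuous_mul {M : Type*} [TopologicalSpace M] {f g : M → G}
    (hf : Continuous f) (hg : Continuous g) (h : ∀ y, 𝒢.src (f y) = 𝒢.tgt (g y)) :
    Continuous (fun y => 𝒢.mul (f y) (g y)) :=
  continuous_iff_continuousAt.2 fun _ =>
    continuousAt_mul hf.continuousAt hg.continuousAt (Filter.Eventually.of_forall h)

variable (𝒢) in
theorem continuous_src : Continuous 𝒢.src := 𝒢.holomorphic_src.continuous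

variable (𝒢) in
theorem continuous_tgt : Continuous 𝒢.tgt := 𝒢.holomorphic_tgt.continuous

variable (𝒢) in
theorem continuous_inv : Continuous 𝒢.inv := 𝒢.holomorphic_inv.continuous

variable (𝒢) in
/-- The source map has local holomorphic sections through every arrow. -/
theorem exists_src_section (g : G) : ∃ σ : ℂ → G,
    ContMDiffAt 𝓘(ℂ, ℂ) 𝓘(ℂ, E) ω σ (𝒢.src g) ∧ σ (𝒢.src g) = g ∧
      ∀ᶠ z in 𝓝 (𝒢.src g), 𝒢.src (σ z) = z := by
  let φ := chartAt E g
  have hφ0 : g ∈ φ.source := mem_chart_source E _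
  have hφ1 : φ g ∈ φ.target := φ.map_source hφ0
  have hφ2 : φ.symm (φ g) = g := φ.left_inv hφ0
  have hφs : ContMDiffAt 𝓘(ℂ, E) 𝓘(ℂ, E) ω φ.symm (φ g) :=
    (contMDiffOn_chart_symm (I := 𝓘(ℂ, E)) (n := ω) (x := g)).contMDiffAt
      (φ.open_target.mem_nhds hφ1)
  have hs : AnalyticAt ℂ (fun v => 𝒢.src (φ.symm v)) (φ g) :=
    (contMDiffAt_iff_contDiffAt.1 ((𝒢.holomorphic_src _).comp _ hφs)).analyticAt
  have hA : ∀ v : E, fderiv ℂ (fun v => 𝒢.src (φ.symm v)) (φ g) v =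
      mfderiv 𝓘(ℂ, E) 𝓘(ℂ, ℂ) 𝒢.src g v := by
    intro v
    rw [(𝒢.mdifferentiableAt_src _).mfderiv]
    simp only [writtenInExtChartAt, mfld_simps, fderivWithin_univ]
    rfl
  obtain ⟨v, hv⟩ := 𝒢.submersion_src g (1 : ℂ)
  obtain ⟨v', hv'⟩ : ∃ v' : E, v' = v := ⟨v, rfl⟩
  have hline : AnalyticAt ℂ (fun c : ℂ => φ g + c • v') 0 := by fun_prop
  have hl0 : φ g + (0 : ℂ) • v' = φ g := by simp
  -- The source map along a line in a direction `v` with `ds(v) = 1`; the one-variable inverse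
  -- function theorem reparametrizes the line into a section.
  let f : ℂ → ℂ := fun c => 𝒢.src (φ.symm (φ g + c • v'))
  have hf : AnalyticAt ℂ f 0 :=
    AnalyticAt.comp (g := fun v => 𝒢.src (φ.symm v)) (f := fun c : ℂ => φ g + c • v')
      (by rwa [hl0]) hline
  have hf0 : f 0 = 𝒢.src g := by simp only [f, hl0, hφ2]
  have hd : deriv f 0 = 1 := by
    have h1 : HasDerivAt (fun c : ℂ => φ g + c • v') v' 0 := by
      simpa using ((hasDerivAt_id (0 : ℂ)).smul_const v').const_add (φ g)
    have h2 : HasDerivAt f (fderiv ℂ (fun v => 𝒢.src (φ.symm v)) (φ g) v') 0 :=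
      HasFDerivAt.comp_hasDerivAt (0 : ℂ) (l := fun v => 𝒢.src (φ.symm v))
        (by rw [hl0]; exact hs.differentiableAt.hasFDerivAt) h1
    refine h2.deriv.trans ((hA v').trans ?_)
    rw [hv']
    exact hv
  have hd0 : deriv f 0 ≠ 0 := by rw [hd]; exact one_ne_zero
  let i := HasStrictDerivAt.localInverse f (deriv f 0) 0 hf.hasStrictDerivAt hd0
  have hi : AnalyticAt ℂ i (𝒢.src g) := hf0 ▸ hf.analyticAt_localInverse hd0
  have hi0 : i (𝒢.src g) = 0 := by
    rw [← hf0]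
    exact HasStrictFDerivAt.localInverse_apply_image _
  have hfi : ∀ᶠ z in 𝓝 (𝒢.src g), f (i z) = z := by
    rw [← hf0]
    exact HasStrictFDerivAt.eventually_right_inverse _
  have hli : AnalyticAt ℂ (fun z => φ g + i z • v') (𝒢.src g) :=
    analyticAt_const.add (hi.smul analyticAt_const)
  refine ⟨fun z => φ.symm (φ g + i z • v'), ?_, ?_, hfi⟩
  · exact ContMDiffAt.comp (g := φ.symm) (f := fun z => φ g + i z • v') _
      (by rw [hi0, hl0]; exact hφs) hli.contDiffAt.contMDiffAt
  · simp only [hi0, hl0, hφ2]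

variable (𝒢) in
theorem exists_tgt_section (g : G) : ∃ σ : ℂ → G,
    ContMDiffAt 𝓘(ℂ, ℂ) 𝓘(ℂ, E) ω σ (𝒢.tgt g) ∧ σ (𝒢.tgt g) = g ∧
      ∀ᶠ z in 𝓝 (𝒢.tgt g), 𝒢.tgt (σ z) = z := by
  obtain ⟨σ, h1, h2, h3⟩ := 𝒢.exists_src_section (𝒢.inv g)
  rw [𝒢.src_inv] at h1 h2 h3
  exact ⟨fun z => 𝒢.inv (σ z), (𝒢.holomorphic_inv _).comp _ h1, (congrArg 𝒢.inv h2).trans (inv_inv g),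
    h3.mono fun z hz => by rw [𝒢.tgt_inv, hz]⟩

/-- Arrows near a product are products of arrows near the factors. -/
theorem exists_factorization {a g : G} (hag : 𝒢.src a = 𝒢.tgt g) : ∃ σ η : G → G,
    ContMDiffAt 𝓘(ℂ, E) 𝓘(ℂ, E) ω σ (𝒢.mul a g) ∧ ContMDiffAt 𝓘(ℂ, E) 𝓘(ℂ, E) ω η (𝒢.mul a g) ∧
      σ (𝒢.mul a g) = a ∧ η (𝒢.mul a g) = g ∧
      ∀ᶠ h in 𝓝 (𝒢.mul a g), 𝒢.src (σ h) = 𝒢.tgt (η h) ∧ 𝒢.mul (σ h) (η h) = h := by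
  obtain ⟨ς, h1, h2, h3⟩ := 𝒢.exists_tgt_section a
  have ht : 𝒢.tgt (𝒢.mul a g) = 𝒢.tgt a := 𝒢.tgt_mul a g hag
  have hσ : ContMDiffAt 𝓘(ℂ, E) 𝓘(ℂ, E) ω (fun h => ς (𝒢.tgt h)) (𝒢.mul a g) :=
    ContMDiffAt.comp (g := ς) _ (by rw [ht]; exact h1) (𝒢.holomorphic_tgt _)
  have hev : ∀ᶠ h in 𝓝 (𝒢.mul a g), 𝒢.tgt (ς (𝒢.tgt h)) = 𝒢.tgt h :=
    (𝒢.continuous_tgt.tendsto _).eventually (by rw [ht]; exact h3)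
  -- The left factor is the target section through `a` evaluated at `tgt h`; the right factor is
  -- then forced.
  refine ⟨fun h => ς (𝒢.tgt h), fun h => 𝒢.mul (𝒢.inv (ς (𝒢.tgt h))) h, hσ, ?_, ?_, ?_, ?_⟩
  · refine contMDiffAt_mul ((𝒢.holomorphic_inv _).comp _ hσ) contMDiffAt_id ?_
    filter_upwards [hev] with h hh
    rw [𝒢.src_inv, hh]
  · simp only [ht, h2]
  · simp only [ht, h2, inv_mul_mul hag]
  · filter_upwards [hev] with h hh
    refine ⟨?_, mul_inv_mul_left hh.symm⟩
    rw [𝒢.tgt_mul _ _ (by rw [𝒢.src_inv, hh]), 𝒢.tgt_inv]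

/-- A composable pair of arrows lies on a holomorphic curve of composable pairs that is transverse
to the source fibres. -/
theorem exists_composable_curve {g h : G} (hgh : 𝒢.src g = 𝒢.tgt h) : ∃ α β : ℂ → G,
    ContinuousAt α (𝒢.src h) ∧ ContinuousAt β (𝒢.src h) ∧ α (𝒢.src h) = g ∧ β (𝒢.src h) = h ∧
      ∀ᶠ z in 𝓝 (𝒢.src h), 𝒢.src (α z) = 𝒢.tgt (β z) ∧ 𝒢.src (β z) = z := by
  obtain ⟨β, h1, h2, h3⟩ := 𝒢.exists_src_section h
  obtain ⟨α, h4, h5, h6⟩ := 𝒢.exists_src_section g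
  have hc : ContinuousAt (fun z => 𝒢.tgt (β z)) (𝒢.src h) :=
    𝒢.continuous_tgt.continuousAt.comp h1.continuousAt
  have he : 𝒢.tgt (β (𝒢.src h)) = 𝒢.src g := by rw [h2, hgh]
  -- Precomposing the section through `g` with `tgt ∘ β` keeps the pair composable.
  refine ⟨fun z => α (𝒢.tgt (β z)), β,
    ContinuousAt.comp (g := α) (by rw [he]; exact h4.continuousAt) hc, h1.continuousAt, ?_, h2, ?_⟩
  · simp only [he, h5]
  · have h7 : Filter.Tendsto (fun z => 𝒢.tgt (β z)) (𝓝 (𝒢.src h)) (𝓝 (𝒢.src g)) := by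
      rw [← he]
      exact hc
    filter_upwards [h3, h7.eventually h6] with z hz hz' using ⟨hz', hz⟩

/-- Two functions that are continuous at an arrow and agree near it where the source does not
vanish agree at the arrow. -/
theorem eq_of_eventually_src_ne_zero {f₁ f₂ : G → ℂ} {g : G} (h1 : ContinuousAt f₁ g)
    (h2 : ContinuousAt f₂ g) (h : ∀ᶠ g' in 𝓝 g, 𝒢.src g' ≠ 0 → f₁ g' = f₂ g') : f₁ g = f₂ g := by
  obtain ⟨σ, hσ, hσ0, hσs⟩ := 𝒢.exists_src_section g
  have hσc : Filter.Tendsto σ (𝓝 (𝒢.src g)) (𝓝 g) := by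
    have := hσ.continuousAt.tendsto
    rwa [hσ0] at this
  have := eq_of_eventuallyEq_punctured (f := fun z => f₁ (σ z)) (g := fun z => f₂ (σ z))
    (z₀ := 𝒢.src g) (ContinuousAt.comp (by rwa [hσ0]) hσ.continuousAt)
    (ContinuousAt.comp (by rwa [hσ0]) hσ.continuousAt) (by
      filter_upwards [nhdsWithin_le_nhds (hσc.eventually h), nhdsWithin_le_nhds hσs,
        eventually_punctured_ne_zero (𝒢.src g)] with z h3 h4 h5
      exact h3 (by rwa [h4]))
  simpa only [hσ0] using this

/-- A nonempty open set of arrows that is stable under left multiplication by arrows near the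
identities is everything, if the source fibres are connected. -/
theorem eq_univ_of_mul_mem (hconn : ∀ z, PreconnectedSpace (𝒢.src ⁻¹' {z})) {A : Set G}
    (hA : IsOpen A) (hone : ∀ x, 𝒢.one x ∈ A)
    (hmul : ∀ x, ∃ N ∈ 𝓝 (𝒢.one x), ∀ a ∈ N, ∀ h ∈ A, 𝒢.src a = 𝒢.tgt h → 𝒢.mul a h ∈ A) (g : G) :
    g ∈ A := by
  have := hconn (𝒢.src g)
  let A' : Set (𝒢.src ⁻¹' {𝒢.src g}) := Subtype.val ⁻¹' A
  -- For `h'` close to `h` in the source fibre, `h = (h h'⁻¹) h'` with `h h'⁻¹` close to an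
  -- identity. Thus `h' ∈ A` would force `h ∈ A`.
  have hclosed : IsClosed A' := by
    rw [← isOpen_compl_iff, isOpen_iff_mem_nhds]
    intro h hh
    obtain ⟨N, hN, hNA⟩ := hmul (𝒢.tgt h)
    have hs : ∀ h' : 𝒢.src ⁻¹' {𝒢.src g}, 𝒢.src h = 𝒢.src h' := fun h' => h.2.trans h'.2.symm
    have hc : Continuous fun h' : 𝒢.src ⁻¹' {𝒢.src g} => 𝒢.mul h (𝒢.inv h') :=
      continuous_mul continuous_const (𝒢.continuous_inv.comp continuous_subtype_val)
        fun h' => by rw [𝒢.tgt_inv, hs h']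
    have hN' : N ∈ 𝓝 (𝒢.mul h (𝒢.inv (h : G))) := by rwa [𝒢.mul_inv]
    filter_upwards [hc.continuousAt hN'] with h' hh' hcon
    refine hh ?_
    have h1 := hNA _ hh' h' hcon (by
      rw [𝒢.src_mul _ _ (by rw [𝒢.tgt_inv, hs h']), 𝒢.src_inv])
    rw [mul_inv_mul (hs h')] at h1
    exact h1
  have h1 : A' = Set.univ := IsClopen.eq_univ ⟨hclosed, hA.preimage continuous_subtype_val⟩
    ⟨⟨𝒢.one (𝒢.src g), 𝒢.src_one _⟩, hone _⟩
  have h2 : (⟨g, rfl⟩ : 𝒢.src ⁻¹' {𝒢.src g}) ∈ A' := h1 ▸ Set.mem_univ _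
  exact h2

/-- `F` is near `g` the product of a power of the source map and a holomorphic function. -/
def DivisibleAt (𝒢 : HolLieGroupoid E ℂ G ℂ) (n : ℕ) (F : G → ℂ) (g : G) : Prop :=
  ∃ u : G → ℂ, ContMDiffAt 𝓘(ℂ, E) 𝓘(ℂ, ℂ) ω u g ∧ ∀ᶠ h in 𝓝 g, F h = 𝒢.src h ^ n * u h

theorem isOpen_divisibleAt (n : ℕ) (F : G → ℂ) : IsOpen {g | 𝒢.DivisibleAt n F g} := by
  rw [isOpen_iff_mem_nhds]
  rintro g ⟨u, hu, hF⟩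
  filter_upwards [(contMDiffAt_iff_contMDiffAt_nhds (by simp)).1 hu, hF.eventually_nhds]
    with h h1 h2 using ⟨u, h1, h2⟩

/-- The local quotients are unique by continuity, since the source map is a submersion and vanishes
on no open set; so they glue along the diagonal `u h h`. -/
theorem exists_eq_src_pow_mul {n : ℕ} {F : G → ℂ} (hF : ∀ g, 𝒢.DivisibleAt n F g) :
    ∃ u : G → ℂ, ContMDiff 𝓘(ℂ, E) 𝓘(ℂ, ℂ) ω u ∧ ∀ g, F g = 𝒢.src g ^ n * u g := by
  choose u hu huF using hF
  have huu : ∀ g, (fun h => u h h) =ᶠ[𝓝 g] u g := by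
    intro g
    filter_upwards [(contMDiffAt_iff_contMDiffAt_nhds (by simp)).1 (hu g),
      (huF g).eventually_nhds] with h h1 h2
    refine eq_of_eventually_src_ne_zero (𝒢 := 𝒢) (hu h).continuousAt h1.continuousAt ?_
    filter_upwards [h2, huF h] with h' h3 h4 h5
    exact mul_left_cancel₀ (pow_ne_zero n h5) (h4.symm.trans h3)
  exact ⟨fun g => u g g, fun g => (hu g).congr_of_eventuallyEq (huu g),
    fun g => (huF g).self_of_nhds⟩

end HolLieGroupoid
end


/-! ### Source fibres, and the quotient of the target by the source. -/

noncomputable section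

namespace HolLieGroupoid

variable {E : Type*} [NormedAddCommGroup E] [NormedSpace ℂ E] [FiniteDimensional ℂ E]
  {G : Type*} [TopologicalSpace G] [T2Space G] [ChartedSpace E G] [IsManifold 𝓘(ℂ, E) ω G]
  {𝒢 : HolLieGroupoid E ℂ G ℂ} {k : ℕ}

namespace LogChart

variable {x : ℂ} (c : LogChart 𝒢 k x)

theorem source_mem_nhds : c.chart.source ∈ 𝓝 (𝒢.one x) := c.chart.open_source.mem_nhds c.one_mem

theorem mem_target {w : ℂ} (hw : w ∈ Metric.ball (0 : ℂ) c.radius) : (x, w) ∈ c.chart.target := by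
  rw [c.target_eq]
  exact ⟨Metric.mem_ball_self c.radius_pos, hw⟩

theorem src_symm {p : ℂ × ℂ} (hp : p ∈ c.chart.target) : 𝒢.src (c.chart.symm p) = p.1 := by
  rw [← c.fst_eq _ (c.chart.map_target hp), c.chart.right_inv hp]

theorem chart_one : c.chart (𝒢.one x) = (x, 0) := by
  rw [← c.symm_zero x (Metric.mem_ball_self c.radius_pos),
    c.chart.right_inv (c.mem_target (Metric.mem_ball_self c.radius_pos))]

theorem symm_self : c.chart.symm (x, 0) = 𝒢.one x :=
  c.symm_zero x (Metric.mem_ball_self c.radius_pos)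

theorem contMDiffAt_snd {g : G} (hg : g ∈ c.chart.source) :
    ContMDiffAt 𝓘(ℂ, E) 𝓘(ℂ, ℂ) ω (fun h => (c.chart h).2) g :=
  ContMDiffAt.comp (g := Prod.snd) (f := c.chart) g
    (contMDiffAt_iff_contDiffAt.2 contDiffAt_snd)
    (c.contMDiffOn.contMDiffAt (c.chart.open_source.mem_nhds hg))

/-- The right translate by `g` of the source fibre in a chart. -/
def plaque {g : G} (hg : 𝒢.tgt g = x) (w : Metric.ball (0 : ℂ) c.radius) :
    𝒢.src ⁻¹' {𝒢.src g} :=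
  ⟨𝒢.mul (c.chart.symm (x, w)) g, 𝒢.src_mul _ _ ((c.src_symm (c.mem_target w.2)).trans hg.symm)⟩

theorem continuous_plaque {g : G} (hg : 𝒢.tgt g = x) : Continuous (c.plaque hg) := by
  refine Continuous.subtype_mk (continuous_mul ?_ continuous_const
    fun w => (c.src_symm (c.mem_target w.2)).trans hg.symm) _
  exact c.chart.continuousOn_symm.comp_continuous
    (f := fun w : Metric.ball (0 : ℂ) c.radius => (x, (w : ℂ))) (by fun_prop)
    fun w => c.mem_target w.2

theorem plaque_zero {g : G} (hg : 𝒢.tgt g = x) (h0 : (0 : ℂ) ∈ Metric.ball (0 : ℂ) c.radius) :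
    c.plaque hg ⟨0, h0⟩ = ⟨g, rfl⟩ := by
  subst hg
  refine Subtype.ext ?_
  change 𝒢.mul (c.chart.symm (𝒢.tgt g, 0)) g = g
  rw [c.symm_self, 𝒢.one_mul]

/-- The coordinate on the source fibre near `g` that inverts `plaque`. -/
theorem eventually_plaque {g : G} (hg : 𝒢.tgt g = x) {ρ : ℝ} (hρ : 0 < ρ) :
    ∀ᶠ h : 𝒢.src ⁻¹' {𝒢.src g} in 𝓝 ⟨g, rfl⟩,
      𝒢.mul h (𝒢.inv g) ∈ c.chart.source ∧
      ∃ w : Metric.ball (0 : ℂ) c.radius, ‖(w : ℂ)‖ < ρ ∧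
        (w : ℂ) = (c.chart (𝒢.mul h (𝒢.inv g))).2 ∧ c.plaque hg w = h := by
  have hsrc : ∀ h : 𝒢.src ⁻¹' {𝒢.src g}, 𝒢.src h = 𝒢.src g := fun h => h.2
  have hc : Continuous fun h : 𝒢.src ⁻¹' {𝒢.src g} => 𝒢.mul h (𝒢.inv g) :=
    continuous_mul continuous_subtype_val continuous_const fun h => by rw [𝒢.tgt_inv, hsrc h]
  have hg' : 𝒢.mul g (𝒢.inv g) = 𝒢.one x := by rw [𝒢.mul_inv, hg]
  have h1 : ∀ᶠ h : 𝒢.src ⁻¹' {𝒢.src g} in 𝓝 ⟨g, rfl⟩, 𝒢.mul h (𝒢.inv g) ∈ c.chart.source :=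
    (hc.tendsto' ⟨g, rfl⟩ (𝒢.one x) hg').eventually c.source_mem_nhds
  have h2 : ∀ᶠ a in 𝓝 (𝒢.one x), ‖(c.chart a).2‖ < ρ := by
    have h3 : ContinuousAt (fun a => ‖(c.chart a).2‖) (𝒢.one x) :=
      (c.contMDiffAt_snd c.one_mem).continuousAt.norm
    refine h3.eventually_lt continuousAt_const ?_
    simpa [c.chart_one] using hρ
  have h3 : ∀ᶠ h : 𝒢.src ⁻¹' {𝒢.src g} in 𝓝 ⟨g, rfl⟩, ‖(c.chart (𝒢.mul h (𝒢.inv g))).2‖ < ρ :=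
    (hc.tendsto' ⟨g, rfl⟩ (𝒢.one x) hg').eventually h2
  filter_upwards [h1, h3] with h h4 h5
  have h6 := c.chart.map_source h4
  have h7 : (c.chart (𝒢.mul h (𝒢.inv g))).1 = x := by
    rw [c.fst_eq _ h4, 𝒢.src_mul _ _ (by rw [𝒢.tgt_inv, hsrc h]), 𝒢.src_inv, hg]
  have h8 := h6
  rw [c.target_eq] at h8
  refine ⟨h4, ⟨_, h8.2⟩, h5, rfl, Subtype.ext ?_⟩
  have h9 : (x, (c.chart (𝒢.mul h (𝒢.inv g))).2) = c.chart (𝒢.mul h (𝒢.inv g)) :=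
    Prod.ext h7.symm rfl
  simp only [plaque, h9, c.chart.left_inv h4, mul_inv_mul (hsrc h)]

end LogChart

/-- Right translates of discs in a chart are path connected neighbourhoods. Lifting through `exp` on
a source fibre needs this property. -/
theorem locallyPathConnectedSpace_fibre (C : ∀ x, LogChart 𝒢 k x) (z : ℂ) :
    LocallyPathConnectedSpace (𝒢.src ⁻¹' {z}) := by
  rw [locallyPathConnectedSpace_iff_pathComponentIn_mem_nhds]
  rintro ⟨g, rfl⟩ S hS hg
  let c := C (𝒢.tgt g)
  have h0 : (0 : ℂ) ∈ Metric.ball (0 : ℂ) c.radius := Metric.mem_ball_self c.radius_pos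
  have hc := c.continuous_plaque (g := g) rfl
  have hz := c.plaque_zero (g := g) rfl h0
  have hS' : ∀ᶠ w in 𝓝 (⟨0, h0⟩ : Metric.ball (0 : ℂ) c.radius), c.plaque (g := g) rfl w ∈ S :=
    hc.continuousAt.eventually (by rw [hz]; exact hS.mem_nhds hg)
  obtain ⟨ρ, hρ, hball⟩ := Metric.eventually_nhds_iff_ball.1 hS'
  have hle : Metric.ball (0 : ℂ) (min ρ c.radius) ⊆ Metric.ball 0 c.radius :=
    Metric.ball_subset_ball (min_le_right _ _)
  have hpos : 0 < min ρ c.radius := lt_min hρ c.radius_pos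
  have : PathConnectedSpace (Metric.ball (0 : ℂ) (min ρ c.radius)) :=
    isPathConnected_iff_pathConnectedSpace.1
      ((convex_ball 0 _).isPathConnected ⟨0, Metric.mem_ball_self hpos⟩)
  have hpc := isPathConnected_range (hc.comp (continuous_inclusion hle))
  refine Filter.mem_of_superset ?_ (hpc.subset_pathComponentIn (F := S) ?_ ?_)
  · filter_upwards [c.eventually_plaque (g := g) rfl hpos] with h hh
    obtain ⟨-, w, h1, -, h3⟩ := hh
    exact ⟨⟨w, by simpa using h1⟩, h3⟩
  · exact ⟨⟨0, Metric.mem_ball_self hpos⟩, hz⟩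
  · rintro _ ⟨w, rfl⟩
    refine hball _ ?_
    have := w.2
    rw [Metric.mem_ball] at this ⊢
    exact this.trans_le (min_le_left _ _)

/-- The target map is the product of the source map and a nowhere vanishing multiplicative
holomorphic function. -/
theorem exists_tgt_eq_src_mul (C : ∀ x, LogChart 𝒢 k x)
    (hconn : ∀ z, PreconnectedSpace (𝒢.src ⁻¹' {z})) :
    ∃ m : G → ℂ, ContMDiff 𝓘(ℂ, E) 𝓘(ℂ, ℂ) ω m ∧ (∀ g, 𝒢.tgt g = 𝒢.src g * m g) ∧
      (∀ x, ∀ g ∈ (C x).chart.source,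
        m g = Complex.exp (𝒢.src g ^ (k - 1) * ((C x).chart g).2)) ∧
      (∀ x, m (𝒢.one x) = 1) ∧ (∀ g, m g ≠ 0) ∧
      ∀ g h, 𝒢.src g = 𝒢.tgt h → m (𝒢.mul g h) = m g * m h := by
  have hchart : ∀ x, ∀ a ∈ (C x).chart.source, ContMDiffAt 𝓘(ℂ, E) 𝓘(ℂ, ℂ) ω
      (fun g => Complex.exp (𝒢.src g ^ (k - 1) * ((C x).chart g).2)) a := fun x a ha =>
    ContMDiffAt.comp (g := Complex.exp) a Complex.contDiff_exp.contDiffAt.contMDiffAt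
      (((𝒢.holomorphic_src a).pow (k - 1)).mul ((C x).contMDiffAt_snd ha))
  -- Stability: `t(ah) = t(a)` is a multiple of `s(a)` for small `a`, and `s(a) = t(h)` is a
  -- multiple of `s(h) = s(ah)`.
  have hdiv : ∀ g, 𝒢.DivisibleAt 1 𝒢.tgt g := by
    refine eq_univ_of_mul_mem hconn (A := {g | 𝒢.DivisibleAt 1 𝒢.tgt g})
      (isOpen_divisibleAt 1 𝒢.tgt) (fun x => ?_) (fun x => ?_)
    · refine ⟨_, hchart x _ (C x).one_mem, ?_⟩
      filter_upwards [(C x).source_mem_nhds] with g hg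
      rw [(C x).tgt_eq g hg, pow_one]
    · refine ⟨_, (C x).source_mem_nhds, ?_⟩
      rintro a ha h ⟨u, hu, hut⟩ hah
      obtain ⟨σ, η, hσ, hη, hσ0, hη0, hση⟩ := exists_factorization hah
      refine ⟨fun g => u (η g) * Complex.exp (𝒢.src (σ g) ^ (k - 1) * ((C x).chart (σ g)).2),
        ?_, ?_⟩
      · exact (ContMDiffAt.comp (g := u) _ (by rwa [hη0]) hη).mul
          (ContMDiffAt.comp (g := fun g => Complex.exp (𝒢.src g ^ (k - 1) * ((C x).chart g).2)) _
            (hchart x _ (by rwa [hσ0])) hσ)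
      · filter_upwards [hση,
          hσ.continuousAt.eventually (by rw [hσ0]; exact (C x).chart.open_source.mem_nhds ha),
          hη.continuousAt.eventually (by rw [hη0]; exact hut)] with h' h1 h2 h3
        have h4 : 𝒢.tgt h' = 𝒢.tgt (σ h') := by
          conv_lhs => rw [← h1.2, 𝒢.tgt_mul _ _ h1.1]
        have h5 : 𝒢.src h' = 𝒢.src (η h') := by
          conv_lhs => rw [← h1.2, 𝒢.src_mul _ _ h1.1]
        have h6 : 𝒢.src (σ h') = 𝒢.src h' ^ 1 * u (η h') := by rw [h1.1, h3, h5]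
        rw [h4, (C x).tgt_eq _ h2]
        conv_lhs => enter [1]; rw [h6]
        ring
  obtain ⟨m, hm, htm⟩ := exists_eq_src_pow_mul hdiv
  simp only [pow_one] at htm
  have hmchart : ∀ x, ∀ g ∈ (C x).chart.source,
      m g = Complex.exp (𝒢.src g ^ (k - 1) * ((C x).chart g).2) := fun x g hg => by
    refine eq_of_eventually_src_ne_zero (𝒢 := 𝒢) hm.continuous.continuousAt
      (hchart x g hg).continuousAt ?_
    filter_upwards [(C x).chart.open_source.mem_nhds hg] with g' hg' h0
    exact mul_left_cancel₀ h0 ((htm g').symm.trans ((C x).tgt_eq g' hg'))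
  have hmone : ∀ x, m (𝒢.one x) = 1 := fun x => by
    rw [hmchart x _ (C x).one_mem, (C x).chart_one]
    simp
  -- Comparing targets gives `s(h) m(gh) = s(h) m(h) m(g)`. The factor `s(h)` may vanish, so the
  -- pair is first moved along a curve on which the source varies.
  have hmmul : ∀ g h, 𝒢.src g = 𝒢.tgt h → m (𝒢.mul g h) = m g * m h := fun g h hgh => by
    obtain ⟨α, β, hα, hβ, hα0, hβ0, hαβ⟩ := exists_composable_curve hgh
    have h1 := eq_of_eventuallyEq_punctured (z₀ := 𝒢.src h)
      (f := fun z => m (𝒢.mul (α z) (β z))) (g := fun z => m (α z) * m (β z))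
      (hm.continuous.continuousAt.comp (continuousAt_mul hα hβ (hαβ.mono fun _ h => h.1)))
      ((hm.continuous.continuousAt.comp hα).mul (hm.continuous.continuousAt.comp hβ)) (by
        filter_upwards [nhdsWithin_le_nhds hαβ, eventually_punctured_ne_zero (𝒢.src h)] with z h1 h2
        refine mul_left_cancel₀ h2 ?_
        have h3 := htm (𝒢.mul (α z) (β z))
        rw [𝒢.src_mul _ _ h1.1, 𝒢.tgt_mul _ _ h1.1, htm (α z), h1.1, htm (β z), h1.2] at h3
        rw [← h3]
        ring)
    simpa only [hα0, hβ0] using h1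
  refine ⟨m, hm, htm, hmchart, hmone, fun g hg => ?_, hmmul⟩
  have h1 := hmmul g (𝒢.inv g) (𝒢.tgt_inv g).symm
  rw [𝒢.mul_inv, hmone, hg, zero_mul] at h1
  exact one_ne_zero h1

end HolLieGroupoid
end


/-! ### The additive logarithm and the global coordinate. -/

noncomputable section

namespace HolLieGroupoid

variable {E : Type*} [NormedAddCommGroup E] [NormedSpace ℂ E] [FiniteDimensional ℂ E]
  {G : Type*} [TopologicalSpace G] [T2Space G] [ChartedSpace E G] [IsManifold 𝓘(ℂ, E) ω G]
  {𝒢 : HolLieGroupoid E ℂ G ℂ} {k : ℕ}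

/-- A nowhere vanishing multiplicative function has an additive logarithm, if the source fibres are
simply connected. -/
theorem exists_log_multiplicative (C : ∀ x, LogChart 𝒢 k x) (hsc : 𝒢.SourceSimplyConnected)
    {m : G → ℂ} (hm : Continuous m) (hm0 : ∀ g, m g ≠ 0) (hmone : ∀ x, m (𝒢.one x) = 1)
    (hmmul : ∀ g h, 𝒢.src g = 𝒢.tgt h → m (𝒢.mul g h) = m g * m h) :
    ∃ L : G → ℂ, (∀ z, Continuous fun g : 𝒢.src ⁻¹' {z} => L g) ∧ (∀ g, Complex.exp (L g) = m g) ∧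
      (∀ x, L (𝒢.one x) = 0) ∧
      ∀ g h, 𝒢.src g = 𝒢.tgt h → L (𝒢.mul g h) = L g + L h := by
  -- The logarithm is chosen fibre by fibre, normalized at the identity; its continuity across
  -- source fibres is not yet known.
  have hlift : ∀ z, ∃ ℓ : C(𝒢.src ⁻¹' {z}, ℂ), ℓ ⟨𝒢.one z, 𝒢.src_one z⟩ = 0 ∧
      ∀ g, Complex.exp (ℓ g) = m g := fun z => by
    have := hsc z
    have := locallyPathConnectedSpace_fibre C z
    obtain ⟨ℓ, ⟨h1, h2⟩, -⟩ := Complex.isCoveringMapOn_exp.existsUnique_continuousMap_lifts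
      (⟨fun g => m g, hm.comp continuous_subtype_val⟩ : C(𝒢.src ⁻¹' {z}, ℂ))
      (a₀ := ⟨𝒢.one z, 𝒢.src_one z⟩) (e₀ := 0) (by simp [hmone]) (fun g => by simp [hm0])
    exact ⟨ℓ, h1, fun g => congrFun h2 g⟩
  choose ℓ hℓ0 hℓ using hlift
  let L : G → ℂ := fun g => ℓ (𝒢.src g) ⟨g, rfl⟩
  have hL : ∀ z (g : 𝒢.src ⁻¹' {z}), L g = ℓ z g := by
    rintro z ⟨g, rfl⟩
    rfl
  have hLc : ∀ z, Continuous fun g : 𝒢.src ⁻¹' {z} => L g := fun z => by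
    simp only [hL]
    exact (ℓ z).continuous
  have hLone : ∀ x, L (𝒢.one x) = 0 := fun x => (hL x ⟨_, 𝒢.src_one x⟩).trans (hℓ0 x)
  have hLexp : ∀ g, Complex.exp (L g) = m g := fun g => hℓ _ _
  refine ⟨L, hLc, hLexp, hLone, fun g h hgh => ?_⟩
  have := hsc (𝒢.tgt h)
  have hs : ∀ a : 𝒢.src ⁻¹' {𝒢.tgt h}, 𝒢.src a = 𝒢.tgt h := fun a => a.2
  -- With `h` fixed and `a` varying in the connected source fibre over `tgt h`, the defect of
  -- additivity lies in the kernel of `exp` and vanishes when `a` is an identity.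
  have hd : Continuous fun a : 𝒢.src ⁻¹' {𝒢.tgt h} => L (𝒢.mul a h) - (L a + L h) :=
    ((hLc (𝒢.src h)).comp (Continuous.subtype_mk
      (continuous_mul continuous_subtype_val continuous_const hs)
      fun a => 𝒢.src_mul _ _ (hs a))).sub ((hLc _).add continuous_const)
  refine sub_eq_zero.1 (eq_zero_of_exp_eq_one hd (fun a => ?_)
    (x₀ := ⟨𝒢.one (𝒢.tgt h), 𝒢.src_one _⟩) ?_ ⟨g, hgh⟩)
  · rw [Complex.exp_sub, Complex.exp_add, hLexp, hLexp, hLexp, hmmul _ _ (hs a)]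
    exact div_self (mul_ne_zero (hm0 _) (hm0 _))
  · simp only [𝒢.one_mul, hLone, zero_add, sub_self]

/-- The global coordinate on the arrows of a Stokes groupoid. -/
theorem exists_global_coordinate (hk : 1 ≤ k) (C : ∀ x, LogChart 𝒢 k x)
    (hsc : 𝒢.SourceSimplyConnected) :
    ∃ u : G → ℂ, ContMDiff 𝓘(ℂ, E) 𝓘(ℂ, ℂ) ω u ∧
      (∀ g, 𝒢.tgt g = Complex.exp (u g * 𝒢.src g ^ (k - 1)) * 𝒢.src g) ∧
      (∀ x, ∀ g ∈ (C x).chart.source, u g = ((C x).chart g).2) ∧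
      ∀ g h, 𝒢.src g = 𝒢.tgt h →
        u (𝒢.mul g h) = u g * Complex.exp (((k : ℂ) - 1) * u h * 𝒢.src h ^ (k - 1)) + u h := by
  have hconn : ∀ z, PreconnectedSpace (𝒢.src ⁻¹' {z}) := fun z => by
    have := hsc z
    infer_instance
  obtain ⟨m, hm, htm, hmchart, hmone, hm0, hmmul⟩ := exists_tgt_eq_src_mul C hconn
  obtain ⟨L, hLc, hLexp, hLone, hLmul⟩ :=
    exists_log_multiplicative C hsc hm.continuous hm0 hmone hmmul
  -- On a disc of fixed source, `L` and `s^(k-1) w` are two logarithms of `m` that vanish at `w =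
  -- 0`. The source is fixed because `L` is so far continuous only along source fibres.
  have hLchart : ∀ x, ∀ g ∈ (C x).chart.source, L g = 𝒢.src g ^ (k - 1) * ((C x).chart g).2 := by
    intro x g hg
    have h1 := (C x).chart.map_source hg
    have h2 := h1
    rw [(C x).target_eq] at h2
    have hz := (C x).fst_eq g hg
    have hmem : ∀ w : Metric.ball (0 : ℂ) (C x).radius,
        (((C x).chart g).1, (w : ℂ)) ∈ (C x).chart.target := fun w => by
      rw [(C x).target_eq]
      exact ⟨h2.1, w.2⟩
    have hs : ∀ w : Metric.ball (0 : ℂ) (C x).radius,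
        𝒢.src ((C x).chart.symm (((C x).chart g).1, (w : ℂ))) = 𝒢.src g := fun w => by
      rw [(C x).src_symm (hmem w), hz]
    have : PreconnectedSpace (Metric.ball (0 : ℂ) (C x).radius) :=
      isPreconnected_iff_preconnectedSpace.1 (convex_ball _ _).isPreconnected
    have hd : Continuous fun w : Metric.ball (0 : ℂ) (C x).radius =>
        L ((C x).chart.symm (((C x).chart g).1, (w : ℂ))) - 𝒢.src g ^ (k - 1) * w := by
      refine ((hLc (𝒢.src g)).comp (Continuous.subtype_mk ?_ hs)).sub (by fun_prop)
      exact (C x).chart.continuousOn_symm.comp_continuous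
        (f := fun w : Metric.ball (0 : ℂ) (C x).radius => (((C x).chart g).1, (w : ℂ)))
        (by fun_prop) hmem
    have h3 := eq_zero_of_exp_eq_one hd (fun w => ?_)
      (x₀ := ⟨0, Metric.mem_ball_self (C x).radius_pos⟩) ?_ ⟨_, h2.2⟩
    · rw [sub_eq_zero] at h3
      rw [← h3]
      exact congrArg L ((C x).chart.left_inv hg).symm
    · rw [Complex.exp_sub, hLexp, hmchart x _ ((C x).chart.map_target (hmem w)), hs,
        (C x).chart.right_inv (hmem w)]
      exact div_self (Complex.exp_ne_zero _)
    · simp only [mul_zero, sub_zero]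
      rw [(C x).symm_zero _ h2.1, hLone]
  -- In `L(ah) = L(a) + L(h)` the first term is a multiple of `s(a)^(k-1) = (s(h) m(h))^(k-1)`,
  -- hence of `s(h)^(k-1)`.
  have hdiv : ∀ g, 𝒢.DivisibleAt (k - 1) L g := by
    refine eq_univ_of_mul_mem hconn (A := {g | 𝒢.DivisibleAt (k - 1) L g})
      (isOpen_divisibleAt (k - 1) L) (fun x => ?_) (fun x => ?_)
    · refine ⟨_, (C x).contMDiffAt_snd (C x).one_mem, ?_⟩
      filter_upwards [(C x).source_mem_nhds] with g hg using hLchart x g hg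
    · refine ⟨_, (C x).source_mem_nhds, ?_⟩
      rintro a ha h ⟨u, hu, hut⟩ hah
      obtain ⟨σ, η, hσ, hη, hσ0, hη0, hση⟩ := exists_factorization hah
      refine ⟨fun g => m (η g) ^ (k - 1) * ((C x).chart (σ g)).2 + u (η g), ?_, ?_⟩
      · exact ((((hm _).comp _ hη).pow (k - 1)).mul
          (ContMDiffAt.comp (g := fun g => ((C x).chart g).2) _
            (by rw [hσ0]; exact (C x).contMDiffAt_snd ha) hσ)).add
          (ContMDiffAt.comp (g := u) _ (by rwa [hη0]) hη)
      · filter_upwards [hση,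
          hσ.continuousAt.eventually (by rw [hσ0]; exact (C x).chart.open_source.mem_nhds ha),
          hη.continuousAt.eventually (by rw [hη0]; exact hut)] with h' h1 h2 h3
        have h4 : L h' = L (σ h') + L (η h') := by
          conv_lhs => rw [← h1.2, hLmul _ _ h1.1]
        have h5 : 𝒢.src h' = 𝒢.src (η h') := by
          conv_lhs => rw [← h1.2, 𝒢.src_mul _ _ h1.1]
        rw [h4, hLchart x _ h2, h3, h1.1, htm, h5]
        ring
  obtain ⟨u, hu, hLu⟩ := exists_eq_src_pow_mul hdiv
  have hmu : ∀ g, m g = Complex.exp (u g * 𝒢.src g ^ (k - 1)) := fun g => by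
    rw [← hLexp, hLu, mul_comm]
  refine ⟨u, hu, fun g => ?_, fun x g hg => ?_, fun g h hgh => ?_⟩
  · rw [htm, hmu, mul_comm]
  · refine eq_of_eventually_src_ne_zero (𝒢 := 𝒢) hu.continuous.continuousAt
      ((C x).contMDiffAt_snd hg).continuousAt ?_
    filter_upwards [(C x).chart.open_source.mem_nhds hg] with g' hg' h0
    exact mul_left_cancel₀ (pow_ne_zero (k - 1) h0) ((hLu g').symm.trans (hLchart x g' hg'))
  -- Additivity of `L` reads `s(h)^(k-1) u(gh) = s(g)^(k-1) u(g) + s(h)^(k-1) u(h)`. With `s(g) =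
  -- s(h) m(h)` and `m(h)^(k-1) = exp((k-1) u(h) s(h)^(k-1))`, cancelling `s(h)^(k-1)` gives the
  -- cocycle identity.
  · obtain ⟨α, β, hα, hβ, hα0, hβ0, hαβ⟩ := exists_composable_curve hgh
    have hcu := hu.continuous
    have hcs := 𝒢.continuous_src
    have h1 := eq_of_eventuallyEq_punctured (z₀ := 𝒢.src h)
      (f := fun z => u (𝒢.mul (α z) (β z)))
      (g := fun z => u (α z) * Complex.exp (((k : ℂ) - 1) * u (β z) * 𝒢.src (β z) ^ (k - 1))
        + u (β z))
      (hcu.continuousAt.comp (continuousAt_mul hα hβ (hαβ.mono fun _ h => h.1)))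
      (((hcu.continuousAt.comp hα).mul (Complex.continuous_exp.continuousAt.comp
        ((continuousAt_const.mul (hcu.continuousAt.comp hβ)).mul
          ((hcs.continuousAt.comp hβ).pow (k - 1))))).add (hcu.continuousAt.comp hβ)) (by
        filter_upwards [nhdsWithin_le_nhds hαβ, eventually_punctured_ne_zero (𝒢.src h)] with z h1 h2
        refine mul_left_cancel₀ (pow_ne_zero (k - 1) h2) ?_
        have h3 := hLmul _ _ h1.1
        rw [hLu, hLu, hLu, 𝒢.src_mul _ _ h1.1, h1.1, htm, h1.2, mul_pow, hmu,
          ← Complex.exp_nat_mul, Nat.cast_sub hk, h1.2] at h3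
        rw [h3, h1.2, Nat.cast_one, mul_add, _root_.mul_assoc ((k : ℂ) - 1)]
        ring)
    simpa only [hα0, hβ0] using h1

end HolLieGroupoid
end


/-! ### The global coordinate as a covering of each source fibre, and the biholomorphism with `ℂ ×
ℂ`. -/

noncomputable section

namespace HolLieGroupoid

variable {E : Type*} [NormedAddCommGroup E] [NormedSpace ℂ E] [FiniteDimensional ℂ E]
  {G : Type*} [TopologicalSpace G] [T2Space G] [ChartedSpace E G] [IsManifold 𝓘(ℂ, E) ω G]
  {𝒢 : HolLieGroupoid E ℂ G ℂ} {k : ℕ}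

/-- A holomorphic function `u` on the arrows with `t = exp (u s ^ (k - 1)) s` that satisfies the
cocycle identity of the Stokes groupoid and extends the coordinates near the identity arrows. -/
structure GlobalCoordinate (𝒢 : HolLieGroupoid E ℂ G ℂ) (k : ℕ) where
  logChart : ∀ x, LogChart 𝒢 k x
  u : G → ℂ
  contMDiff : ContMDiff 𝓘(ℂ, E) 𝓘(ℂ, ℂ) ω u
  tgt_eq : ∀ g, 𝒢.tgt g = Complex.exp (u g * 𝒢.src g ^ (k - 1)) * 𝒢.src g
  eq_chart : ∀ x, ∀ g ∈ (logChart x).chart.source, u g = ((logChart x).chart g).2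
  map_mul : ∀ g h, 𝒢.src g = 𝒢.tgt h →
    u (𝒢.mul g h) = u g * Complex.exp (((k : ℂ) - 1) * u h * 𝒢.src h ^ (k - 1)) + u h

theorem IsStokesGroupoid.nonempty_globalCoordinate (hk : 1 ≤ k) (h : 𝒢.IsStokesGroupoid k) :
    Nonempty (GlobalCoordinate 𝒢 k) := by
  obtain ⟨hsc, ⟨Φ⟩⟩ := h
  have C : ∀ x, LogChart 𝒢 k x := fun x => (Φ.nonempty_logChart hk x).some
  obtain ⟨u, h1, h2, h3, h4⟩ := exists_global_coordinate hk C hsc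
  exact ⟨⟨C, u, h1, h2, h3, h4⟩⟩

namespace GlobalCoordinate

variable (c : GlobalCoordinate 𝒢 k)

theorem map_one (x : ℂ) : c.u (𝒢.one x) = 0 := by
  rw [c.eq_chart x _ (c.logChart x).one_mem, (c.logChart x).chart_one]

theorem map_symm {x : ℂ} {p : ℂ × ℂ} (hp : p ∈ (c.logChart x).chart.target) :
    c.u ((c.logChart x).chart.symm p) = p.2 := by
  rw [c.eq_chart x _ ((c.logChart x).chart.map_target hp), (c.logChart x).chart.right_inv hp]

theorem pow_exp_mul (hk : 1 ≤ k) (v z : ℂ) : (Complex.exp (v * z ^ (k - 1)) * z) ^ (k - 1) =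
    Complex.exp (((k : ℂ) - 1) * v * z ^ (k - 1)) * z ^ (k - 1) := by
  rw [mul_pow, ← Complex.exp_nat_mul, Nat.cast_sub hk, Nat.cast_one,
    _root_.mul_assoc ((k : ℂ) - 1)]

/-- An arrow `a` whose coordinates are those of the quotient of `h` by an arrow with coordinates
`(src h, v)` has the same target as `h`. -/
theorem tgt_eq_of_quotient (hk : 1 ≤ k) {a h : G} {v : ℂ}
    (ha : 𝒢.src a = Complex.exp (v * 𝒢.src h ^ (k - 1)) * 𝒢.src h)
    (hu : c.u a * Complex.exp (((k : ℂ) - 1) * v * 𝒢.src h ^ (k - 1)) + v = c.u h) :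
    𝒢.tgt a = 𝒢.tgt h := by
  rw [c.tgt_eq a, ha, pow_exp_mul hk, c.tgt_eq h, ← hu, ← _root_.mul_assoc, ← Complex.exp_add]
  ring_nf

/-- The cocycle identity for `a⁻¹ a` determines `u(a⁻¹)`, and the exponential multiplier of `h` is
the product of those of `a` and of an arrow with coordinates `(src h, v)`. -/
theorem map_inv_mul_of_quotient (hk : 1 ≤ k) {a h : G} {v : ℂ}
    (ha : 𝒢.src a = Complex.exp (v * 𝒢.src h ^ (k - 1)) * 𝒢.src h)
    (hu : c.u a * Complex.exp (((k : ℂ) - 1) * v * 𝒢.src h ^ (k - 1)) + v = c.u h) :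
    c.u (𝒢.mul (𝒢.inv a) h) = v := by
  have h1 := c.map_mul (𝒢.inv a) a (𝒢.src_inv a)
  rw [𝒢.inv_mul, c.map_one, ha, pow_exp_mul hk] at h1
  have h2 : Complex.exp (((k : ℂ) - 1) * c.u h * 𝒢.src h ^ (k - 1)) =
      Complex.exp (((k : ℂ) - 1) * c.u a *
        (Complex.exp (((k : ℂ) - 1) * v * 𝒢.src h ^ (k - 1)) * 𝒢.src h ^ (k - 1))) *
      Complex.exp (((k : ℂ) - 1) * v * 𝒢.src h ^ (k - 1)) := by
    rw [← Complex.exp_add, ← hu]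
    ring_nf
  rw [c.map_mul _ _ ((𝒢.src_inv a).trans (c.tgt_eq_of_quotient hk ha hu)), h2, ← hu]
  linear_combination -Complex.exp (((k : ℂ) - 1) * v * 𝒢.src h ^ (k - 1)) * h1

/-- If `h` is near `g` with the same source and the same `u`, the cocycle identity for `(h g⁻¹) g`
gives `u(h g⁻¹) = 0`. Near an identity `u` is a coordinate on the source fibre, so `h = g`. -/
theorem discreteTopology_preimage (z v : ℂ) :
    DiscreteTopology ((fun g : 𝒢.src ⁻¹' {z} => c.u g) ⁻¹' {v}) := by
  rw [discreteTopology_iff_singleton_mem_nhds]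
  rintro ⟨⟨g, rfl⟩, rfl⟩
  have h1 := (c.logChart (𝒢.tgt g)).eventually_plaque (g := g) rfl one_pos
  filter_upwards [continuous_subtype_val.continuousAt.eventually h1] with h hh
  obtain ⟨h2, w, -, h3, h4⟩ := hh
  have hs : 𝒢.src h.1 = 𝒢.src g := h.1.2
  have hu : c.u h.1 = c.u g := h.2
  have h5 := c.map_mul (𝒢.mul h.1 (𝒢.inv g)) g (by
    rw [𝒢.src_mul _ _ (by rw [𝒢.tgt_inv, hs]), 𝒢.src_inv])
  rw [mul_inv_mul hs, hu, right_eq_add, mul_eq_zero, or_iff_left (Complex.exp_ne_zero _),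
    c.eq_chart _ _ h2, ← h3] at h5
  have h6 : w = ⟨0, Metric.mem_ball_self (c.logChart (𝒢.tgt g)).radius_pos⟩ := Subtype.ext h5
  rw [h6, LogChart.plaque_zero] at h4
  exact Subtype.ext h4.symm

/-- The coordinate is a covering map on each source fibre. -/
theorem isCoveringMap (hk : 1 ≤ k) (z : ℂ) :
    IsCoveringMap (fun g : 𝒢.src ⁻¹' {z} => c.u g) := by
  intro v
  refine ⟨c.discreteTopology_preimage z v, ?_⟩
  have hcu : Continuous fun g : 𝒢.src ⁻¹' {z} => c.u g :=
    c.contMDiff.continuous.comp continuous_subtype_val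
  -- All arrows from `z` with coordinate `v` have the same target `x`, so the chart at the identity
  -- over `x` translates to all of them and gives sheets of uniform size.
  let x := Complex.exp (v * z ^ (k - 1)) * z
  let M := Complex.exp (((k : ℂ) - 1) * v * z ^ (k - 1))
  have hM : M ≠ 0 := Complex.exp_ne_zero _
  let χ := c.logChart x
  let U : Set ℂ := (fun w => (w - v) / M) ⁻¹' Metric.ball 0 χ.radius
  have hU : IsOpen U := Metric.isOpen_ball.preimage (by fun_prop)
  have hvU : v ∈ U := by
    simp only [U, Set.mem_preimage, sub_self, zero_div]
    exact Metric.mem_ball_self χ.radius_pos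
  -- By the cocycle identity, left multiplication by `a w` takes coordinate `v` to `((w - v)/M) M +
  -- v = w`.
  let a : U → G := fun w => χ.chart.symm (x, (w - v) / M)
  have hat : ∀ w : U, (x, ((w : ℂ) - v) / M) ∈ χ.chart.target := fun w => χ.mem_target w.2
  have hac : Continuous a :=
    χ.chart.continuousOn_symm.comp_continuous (f := fun w : U => (x, ((w : ℂ) - v) / M))
      (by fun_prop) hat
  have has : ∀ w, 𝒢.src (a w) = x := fun w => χ.src_symm (hat w)
  have hau : ∀ w, c.u (a w) * M + v = w := fun w => by
    rw [c.map_symm (hat w), div_mul_cancel₀ _ hM, sub_add_cancel]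
  have hfs : ∀ h : 𝒢.src ⁻¹' {z}, 𝒢.src h = z := fun h => h.2
  have hgt : ∀ g : (fun g : 𝒢.src ⁻¹' {z} => c.u g) ⁻¹' {v}, 𝒢.tgt g.1 = x := fun g => by
    rw [c.tgt_eq, hfs, show c.u g.1 = v from g.2]
  have hag : ∀ w (g : (fun g : 𝒢.src ⁻¹' {z} => c.u g) ⁻¹' {v}), 𝒢.src (a w) = 𝒢.tgt g.1 :=
    fun w g => (has w).trans (hgt g).symm
  have hmulu : ∀ w (g : (fun g : 𝒢.src ⁻¹' {z} => c.u g) ⁻¹' {v}),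
      c.u (𝒢.mul (a w) g.1) = w := fun w g => by
    rw [c.map_mul _ _ (hag w g), hfs, show c.u g.1 = v from g.2, hau]
  have hat' : ∀ (w : U) (h : 𝒢.src ⁻¹' {z}), c.u h = w → 𝒢.tgt (a w) = 𝒢.tgt h := fun w h hw =>
    c.tgt_eq_of_quotient hk (v := v) (by rw [has, hfs]) (by rw [hfs, hw]; exact hau w)
  have hinv : ∀ (w : U) (h : 𝒢.src ⁻¹' {z}), c.u h = w → c.u (𝒢.mul (𝒢.inv (a w)) h) = v :=
    fun w h hw =>
      c.map_inv_mul_of_quotient hk (v := v) (by rw [has, hfs]) (by rw [hfs, hw]; exact hau w)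
  -- The trivialization is `h ↦ (u h, a(u h)⁻¹ h)`, with inverse `(w, g) ↦ a(w) g`.
  refine ⟨U, hvU, hU, hU.preimage hcu, ⟨⟨fun h => (⟨c.u h.1, h.2⟩,
    ⟨⟨𝒢.mul (𝒢.inv (a ⟨c.u h.1, h.2⟩)) h.1, ?_⟩, hinv ⟨_, h.2⟩ h.1 rfl⟩),
    fun p => ⟨⟨𝒢.mul (a p.1) p.2.1, ?_⟩, ?_⟩, ?_, ?_⟩, ?_, ?_⟩, fun h => rfl⟩
  · exact (𝒢.src_mul _ _ ((𝒢.src_inv _).trans (hat' ⟨_, h.2⟩ h.1 rfl))).trans h.1.2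
  · exact (𝒢.src_mul _ _ (hag _ _)).trans p.2.1.2
  · change c.u (𝒢.mul (a p.1) p.2.1) ∈ U
    rw [hmulu]
    exact p.1.2
  · intro h
    exact Subtype.ext (Subtype.ext (mul_inv_mul_left (hat' ⟨_, h.2⟩ h.1 rfl).symm))
  · rintro ⟨w, g⟩
    have h1 : ∀ w' : U, w' = w → 𝒢.mul (𝒢.inv (a w')) (𝒢.mul (a w) g.1) = g.1 := by
      rintro _ rfl
      exact inv_mul_mul (hag _ _)
    exact Prod.ext (Subtype.ext (hmulu w g))
      (Subtype.ext (Subtype.ext (h1 _ (Subtype.ext (hmulu w g)))))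
  · have h1 : Continuous fun h : (fun g : 𝒢.src ⁻¹' {z} => c.u g) ⁻¹' U =>
        (⟨c.u h.1, h.2⟩ : U) := (hcu.comp continuous_subtype_val).subtype_mk _
    exact h1.prodMk ((Continuous.subtype_mk (continuous_mul
      (𝒢.continuous_inv.comp (hac.comp h1)) (continuous_subtype_val.comp continuous_subtype_val)
      fun h => (𝒢.src_inv _).trans (hat' ⟨_, h.2⟩ h.1 rfl)) _).subtype_mk _)
  · exact (Continuous.subtype_mk (continuous_mul (hac.comp continuous_fst)
      (continuous_subtype_val.comp (continuous_subtype_val.comp continuous_snd))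
      fun p => hag _ _) _).subtype_mk _

/-- As `ℂ` is simply connected, the covering has a section through the identity. Its composite with
`u` and the identity map are lifts of `u` that agree at one point of a connected fibre. -/
theorem bijective_fibre (hk : 1 ≤ k) (z : ℂ) [PreconnectedSpace (𝒢.src ⁻¹' {z})] :
    Function.Bijective (fun g : 𝒢.src ⁻¹' {z} => c.u g) := by
  have hcov := c.isCoveringMap hk z
  have hcu : Continuous fun g : 𝒢.src ⁻¹' {z} => c.u g :=
    c.contMDiff.continuous.comp continuous_subtype_val
  obtain ⟨Φ, ⟨h0, h1⟩, -⟩ := hcov.existsUnique_continuousMap_lifts (ContinuousMap.id ℂ) 0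
    ⟨𝒢.one z, 𝒢.src_one z⟩ (c.map_one z)
  have h2 : ∀ w, c.u (Φ w) = w := fun w => congrFun h1 w
  have h3 : (fun g : 𝒢.src ⁻¹' {z} => Φ (c.u g)) = id :=
    hcov.eq_of_comp_eq (Φ.continuous.comp hcu) continuous_id (funext fun g => h2 _)
      ⟨𝒢.one z, 𝒢.src_one z⟩ (by simp only [c.map_one, h0, id])
  exact ⟨Function.LeftInverse.injective (congrFun h3), fun w => ⟨Φ w, h2 w⟩⟩

theorem bijective (hk : 1 ≤ k) (hsc : 𝒢.SourceSimplyConnected) :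
    Function.Bijective (fun g => (𝒢.src g, c.u g)) := by
  refine ⟨fun g h hgh => ?_, fun p => ?_⟩
  · have := hsc (𝒢.src h)
    exact congrArg Subtype.val (@(c.bijective_fibre hk (𝒢.src h)).1
      ⟨g, congrArg Prod.fst hgh⟩ ⟨h, rfl⟩ (congrArg Prod.snd hgh))
  · have := hsc p.1
    obtain ⟨g, hg⟩ := (c.bijective_fibre hk p.1).2 p.2
    exact ⟨g, Prod.ext g.2 hg⟩

/-- The source map and the coordinate identify the manifold of arrows with `ℂ × ℂ`. -/
def diffeomorph (hk : 1 ≤ k) (hsc : 𝒢.SourceSimplyConnected) :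
    Diffeomorph 𝓘(ℂ, E) 𝓘(ℂ, ℂ × ℂ) G (ℂ × ℂ) ω where
  toEquiv := Equiv.ofBijective _ (c.bijective hk hsc)
  contMDiff_toFun := 𝒢.holomorphic_src.prodMk_space c.contMDiff
  contMDiff_invFun := by
    intro p₀
    obtain ⟨g₀, rfl⟩ := (c.bijective hk hsc).2 p₀
    obtain ⟨ς, hς, hς0, hςs⟩ := 𝒢.exists_src_section g₀
    let χ := c.logChart (𝒢.tgt g₀)
    let γ : ℂ × ℂ → G := fun p => ς p.1
    have hγ : ContMDiffAt 𝓘(ℂ, ℂ × ℂ) 𝓘(ℂ, E) ω γ (𝒢.src g₀, c.u g₀) :=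
      ContMDiffAt.comp (g := ς) (f := Prod.fst) (𝒢.src g₀, c.u g₀) hς
        (contMDiffAt_iff_contDiffAt.2 contDiffAt_fst)
    have hγ0 : γ (𝒢.src g₀, c.u g₀) = g₀ := hς0
    -- The arrow with coordinates `p` is sought as a small arrow times `γ p`; `q p` solves the
    -- cocycle identity for the chart coordinates of the small arrow.
    let q : ℂ × ℂ → ℂ × ℂ := fun p => (𝒢.tgt (γ p),
      (p.2 - c.u (γ p)) * Complex.exp (-(((k : ℂ) - 1) * c.u (γ p) * p.1 ^ (k - 1))))
    have hq : ContMDiffAt 𝓘(ℂ, ℂ × ℂ) 𝓘(ℂ, ℂ × ℂ) ω q (𝒢.src g₀, c.u g₀) := by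
      have h1 : ContDiffAt ℂ ω (fun p => c.u (γ p)) (𝒢.src g₀, c.u g₀) :=
        contMDiffAt_iff_contDiffAt.1 ((c.contMDiff _).comp _ hγ)
      refine ContMDiffAt.prodMk_space ((𝒢.holomorphic_tgt _).comp _ hγ) ?_
      refine contMDiffAt_iff_contDiffAt.2 ((contDiffAt_snd.sub h1).mul (ContDiffAt.cexp ?_))
      exact ((contDiffAt_const.mul h1).mul (contDiffAt_fst.pow _)).neg
    have hq0 : q (𝒢.src g₀, c.u g₀) = (𝒢.tgt g₀, 0) := by
      simp only [q, hγ0, sub_self, zero_mul]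
    have hqt : (𝒢.tgt g₀, (0 : ℂ)) ∈ χ.chart.target :=
      χ.mem_target (Metric.mem_ball_self χ.radius_pos)
    have hevt : ∀ᶠ p in 𝓝 (𝒢.src g₀, c.u g₀), q p ∈ χ.chart.target :=
      hq.continuousAt.eventually (by rw [hq0]; exact χ.chart.open_target.mem_nhds hqt)
    have hα : ContMDiffAt 𝓘(ℂ, ℂ × ℂ) 𝓘(ℂ, E) ω (fun p => χ.chart.symm (q p))
        (𝒢.src g₀, c.u g₀) :=
      ContMDiffAt.comp (g := χ.chart.symm) (f := q) _
        (by
          rw [hq0]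
          exact χ.contMDiffOn_symm.contMDiffAt (χ.chart.open_target.mem_nhds hqt)) hq
    have hcomp : ∀ᶠ p in 𝓝 (𝒢.src g₀, c.u g₀), 𝒢.src (χ.chart.symm (q p)) = 𝒢.tgt (γ p) :=
      hevt.mono fun p hp => χ.src_symm hp
    refine (contMDiffAt_mul hα hγ hcomp).congr_of_eventuallyEq ?_
    have hςs' : ∀ᶠ p in 𝓝 (𝒢.src g₀, c.u g₀), 𝒢.src (γ p) = p.1 :=
      (continuous_fst.tendsto (𝒢.src g₀, c.u g₀)).eventually hςs
    filter_upwards [hevt, hcomp, hςs'] with p h1 h2 h3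
    refine (Equiv.symm_apply_eq _).2 (Prod.ext ?_ ?_)
    · exact h3.symm.trans (𝒢.src_mul _ _ h2).symm
    · refine Eq.symm ((c.map_mul _ _ h2).trans ?_)
      rw [c.map_symm h1, h3, _root_.mul_assoc, ← Complex.exp_add, neg_add_cancel, Complex.exp_zero,
        _root_.mul_one, sub_add_cancel]

end GlobalCoordinate
end HolLieGroupoid
end


/-! ### The groupoid given by the explicit formulas. -/

noncomputable section

namespace Stokes

variable (k : ℕ)

/-- The factor by which right translation by the arrow `p` multiplies the second coordinate. -/
def factor (p : ℂ × ℂ) : ℂ := Complex.exp (((k : ℂ) - 1) * p.2 * p.1 ^ (k - 1))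

def tgt (p : ℂ × ℂ) : ℂ := Complex.exp (p.2 * p.1 ^ (k - 1)) * p.1

def mul (p q : ℂ × ℂ) : ℂ × ℂ := (q.1, p.2 * factor k q + q.2)

/-- The second coordinate is the solution `u'` of `u' * factor k p + p.2 = 0`. -/
def inv (p : ℂ × ℂ) : ℂ × ℂ := (tgt k p, -(p.2 * (factor k p)⁻¹))

theorem factor_ne_zero (p : ℂ × ℂ) : factor k p ≠ 0 := Complex.exp_ne_zero _

theorem contDiff_factor : ContDiff ℂ ω (factor k) := by
  unfold factor
  fun_prop

theorem contDiff_tgt : ContDiff ℂ ω (tgt k) := by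
  unfold tgt
  fun_prop

theorem contDiff_inv : ContDiff ℂ ω (inv k) :=
  (contDiff_tgt k).prodMk (contDiff_snd.mul ((contDiff_factor k).inv (factor_ne_zero k))).neg

theorem contDiff_mul : ContDiff ℂ ω fun p : (ℂ × ℂ) × (ℂ × ℂ) => mul k p.1 p.2 :=
  (contDiff_fst.comp contDiff_snd).prodMk (((contDiff_snd.comp contDiff_fst).mul
    ((contDiff_factor k).comp contDiff_snd)).add (contDiff_snd.comp contDiff_snd))

variable {k}

theorem tgt_pow (hk : 1 ≤ k) (p : ℂ × ℂ) : tgt k p ^ (k - 1) = factor k p * p.1 ^ (k - 1) :=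
  HolLieGroupoid.GlobalCoordinate.pow_exp_mul hk p.2 p.1

theorem tgt_mul (hk : 1 ≤ k) {p q : ℂ × ℂ} (h : p.1 = tgt k q) : tgt k (mul k p q) = tgt k p := by
  rw [tgt, mul, tgt, h, tgt_pow hk, tgt, ← mul_assoc, ← Complex.exp_add]
  ring_nf

/-- This multiplicativity is what makes the product associative. It holds because `tgt k q ^ (k -
1)` already contains `factor k q`. -/
theorem factor_mul (hk : 1 ≤ k) {p q : ℂ × ℂ} (h : p.1 = tgt k q) :
    factor k (mul k p q) = factor k p * factor k q := by
  have h1 : factor k p = Complex.exp (((k : ℂ) - 1) * p.2 * (factor k q * q.1 ^ (k - 1))) := by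
    rw [factor, h, tgt_pow hk]
  conv_rhs => rw [h1]
  conv_rhs => rw [factor.eq_1 k q, ← Complex.exp_add, ← factor.eq_1 k q]
  rw [factor, mul]
  congr 1
  ring

theorem mul_inv_self (p : ℂ × ℂ) : mul k (inv k p) p = (p.1, 0) := by
  refine Prod.ext rfl ?_
  simp [mul, inv, factor_ne_zero]

theorem tgt_inv (hk : 1 ≤ k) (p : ℂ × ℂ) : tgt k (inv k p) = p.1 := by
  rw [← tgt_mul hk (rfl : (inv k p).1 = tgt k p), mul_inv_self]
  simp [tgt]

theorem inv_inv (hk : 1 ≤ k) (p : ℂ × ℂ) : inv k (inv k p) = p := by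
  have h1 := factor_mul hk (rfl : (inv k p).1 = tgt k p)
  rw [mul_inv_self] at h1
  have h2 : factor k (inv k p) = (factor k p)⁻¹ :=
    eq_inv_of_mul_eq_one_left (h1.symm.trans (by simp [factor]))
  refine Prod.ext (tgt_inv hk p) ?_
  change -((inv k p).2 * (factor k (inv k p))⁻¹) = p.2
  rw [h2]
  simp [inv, factor_ne_zero]

theorem surjective_mfderiv_fst (p : ℂ × ℂ) :
    Function.Surjective (mfderiv 𝓘(ℂ, ℂ × ℂ) 𝓘(ℂ, ℂ) Prod.fst p) := by
  rw [mfderiv_eq_fderiv, fderiv_fst]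
  exact fun z => ⟨(z, 0), rfl⟩

/-- Inversion exchanges source and target, so differentiating `tgt ∘ inv = fst` at `inv p` gives a
right inverse. -/
theorem surjective_mfderiv_tgt (hk : 1 ≤ k) (p : ℂ × ℂ) :
    Function.Surjective (mfderiv 𝓘(ℂ, ℂ × ℂ) 𝓘(ℂ, ℂ) (tgt k) p) := by
  rw [mfderiv_eq_fderiv]
  have hd := (contDiff_tgt k).differentiable (by simp)
  have hi := (contDiff_inv k).differentiable (by simp)
  have h1 : HasFDerivAt (fun q => tgt k (inv k q)) ((fderiv ℂ (tgt k) p).comp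
      (fderiv ℂ (inv k) (inv k p))) (inv k p) :=
    HasFDerivAt.comp (g := tgt k) (inv k p) (by rw [inv_inv hk]; exact (hd p).hasFDerivAt)
      (hi _).hasFDerivAt
  have h2 := h1.unique (by
    simp only [tgt_inv hk]
    exact hasFDerivAt_fst)
  exact fun z => ⟨fderiv ℂ (inv k) (inv k p) (z, 0), DFunLike.congr_fun h2 (z, 0)⟩

/-- The Stokes groupoid in its global coordinates. -/
def groupoid (hk : 1 ≤ k) : HolLieGroupoid (ℂ × ℂ) ℂ (ℂ × ℂ) ℂ where
  src := Prod.fst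
  tgt := tgt k
  one z := (z, 0)
  mul := mul k
  inv := inv k
  src_one _ := rfl
  tgt_one z := by simp [tgt]
  src_mul _ _ _ := rfl
  tgt_mul _ _ h := tgt_mul hk h
  mul_assoc p q r _ h2 := by
    refine Prod.ext rfl ?_
    simp only [mul]
    rw [show (r.1, q.2 * factor k r + r.2) = mul k q r from rfl, factor_mul hk h2]
    ring
  one_mul p := by simp [mul]
  mul_one p := by simp [mul, factor]
  src_inv _ := rfl
  tgt_inv p := tgt_inv hk p
  inv_mul p := mul_inv_self p
  mul_inv p := by
    have h := mul_inv_self (k := k) (inv k p)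
    rwa [inv_inv hk] at h
  holomorphic_src := contDiff_fst.contMDiff
  submersion_src := surjective_mfderiv_fst
  holomorphic_tgt := (contDiff_tgt k).contMDiff
  submersion_tgt := surjective_mfderiv_tgt hk
  holomorphic_one := (contDiff_id.prodMk contDiff_const).contMDiff
  closedEmbedding_one := Function.LeftInverse.isClosedEmbedding (f := Prod.fst) (fun _ => rfl)
    continuous_fst (by fun_prop)
  holomorphic_mul := ((contDiff_mul k).contMDiff.comp
    (contMDiff_fst.prodMk_space contMDiff_snd)).contMDiffOn
  holomorphic_inv := (contDiff_inv k).contMDiff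

theorem sourceSimplyConnected (hk : 1 ≤ k) : (groupoid hk).SourceSimplyConnected := by
  intro z
  let e : (groupoid hk).src ⁻¹' {z} ≃ₜ ℂ :=
    { toFun := fun p => p.1.2
      invFun := fun u => ⟨(z, u), rfl⟩
      left_inv := fun p => Subtype.ext (Prod.ext p.2.symm rfl)
      right_inv := fun u => rfl
      continuous_toFun := by fun_prop
      continuous_invFun := by fun_prop }
  have : ContractibleSpace ((groupoid hk).src ⁻¹' {z}) := e.contractibleSpace
  infer_instance

end Stokes
end


/-! ### The Lie algebroid of the explicit groupoid. -/

noncomputable section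

namespace Stokes

open HolLieGroupoid (castTangent_eq holAlong_iff rightInvariant)

variable {k : ℕ} (hk : 1 ≤ k)

theorem holAlong_groupoid_iff {U : Opens ℂ}
    {v : (x : U) → TangentSpace 𝓘(ℂ, ℂ × ℂ) ((groupoid hk).one x)} :
    (groupoid hk).HolAlong U v ↔
      ContMDiff 𝓘(ℂ, ℂ) 𝓘(ℂ, ℂ × ℂ) ω (fun x : U => (v x : ℂ × ℂ)) := by
  rw [holAlong_iff]
  refine forall_congr' fun x => ?_
  simp only [trivializationAt_model_space_apply]

theorem mfderiv_src (x : ℂ) (v : TangentSpace 𝓘(ℂ, ℂ × ℂ) ((groupoid hk).one x)) :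
    mfderiv 𝓘(ℂ, ℂ × ℂ) 𝓘(ℂ, ℂ) (groupoid hk).src ((groupoid hk).one x) v =
      (v : ℂ × ℂ).1 := by
  have h : mfderiv 𝓘(ℂ, ℂ × ℂ) 𝓘(ℂ, ℂ) (groupoid hk).src ((groupoid hk).one x) =
      ContinuousLinearMap.fst ℂ ℂ ℂ := by
    rw [mfderiv_eq_fderiv]
    exact fderiv_fst
  exact DFunLike.congr_fun h v

/-- Right translation is differentiated only within a source fibre, where the derivative is not
unique as a map on `ℂ × ℂ`. Its value on vertical vectors is still determined, by the curve `w ↦ (z,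
w)`. -/
theorem hasDerivAt_curve {F : Type*} [NormedAddCommGroup F] [NormedSpace ℂ F] {f : ℂ × ℂ → F}
    {f' : ℂ × ℂ →L[ℂ] F} {s : Set (ℂ × ℂ)} {z u : ℂ} (hf : HasFDerivWithinAt f f' s (z, u))
    (hs : ∀ w, (z, w) ∈ s) : HasDerivAt (fun w => f (z, w)) (f' (0, 1)) u :=
  HasFDerivWithinAt.comp_hasDerivAt (l := f) (f := fun w => (z, w)) u hf
    ((hasDerivAt_const u z).prodMk (hasDerivAt_id u)) (Filter.Eventually.of_forall hs)

theorem apply_zero_mk {F : Type*} [NormedAddCommGroup F] [NormedSpace ℂ F] (f' : ℂ × ℂ →L[ℂ] F)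
    (c : ℂ) : f' (0, c) = c • f' (0, 1) := by
  rw [← map_smul]
  simp

theorem hasDerivAt_tgt (hk : 1 ≤ k) (x : ℂ) : HasDerivAt (fun w => tgt k (x, w)) (x ^ k) 0 := by
  refine ((((hasDerivAt_id (0 : ℂ)).mul_const (x ^ (k - 1))).cexp).mul_const x).congr_deriv ?_
  simp only [id, zero_mul, Complex.exp_zero, one_mul]
  rw [← pow_succ, Nat.sub_add_cancel hk]

theorem anchor_eq (x : ℂ) (v : TangentSpace 𝓘(ℂ, ℂ × ℂ) ((groupoid hk).one x))
    (hv : (v : ℂ × ℂ).1 = 0) :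
    ((groupoid hk).anchor x v : ℂ) = x ^ k * (v : ℂ × ℂ).2 := by
  refine (castTangent_eq ((groupoid hk).tgt_one x) _).trans ?_
  obtain ⟨⟨v1, v2⟩, hv'⟩ : ∃ v' : ℂ × ℂ, v' = v := ⟨v, rfl⟩
  subst hv'
  obtain rfl : v1 = 0 := hv
  have h1 : HasFDerivAt (tgt k) (fderiv ℂ (tgt k) (x, 0)) (x, 0) :=
    ((contDiff_tgt k).differentiable (by simp) _).hasFDerivAt
  have h2 := hasDerivAt_curve h1.hasFDerivWithinAt (s := Set.univ) (fun _ => trivial)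
  have h4 : fderiv ℂ (tgt k) (x, 0) (0, v2) = x ^ k * v2 := by
    rw [apply_zero_mk, h2.unique (hasDerivAt_tgt hk x), smul_eq_mul, mul_comm]
  have h5 : mfderiv 𝓘(ℂ, ℂ × ℂ) 𝓘(ℂ, ℂ) (groupoid hk).tgt ((groupoid hk).one x) =
      fderiv ℂ (tgt k) (x, 0) := mfderiv_eq_fderiv
  exact (DFunLike.congr_fun h5 _).trans h4

/-- Right translation by `p` acts on second coordinates as `w ↦ w * factor k p + p.2`, so it scales
vertical vectors by `factor k p`. -/
theorem rightInvariant_eq (U : Opens ℂ)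
    (v : (x : U) → TangentSpace 𝓘(ℂ, ℂ × ℂ) ((groupoid hk).one x))
    (hv : ∀ x, (v x : ℂ × ℂ).1 = 0) (p : ℂ × ℂ) :
    ((groupoid hk).rightInvariant U v p : ℂ × ℂ) =
      (0, extendZero U (fun x => (v x : ℂ × ℂ).2) (tgt k p) * factor k p) := by
  by_cases h : tgt k p ∈ U
  · have h0 : (groupoid hk).tgt p ∈ U := h
    unfold rightInvariant extendZero
    rw [dif_pos h0, dif_pos h]
    refine (castTangent_eq ((groupoid hk).one_mul p) _).trans ?_
    obtain ⟨⟨v1, v2⟩, hv'⟩ : ∃ v' : ℂ × ℂ, v' = v ⟨tgt k p, h⟩ := ⟨v _, rfl⟩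
    have hv1 : v1 = 0 := (congrArg Prod.fst hv').trans (hv _)
    subst hv1
    have h1 : HasFDerivWithinAt (fun a => mul k a p)
        (fderivWithin ℂ (fun a => mul k a p) {a | a.1 = tgt k p} (tgt k p, 0))
        {a | a.1 = tgt k p} (tgt k p, 0) := by
      refine DifferentiableWithinAt.hasFDerivWithinAt ?_
      unfold mul
      fun_prop
    have h2 := hasDerivAt_curve h1 (fun _ => rfl)
    have h3 : HasDerivAt (fun w : ℂ => mul k (tgt k p, w) p) (0, factor k p) 0 := by
      have h4 := (hasDerivAt_const (0 : ℂ) p.1).prodMk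
        (((hasDerivAt_id (0 : ℂ)).mul_const (factor k p)).add_const p.2)
      simpa [mul] using h4
    have h4 : fderivWithin ℂ (fun a => mul k a p) {a | a.1 = tgt k p} (tgt k p, 0) (0, v2) =
        (0, v2 * factor k p) := by
      rw [apply_zero_mk, h2.unique h3]
      simp
    have h5 : mfderivWithin 𝓘(ℂ, ℂ × ℂ) 𝓘(ℂ, ℂ × ℂ) (fun a => (groupoid hk).mul a p)
        ((groupoid hk).src ⁻¹' {(groupoid hk).tgt p}) ((groupoid hk).one ((groupoid hk).tgt p)) =
        fderivWithin ℂ (fun a => mul k a p) {a | a.1 = tgt k p} (tgt k p, 0) :=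
      mfderivWithin_eq_fderivWithin
    refine (DFunLike.congr_fun h5 _).trans ?_
    refine (congrArg _ hv'.symm).trans (h4.trans ?_)
    exact congrArg (fun c => ((0 : ℂ), c * factor k p)) (congrArg Prod.snd hv')
  · have h0 : (groupoid hk).tgt p ∉ U := h
    unfold rightInvariant extendZero
    rw [dif_neg h0, dif_neg h, zero_mul]
    rfl

theorem analyticAt_extendZero {U : Opens ℂ} {f : U → ℂ} (hf : ContMDiff 𝓘(ℂ, ℂ) 𝓘(ℂ, ℂ) ω f)
    (x : U) : AnalyticAt ℂ (extendZero U f) x := by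
  refine (contMDiffAt_iff_contDiffAt.1 (contMDiffAt_subtype_iff.1 ?_)).analyticAt
  have h : (fun x : U => extendZero U f x) = f := by
    funext y
    simp [extendZero]
  rw [h]
  exact hf x

theorem hasDerivAt_rightInvariant {h : ℂ → ℂ} {x : ℂ} (hh : DifferentiableAt ℂ h x) (hk : 1 ≤ k) :
    HasDerivAt (fun u => h (tgt k (x, u)) * factor k (x, u))
      (x ^ k * deriv h x + ((k : ℂ) - 1) * x ^ (k - 1) * h x) 0 := by
  have ht0 : tgt k (x, 0) = x := by simp [tgt]
  have hf : HasDerivAt (fun w => factor k (x, w)) (((k : ℂ) - 1) * x ^ (k - 1)) 0 := by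
    refine ((((hasDerivAt_id (0 : ℂ)).const_mul ((k : ℂ) - 1)).mul_const
      (x ^ (k - 1))).cexp).congr_deriv ?_
    simp
  have h1 : HasDerivAt (fun w => h (tgt k (x, w))) (deriv h x * x ^ k) 0 :=
    HasDerivAt.comp (h₂ := h) (h := fun w => tgt k (x, w)) 0 (by rw [ht0]; exact hh.hasDerivAt) (hasDerivAt_tgt hk x)
  refine (h1.mul hf).congr_deriv ?_
  simp only [ht0, factor, mul_zero, zero_mul, Complex.exp_zero]
  ring

theorem mlieBracket_eq_lieBracket (V W : ℂ × ℂ → ℂ × ℂ) (p : ℂ × ℂ) :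
    VectorField.mlieBracket 𝓘(ℂ, ℂ × ℂ) (M := ℂ × ℂ) V W p = VectorField.lieBracket ℂ V W p := by
  have h := congrFun (VectorField.mlieBracketWithin_eq_lieBracketWithin (𝕜 := ℂ) (E := ℂ × ℂ)
    (V := V) (W := W) (s := Set.univ)) p
  exact (congrFun VectorField.mlieBracketWithin_univ p).symm.trans
    (h.trans (congrFun VectorField.lieBracketWithin_univ p))

/-- Right-invariant fields are vertical, so only derivatives in `u` enter. The terms in `(k - 1)
x^(k-1)`, which come from `factor`, are symmetric in the two sections and cancel. -/
theorem lieBracket_eq (U : Opens ℂ)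
    (v w : (x : U) → TangentSpace 𝓘(ℂ, ℂ × ℂ) ((groupoid hk).one x))
    (hv : ContMDiff 𝓘(ℂ, ℂ) 𝓘(ℂ, ℂ) ω fun x : U => (v x : ℂ × ℂ).2)
    (hw : ContMDiff 𝓘(ℂ, ℂ) 𝓘(ℂ, ℂ) ω fun x : U => (w x : ℂ × ℂ).2)
    (hv0 : ∀ x, (v x : ℂ × ℂ).1 = 0) (hw0 : ∀ x, (w x : ℂ × ℂ).1 = 0) (x : U) :
    ((groupoid hk).lieBracket U v w x : ℂ × ℂ) =
      (0, (x : ℂ) ^ k *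
        (extendZero U (fun x => (v x : ℂ × ℂ).2) x *
          deriv (extendZero U (fun x => (w x : ℂ × ℂ).2)) x -
        deriv (extendZero U (fun x => (v x : ℂ × ℂ).2)) x *
          extendZero U (fun x => (w x : ℂ × ℂ).2) x)) := by
  have key : ∀ h : ℂ → ℂ, AnalyticAt ℂ h x → ∀ c : ℂ,
      fderiv ℂ (fun p => ((0 : ℂ), h (tgt k p) * factor k p)) ((x : ℂ), 0) (0, c) =
        (0, c * ((x : ℂ) ^ k * deriv h x + ((k : ℂ) - 1) * (x : ℂ) ^ (k - 1) * h x)) := by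
    intro h hh c
    have ht0 : tgt k ((x : ℂ), 0) = x := by simp [tgt]
    have h1 : DifferentiableAt ℂ (fun p => ((0 : ℂ), h (tgt k p) * factor k p)) ((x : ℂ), 0) := by
      refine (differentiableAt_const _).prodMk (DifferentiableAt.mul ?_
        ((contDiff_factor k).differentiable (by simp) _))
      exact DifferentiableAt.comp (g := h) _ (by rw [ht0]; exact hh.differentiableAt)
        ((contDiff_tgt k).differentiable (by simp) _)
    have h2 := hasDerivAt_curve h1.hasFDerivAt.hasFDerivWithinAt (s := Set.univ) fun _ => trivial
    have h3 := (hasDerivAt_const (0 : ℂ) (0 : ℂ)).prodMk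
      (hasDerivAt_rightInvariant hh.differentiableAt hk)
    rw [apply_zero_mk, h2.unique h3]
    simp
  have hV := funext (rightInvariant_eq hk U v hv0)
  have hW := funext (rightInvariant_eq hk U w hw0)
  have ha := analyticAt_extendZero hv x
  have hb := analyticAt_extendZero hw x
  set a := extendZero U (fun x => (v x : ℂ × ℂ).2)
  set b := extendZero U (fun x => (w x : ℂ × ℂ).2)
  have h1 : (groupoid hk).lieBracket U v w x =
      VectorField.lieBracket ℂ (fun p => ((0 : ℂ), a (tgt k p) * factor k p))
        (fun p => ((0 : ℂ), b (tgt k p) * factor k p)) ((x : ℂ), (0 : ℂ)) := by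
    unfold HolLieGroupoid.lieBracket
    refine (mlieBracket_eq_lieBracket _ _ _).trans ?_
    exact congrArg₂ (fun V W : ℂ × ℂ → ℂ × ℂ => VectorField.lieBracket ℂ V W ((x : ℂ), (0 : ℂ)))
      hV hW
  refine h1.trans ?_
  rw [VectorField.lieBracket_eq]
  simp only [key a ha, key b hb]
  refine Prod.ext (sub_self _) ?_
  simp only [tgt, factor, Prod.snd_sub, zero_mul, mul_zero, Complex.exp_zero, one_mul]
  ring

theorem mem_lieSections_iff {U : Opens ℂ}
    {v : (x : U) → TangentSpace 𝓘(ℂ, ℂ × ℂ) ((groupoid hk).one x)} :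
    v ∈ (groupoid hk).lieSections U ↔ (∀ x, (v x : ℂ × ℂ).1 = 0) ∧
      ContMDiff 𝓘(ℂ, ℂ) 𝓘(ℂ, ℂ) ω (fun x : U => (v x : ℂ × ℂ).2) := by
  have h1 : (∀ x : U, mfderiv 𝓘(ℂ, ℂ × ℂ) 𝓘(ℂ, ℂ) (groupoid hk).src
      ((groupoid hk).one x) (v x) = 0) ↔ ∀ x, (v x : ℂ × ℂ).1 = 0 :=
    forall_congr' fun x => by rw [mfderiv_src]; rfl
  refine (and_congr (holAlong_groupoid_iff hk) h1).trans ⟨fun h => ⟨h.2, ?_⟩, fun h => ⟨?_, h.1⟩⟩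
  · exact contDiff_snd.contMDiff.comp h.1
  · have h2 : (fun x : U => (v x : ℂ × ℂ)) = fun x : U => ((0 : ℂ), (v x : ℂ × ℂ).2) :=
      funext fun x => Prod.ext (h.1 x) rfl
    rw [h2]
    exact contMDiff_const.prodMk_space h.2

set_option synthInstance.maxHeartbeats 400000 in
/-- The anchor, as a map from sections of the Lie algebroid of the Stokes groupoid to vector
fields. -/
def sectionMap (U : Opens ℂ) :
    (groupoid hk).lieSections U →ₗ[holFun (EX := ℂ) U] twistedTangent k U where
  toFun v := ⟨fun z => (z : ℂ) ^ k * (v.1 z : ℂ × ℂ).2,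
    fun z => (v.1 z : ℂ × ℂ).2, ((mem_lieSections_iff hk).1 v.2).2, fun _ => rfl⟩
  map_add' _ _ := Subtype.ext (funext fun _ => mul_add _ _ _)
  map_smul' _ _ := Subtype.ext (funext fun _ => mul_left_comm _ _ _)

/-- Multiplication by `z^k` is injective on holomorphic functions: it is cancelled off `0`, and
continuity gives the value at `0`. Surjectivity is the definition of `twistedTangent`. -/
theorem bijective_sectionMap (U : Opens ℂ) : Function.Bijective (sectionMap hk U) := by
  constructor
  · intro v w hvw
    have hv := (mem_lieSections_iff hk).1 v.2
    have hw := (mem_lieSections_iff hk).1 w.2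
    have h : ∀ z : U, (z : ℂ) ^ k * (v.1 z : ℂ × ℂ).2 = (z : ℂ) ^ k * (w.1 z : ℂ × ℂ).2 :=
      fun z => congrFun (congrArg Subtype.val hvw) z
    refine Subtype.ext (funext fun z => Prod.ext ((hv.1 z).trans (hw.1 z).symm) ?_)
    have h1 := eq_of_eventuallyEq_punctured (analyticAt_extendZero hv.2 z).continuousAt
      (analyticAt_extendZero hw.2 z).continuousAt (by
        filter_upwards [eventually_punctured_ne_zero (z : ℂ),
          nhdsWithin_le_nhds (U.2.mem_nhds z.2)] with y h1 h2
        simp only [extendZero, dif_pos (show y ∈ U from h2)]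
        exact mul_left_cancel₀ (pow_ne_zero k h1) (h ⟨y, h2⟩))
    simpa [extendZero] using h1
  · rintro ⟨f, g, hg, hfg⟩
    refine ⟨⟨fun z => ((0 : ℂ), g z), (mem_lieSections_iff hk).2 ⟨fun _ => rfl, hg⟩⟩, ?_⟩
    exact Subtype.ext (funext fun z => (hfg z).symm)

/-- The terms that differentiate `z^k` cancel. One of the two remaining factors `z^k` is the anchor
and the other belongs to the bracket in `lieBracket_eq`. -/
theorem vfBracket_pow_mul {U : Opens ℂ} {a b : U → ℂ} (ha : ContMDiff 𝓘(ℂ, ℂ) 𝓘(ℂ, ℂ) ω a)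
    (hb : ContMDiff 𝓘(ℂ, ℂ) 𝓘(ℂ, ℂ) ω b) (z : U) :
    vfBracket U (fun z => (z : ℂ) ^ k * a z) (fun z => (z : ℂ) ^ k * b z) z =
      (z : ℂ) ^ k * ((z : ℂ) ^ k * (extendZero U a z * deriv (extendZero U b) z -
        deriv (extendZero U a) z * extendZero U b z)) := by
  have key : ∀ f : U → ℂ, extendZero U (fun z => (z : ℂ) ^ k * f z) =
      fun y => y ^ k * extendZero U f y := fun f => by
    funext y
    by_cases h : y ∈ U <;> simp [extendZero, h]
  have hd : ∀ f : ℂ → ℂ, DifferentiableAt ℂ f z → ∀ c : ℂ,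
      fderiv ℂ (fun y => y ^ k * f y) z c =
        c * (k * (z : ℂ) ^ (k - 1) * f z + (z : ℂ) ^ k * deriv f z) := fun f hf c => by
    have h1 := (hasDerivAt_pow k (z : ℂ)).mul hf.hasDerivAt
    have h2 := h1.hasFDerivAt.fderiv
    refine (DFunLike.congr_fun h2 c).trans ?_
    simp
  rw [vfBracket, key, key, VectorField.lieBracket_eq]
  simp only [hd _ (analyticAt_extendZero ha z).differentiableAt,
    hd _ (analyticAt_extendZero hb z).differentiableAt]
  ring

set_option synthInstance.maxHeartbeats 400000 in
/-- The Stokes groupoid integrates `𝒯(-k·0)`. -/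
def integration : (groupoid hk).Integration k where
  toEquiv U := LinearEquiv.ofBijective (sectionMap hk U) (bijective_sectionMap hk U)
  map_restrict U V hUV v w h z := congrArg (fun p : ℂ × ℂ => (z : ℂ) ^ k * p.2) (h z)
  map_anchor U v z := (anchor_eq hk z (v.1 z) (((mem_lieSections_iff hk).1 v.2).1 z)).symm
  map_bracket U v w := by
    have hv := (mem_lieSections_iff hk).1 v.2
    have hw := (mem_lieSections_iff hk).1 w.2
    have hb := lieBracket_eq hk U v.1 w.1 hv.2 hw.2 hv.1 hw.1
    refine ⟨⟨(groupoid hk).lieBracket U v.1 w.1, (mem_lieSections_iff hk).2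
      ⟨fun x => congrArg Prod.fst (hb x), fun x => ?_⟩⟩, rfl, funext fun z => ?_⟩
    · have h1 := analyticAt_extendZero hv.2 x
      have h2 := analyticAt_extendZero hw.2 x
      have h3 := ((analyticAt_id (𝕜 := ℂ) (z := (x : ℂ))).pow k).mul
        ((h1.mul h2.deriv).sub (h1.deriv.mul h2))
      refine (contMDiffAt_subtype_iff.2 h3.contDiffAt.contMDiffAt).congr_of_eventuallyEq ?_
      exact Filter.Eventually.of_forall fun y => congrArg Prod.snd (hb y)
    · exact (congrArg (fun p : ℂ × ℂ => (z : ℂ) ^ k * p.2) (hb z)).trans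
        (vfBracket_pow_mul hv.2 hw.2 z).symm

end Stokes
end

/-! ### The isomorphism with the explicit groupoid, and the theorem. -/

noncomputable section

/-- A Stokes groupoid is isomorphic to the one given by the explicit formulas. -/
def HolLieGroupoid.GlobalCoordinate.iso {E : Type*} [NormedAddCommGroup E] [NormedSpace ℂ E]
    [FiniteDimensional ℂ E] {G : Type*} [TopologicalSpace G] [T2Space G] [ChartedSpace E G]
    [IsManifold 𝓘(ℂ, E) ω G] {𝒢 : HolLieGroupoid E ℂ G ℂ} {k : ℕ} (c : GlobalCoordinate 𝒢 k)
    (hk : 1 ≤ k) (hsc : 𝒢.SourceSimplyConnected) : 𝒢.Iso (Stokes.groupoid hk) where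
  toDiffeomorph := c.diffeomorph hk hsc
  map_src _ := rfl
  map_tgt g := (c.tgt_eq g).symm
  map_one x := Prod.ext (𝒢.src_one x) (c.map_one x)
  map_mul g h hgh := Prod.ext (𝒢.src_mul g h hgh) (c.map_mul g h hgh)

end

theorem mainTheorem3 (k : ℕ) (hk : 1 ≤ k) :
    ∃ 𝒮 : HolLieGroupoid (ℂ × ℂ) ℂ (ℂ × ℂ) ℂ,
      (∀ z u : ℂ, 𝒮.src (z, u) = z) ∧
      (∀ z u : ℂ, 𝒮.tgt (z, u) = Complex.exp (u * z ^ (k - 1)) * z) ∧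
      (∀ z₁ u₁ z₂ u₂ : ℂ, 𝒮.src (z₂, u₂) = 𝒮.tgt (z₁, u₁) →
        𝒮.mul (z₂, u₂) (z₁, u₁) =
          (z₁, u₂ * Complex.exp (((k : ℂ) - 1) * u₁ * z₁ ^ (k - 1)) + u₁)) ∧
      𝒮.SourceSimplyConnected ∧
      Nonempty (𝒮.Integration k) ∧
      ∀ (E : Type*) [NormedAddCommGroup E] [NormedSpace ℂ E] [FiniteDimensional ℂ E]
        (G : Type*) [TopologicalSpace G] [T2Space G] [ChartedSpace E G]
        [IsManifold 𝓘(ℂ, E) ω G] (𝒢 : HolLieGroupoid E ℂ G ℂ),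
        𝒢.IsStokesGroupoid k → Nonempty (𝒢.Iso 𝒮) := by
  refine ⟨Stokes.groupoid hk, fun _ _ => rfl, fun _ _ => rfl, fun _ _ _ _ _ => rfl,
    Stokes.sourceSimplyConnected hk, ⟨Stokes.integration hk⟩, ?_⟩
  intro E _ _ _ G _ _ _ _ 𝒢 h𝒢
  obtain ⟨c⟩ := h𝒢.nonempty_globalCoordinate hk
  exact ⟨c.iso hk h𝒢.1⟩
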